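/- **Notation.** For $|p|,|q|<1$ let $(w;p,q)=\prod_{i,j\ge 0}(1-wp^iq^j)$ and let $\Gamma(w)=\Gamma(w;p,q)=\dfrac{(pq/w;p,q)}{(w;p,q)}$ be the elliptic gamma function; its poles are $p^{-i}q^{-j}$ and its zeros are $p^{i+1}q^{j+1}$ ($i,j\ge0$). Under the balancing condition $\prod_{r=1}^6t_r=pq$ the elliptic beta integral, with integrand $\prod_{r}\Gamma(t_rz)\Gamma(t_r/z)/(\Gamma(z^2)\Gamma(z^{-2}))$, has (up to the bounded factor $2/((p;p)(q;q))$) the value $\prod_{r<s}\Gamma(t_rt_s)$, and the rescaled integrand is $$IR(t;z)=\frac{\prod_{r=1}^6\Gamma(t_rz)\Gamma(t_r/z)}{\Gamma(z^2)\Gamma(z^{-2})\prod_{1\le r<s\le 6}\Gamma(t_rt_s)} .$$ Fix $q$ with $0<|q|<1$ and $x\neq0$, with chosen logarithms, and put $p=xq^v$ ($v\in\mathbb Z$), $p^c=x^cq^{vc}$. Let $\alpha\in\mathbb R^6$ with $\sum_r\alpha_r=1$, $\zeta\in\mathbb R$, $t_r=u_rp^{\alpha_r}$ with $u_r\in\mathbb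 C^*$, $\prod_r u_r=q$, and replace $z$ by $zp^{-\zeta}$. A real-valued function $fob(\alpha,\zeta)$ and a $\mathbb C^*$-valued function $sob(\alpha,\zeta;u,z)$ are called a *first and second order behavior* of $IR$ if for all $M,\varepsilon>0$ there are $C_1,C_2>0$ with $$C_1<\left|IR(up^{\alpha};zp^{-\zeta})\,q^{\frac12v^2fob(\alpha,\zeta)}\,sob(\alpha,\zeta;u,z)^v\right|<C_2$$ whenever $|\alpha_r|,|\zeta|\le M$, $\frac1M\le|u_r|,|z|\le M$, $|p|<|q|$ and the argument $w$ of each gamma function in $IR$ satisfies $|1-w/y|>\varepsilon$ for all poles and zeros $y$ of $\Gamma$. We call $\zeta$ *correct* for $\alpha$ if the integrand and the integral have the same first and second order behavior, that is, if there are first and second order behaviors of $IR$ with $fob(\alpha,\zeta)=0$ and $sob(\alpha,\zeta;u,z)=1$ for all $u,z$. Write $\zeta\sim c$ if $\zeta\in(c+\mathbb Z)\cup(-c+\mathbb Z)$. **Polytopes.** Let $e_r$ be the unit vectors of $\mathbb R^6$ and $\rho=(\frac12,\dots,\frac12)$. Let $\beta,\gamma\in\mathbb Z^6\cup(\mathbb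 Z^6+\rho)$ with $\sum\beta_r=0$, $\sum\gamma_r=2$, let $a\in\{1,\dots,6\}$ and let $T\subset\{1,\dots,6\}$ with $|T|=3$. The following are the convex hulls of the given points: $P_{I,\beta}$: $\beta+e_r$; $\hat P_{I,\gamma}$: $\gamma-e_r$ ($1\le r\le6$); $P_{II,\beta,a}$: $\beta+e_r$ and $\beta+\rho-e_a-e_r$ ($r\ne a$); and, for $\beta,\gamma\in\mathbb Z^6$, $P_{III,\beta,T}$: $\beta+e_r$ ($r\in T$) and $\beta+\rho-e_r-e_s$ ($r\neq s$, $r,s\notin T$); $\hat P_{III,\gamma,T}$: $\gamma-e_r$ ($r\in T$) and $\gamma-\rho+e_r+e_s$ ($r\ne s$, $r,s\notin T$). **Theorem.** 1. The $P_{II,\beta,a}$ are five-dimensional cross polytopes and the other polytopes are five-dimensional simplices. Together they tile the hyperplane $\sum_r\alpha_r=1$: their union is the hyperplane, and the relative interiors of any two differently labelled ones are disjoint. 2. $IR$ has a first and a second order behavior. Every first order behavior $fob$ satisfies $fob(\alpha,\zeta+1)=fob(\alpha,\zeta)=fob(\alpha,-\zeta)$, and the following table holds. | Polytope | $\zeta_0$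 | Integrand maximized | Integrand minimized | |---|---|---|---| | $P_{I,\beta}$, $\beta\in\mathbb Z^6$ | $0$ | $\frac12$ | $0$ | | $P_{I,\beta}$, $\beta\in\mathbb Z^6+\rho$ | $\frac12$ | $0$ | $\frac12$ | | $\hat P_{I,\gamma}$, $\gamma\in\mathbb Z^6$ | $0$ | $0$ | $\frac12$ | | $\hat P_{I,\gamma}$, $\gamma\in\mathbb Z^6+\rho$ | $\frac12$ | $\frac12$ | $0$ | | $P_{III,\beta,T}$ | $\sum_{r\in T}\alpha_r$ | $0$ or $\frac12$ | $\sum_{r\in T}\alpha_r$ | | $\hat P_{III,\gamma,T}$ | $\sum_{r\in T}\alpha_r$ | $\sum_{r\in T}\alpha_r$ | $0$ or $\frac12$ | | $P_{II,\beta,a}$, $\beta\in\mathbb Z^6$ | $\alpha_a$ | $\frac12$ | $0$ | | $P_{II,\beta,a}$, $\beta\in\mathbb Z^6+\rho$ | $\alpha_a$ | $0$ | $\frac12$ | 3. (Correct value.) On each closed polytope $fob(\alpha,\zeta_0)=0$, and for $\alpha$ in the interior $fob(\alpha,\zeta)=0$ if and only if $\zeta\sim\zeta_0$. For $\alpha$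 in a closed polytope of type $P_I,\hat P_I,P_{III},\hat P_{III}$, $\zeta$ is correct for $\alpha$ if and only if $\zeta\sim\zeta_0$. For $\alpha\in P_{II,\beta,a}$ put $b=\alpha-\beta$ and $E=-2b_a+\sum_{r\ne a}\min(0,b_r+b_a)$. There are first and second order behaviors of $IR$ with $fob(\alpha,\alpha_a)=0$ and $sob(\alpha,\alpha_a;u,z)=|u_az|^{E}$ for all $u,z$; and $\zeta$ is correct for $\alpha$ if and only if $\zeta\sim\alpha_a$ and $E=0$. 4. (Extrema.) For $\alpha$ in a closed polytope, $\zeta\mapsto fob(\alpha,\zeta)$ attains its maximum over $\mathbb R$ at the value in the column "maximized" and its minimum at the value in the column "minimized" (for an entry "$0$ or $\frac12$": at at least one of these two). For $\alpha$ in the interior of the polytope, the maxima and minima in $[0,\frac12]$ are exactly the following, where $H(y)=[\min(\frac12,1-y),\frac12]$, $L(y)=[0,\max(0,y)]$ and, in the rows with $\mathbb Z^6+\rho$, $\zeta$ has to be replaced by $\frac12-\zeta$. - $P_{I,\beta}$: maximum on $H(\max_r(\alpha_r-\beta_r))$, minimum only at $0$. - $\hat P_{I,\gamma}$: maximum only at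 $0$, minimum on $H(\max_r(\gamma_r-\alpha_r))$. - $P_{II,\beta,a}$: maximum on $H(\max_r(\alpha_r-\beta_r))$, minimum on $L(\max_{r\neq a}(\beta_r-\alpha_r))$. - $P_{III,\beta,T}$: minimum only at the $\zeta\sim\sum_{r\in T}\alpha_r$; maximum on $L(\max_{r\notin T}(\alpha_r-\beta_r))$ if $fob(\alpha,0)>fob(\alpha,\frac12)$, on $H(\max_{r\in T}(\alpha_r-\beta_r))$ if $fob(\alpha,0)<fob(\alpha,\frac12)$, and on the union of both if these are equal. - $\hat P_{III,\gamma,T}$: maximum only at the $\zeta\sim\sum_{r\in T}\alpha_r$; minimum on $L(\max_{r\notin T}(\gamma_r-\alpha_r))$ if $fob(\alpha,0)<fob(\alpha,\frac12)$, on $H(\max_{r\in T}(\gamma_r-\alpha_r))$ if $fob(\alpha,0)>fob(\alpha,\frac12)$, and on the union of both if these are equal. -/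

import Mathlib

open scoped BigOperators
open Set

noncomputable section

namespace BetaTiling

/-! ### The elliptic gamma function and the rescaled integrand -/

/-- The double product `(w; p, q) = ∏_{i,j ≥ 0} (1 - w p^i q^j)`. -/
def pqSymbol (p q w : ℂ) : ℂ := ∏' ij : ℕ × ℕ, (1 - w * p ^ ij.1 * q ^ ij.2)

/-- The elliptic gamma function `Γ(w; p, q) = (pq/w; p, q) / (w; p, q)`. -/
def ellGamma (p q w : ℂ) : ℂ := pqSymbol p q (p * q / w) / pqSymbol p q w

/-- `w` stays at relative distance more than `ε` from the poles `p^{-i} q^{-j}` and from the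
zeros `p^{i+1} q^{j+1}` of the elliptic gamma function (`i, j ≥ 0`): `|1 - w/y| > ε` for each
such point `y`. -/
def Away (ε : ℝ) (p q w : ℂ) : Prop :=
  ∀ i j : ℕ, ε < ‖1 - w * (p ^ i * q ^ j)‖ ∧ ε < ‖1 - w / (p ^ (i + 1) * q ^ (j + 1))‖

/-- The pairs `r < s` of indices. -/
def pairs : Finset (Fin 6 × Fin 6) := Finset.univ.filter fun rs => rs.1 < rs.2

/-- The integrand `∏_r Γ(t_r z) Γ(t_r / z) / (Γ(z²) Γ(z⁻²))` of the elliptic beta integral. -/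
def integrand (p q : ℂ) (t : Fin 6 → ℂ) (z : ℂ) : ℂ :=
  (∏ r, ellGamma p q (t r * z) * ellGamma p q (t r / z)) /
    (ellGamma p q (z ^ 2) * ellGamma p q (1 / z ^ 2))

/-- The value `∏_{r<s} Γ(t_r t_s)` of the elliptic beta integral. -/
def betaValue (p q : ℂ) (t : Fin 6 → ℂ) : ℂ :=
  ∏ rs ∈ pairs, ellGamma p q (t rs.1 * t rs.2)

/-- The integrand, rescaled by the value of the integral. -/
def rescaledIntegrand (p q : ℂ) (t : Fin 6 → ℂ) (z : ℂ) : ℂ :=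
  integrand p q t z / betaValue p q t

/-- All the gamma functions in the rescaled integrand are evaluated at points that stay at
relative distance more than `ε` from their poles and zeros. -/
def Regular (ε : ℝ) (p q : ℂ) (t : Fin 6 → ℂ) (z : ℂ) : Prop :=
  (∀ r, Away ε p q (t r * z) ∧ Away ε p q (t r / z)) ∧
  (∀ r s, r < s → Away ε p q (t r * t s)) ∧
  Away ε p q (z ^ 2) ∧ Away ε p q (1 / z ^ 2)

/-- `pPow lq lx v c = p^c` for `p = x q^v`, where `lx`, `lq` are the chosen logarithms of `x`
and `q`. -/
def pPow (lq lx : ℂ) (v : ℤ) (c : ℝ) : ℂ := Complex.exp (c * (lx + v * lq))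

/-- `fob` and `sob` are a first and a second order behavior of the rescaled integrand with
`t_r = u_r p^{α_r}` and `z` replaced by `z p^{-ζ}`, where `p = x q^v`, `x = exp lx`,
`q = exp lq`, and where `∑ α_r = 1`, `∏ u_r = q`:
`C₁ < |IR · q^{v² fob(α,ζ) / 2} · sob(α,ζ;u,z)^v| < C₂`, uniformly on bounded sets of `α, ζ` and
on compact annuli of `u, z`, away from the poles and zeros. -/
def IsOrderBehavior (lq lx : ℂ) (fob : (Fin 6 → ℝ) → ℝ → ℝ)
    (sob : (Fin 6 → ℝ) → ℝ → (Fin 6 → ℂ) → ℂ → ℂ) : Prop :=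
  (∀ α ζ u z, (∀ r, u r ≠ 0) → z ≠ 0 → sob α ζ u z ≠ 0) ∧
  ∀ M > (0 : ℝ), ∀ ε > (0 : ℝ), ∃ C₁ > (0 : ℝ), ∃ C₂ > (0 : ℝ),
    ∀ (α : Fin 6 → ℝ) (ζ : ℝ) (u : Fin 6 → ℂ) (z : ℂ) (v : ℤ),
      ∑ r, α r = 1 → (∀ r, |α r| ≤ M) → |ζ| ≤ M →
      ∏ r, u r = Complex.exp lq → (∀ r, 1 / M ≤ ‖u r‖ ∧ ‖u r‖ ≤ M) →
      1 / M ≤ ‖z‖ → ‖z‖ ≤ M →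
      ‖pPow lq lx v 1‖ < ‖Complex.exp lq‖ →
      Regular ε (pPow lq lx v 1) (Complex.exp lq) (fun r => u r * pPow lq lx v (α r))
        (z * pPow lq lx v (-ζ)) →
      C₁ < ‖rescaledIntegrand (pPow lq lx v 1) (Complex.exp lq)
              (fun r => u r * pPow lq lx v (α r)) (z * pPow lq lx v (-ζ)) *
            Complex.exp (lq * ((v : ℂ) ^ 2 * (fob α ζ : ℂ) / 2)) * sob α ζ u z ^ v‖ ∧
      ‖rescaledIntegrand (pPow lq lx v 1) (Complex.exp lq)
              (fun r => u r * pPow lq lx v (α r)) (z * pPow lq lx v (-ζ)) *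
            Complex.exp (lq * ((v : ℂ) ^ 2 * (fob α ζ : ℂ) / 2)) * sob α ζ u z ^ v‖ < C₂

/-- `ζ` is a correct value for `α`: the integrand and the integral have the same first and second
order behavior, i.e. the rescaled integrand has first order behavior `0` and, for all parameters
`u` and `z`, second order behavior `1`. -/
def IsCorrect (lq lx : ℂ) (α : Fin 6 → ℝ) (ζ : ℝ) : Prop :=
  ∃ fob sob, IsOrderBehavior lq lx fob sob ∧ fob α ζ = 0 ∧
    ∀ (u : Fin 6 → ℂ) (z : ℂ), (∀ r, u r ≠ 0) → z ≠ 0 → sob α ζ u z = 1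

/-! ### The tiles -/

/-- The standard unit vectors. -/
def e (r : Fin 6) : Fin 6 → ℝ := Pi.single r 1

/-- The vector `(1/2, …, 1/2)`. -/
def rho : Fin 6 → ℝ := fun _ => 1 / 2

/-- `β ∈ ℤ⁶`. -/
def IsIntVec (β : Fin 6 → ℝ) : Prop := ∃ k : Fin 6 → ℤ, ∀ r, β r = k r

/-- `β ∈ ℤ⁶ ∪ (ℤ⁶ + ρ)`. -/
def InLattice (β : Fin 6 → ℝ) : Prop := IsIntVec β ∨ IsIntVec (β - rho)

/-- Labels of the polytopes `P_{I,β}`, `P̂_{I,γ}`, `P_{II,β,a}`, `P_{III,β,T}`, `P̂_{III,γ,T}`. -/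
inductive Tile : Type
  | one (β : Fin 6 → ℝ)
  | oneHat (γ : Fin 6 → ℝ)
  | two (β : Fin 6 → ℝ) (a : Fin 6)
  | three (β : Fin 6 → ℝ) (T : Finset (Fin 6))
  | threeHat (γ : Fin 6 → ℝ) (T : Finset (Fin 6))

namespace Tile

/-- The labels that occur in the tiling. -/
def Admissible : Tile → Prop
  | one β => InLattice β ∧ ∑ r, β r = 0
  | oneHat γ => InLattice γ ∧ ∑ r, γ r = 2
  | two β _ => InLattice β ∧ ∑ r, β r = 0
  | three β T => IsIntVec β ∧ ∑ r, β r = 0 ∧ T.card = 3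
  | threeHat γ T => IsIntVec γ ∧ ∑ r, γ r = 2 ∧ T.card = 3

/-- The vertices of the polytopes. -/
def vertices : Tile → Set (Fin 6 → ℝ)
  | one β => {x | ∃ r, x = β + e r}
  | oneHat γ => {x | ∃ r, x = γ - e r}
  | two β a => {x | ∃ r, r ≠ a ∧ (x = β + e r ∨ x = β + rho - e a - e r)}
  | three β T => {x | (∃ r ∈ T, x = β + e r) ∨
      ∃ r s, r ∉ T ∧ s ∉ T ∧ r ≠ s ∧ x = β + rho - e r - e s}
  | threeHat γ T => {x | (∃ r ∈ T, x = γ - e r) ∨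
      ∃ r s, r ∉ T ∧ s ∉ T ∧ r ≠ s ∧ x = γ - rho + e r + e s}

/-- The polytope. -/
def body (t : Tile) : Set (Fin 6 → ℝ) := convexHull ℝ t.vertices

/-- The interior of the polytope relative to the hyperplane that it spans. -/
def inner (t : Tile) : Set (Fin 6 → ℝ) := intrinsicInterior ℝ t.body

/-- The polytopes of type II are five-dimensional cross polytopes, the others are
five-dimensional simplices. -/
def HasShape : Tile → Prop
  | two β a => ∃ (c : Fin 6 → ℝ) (w : Fin 5 → Fin 6 → ℝ), LinearIndependent ℝ w ∧
      (two β a).vertices = {x | ∃ i, x = c + w i ∨ x = c - w i}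
  | t => t.vertices.ncard = 6 ∧ AffineIndependent ℝ ((↑) : t.vertices → (Fin 6 → ℝ))

end Tile

/-! ### The entries of the table -/

open Classical in
/-- `ζ` for `β ∈ ℤ⁶` and `1/2 - ζ` for `β ∈ ℤ⁶ + ρ`. -/
def swapHalf (β : Fin 6 → ℝ) (ζ : ℝ) : ℝ := if IsIntVec β then ζ else 1 / 2 - ζ

/-- `ζ` and `c` agree modulo the symmetries `ζ → ζ + 1` and `ζ → -ζ`. -/
def Equivalent (ζ c : ℝ) : Prop := ∃ n : ℤ, ζ = n + c ∨ ζ = n - c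

/-- The number `-2 b_a + ∑_{r ≠ a, b_r + b_a < 0} (b_r + b_a)`, with `b = α - β`. -/
def excess (β : Fin 6 → ℝ) (a : Fin 6) (α : Fin 6 → ℝ) : ℝ :=
  -2 * (α a - β a) +
    ∑ r ∈ Finset.univ.erase a, min 0 ((α r - β r) + (α a - β a))

/-- For `0 ≤ ζ ≤ 1/2`: `ζ` lies in the interval `[0, max(0, max_{r ∈ s} x_r)]`. -/
def LowEnd (s : Set (Fin 6)) (x : Fin 6 → ℝ) (ζ : ℝ) : Prop := ζ = 0 ∨ ∃ r ∈ s, ζ ≤ x r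

/-- For `0 ≤ ζ ≤ 1/2`: `ζ` lies in the interval `[min(1/2, 1 - max_{r ∈ s} x_r), 1/2]`. -/
def HighEnd (s : Set (Fin 6)) (x : Fin 6 → ℝ) (ζ : ℝ) : Prop :=
  ζ = 1 / 2 ∨ ∃ r ∈ s, 1 - x r ≤ ζ

namespace Tile

/-- The column `correct ζ`. -/
def correctZeta : Tile → (Fin 6 → ℝ) → ℝ
  | one β, _ => swapHalf β 0
  | oneHat γ, _ => swapHalf γ 0
  | two _ a, α => α a
  | three _ T, α => ∑ r ∈ T, α r
  | threeHat _ T, α => ∑ r ∈ T, α r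

/-- The condition under which the tabulated `ζ` has the correct second order behavior. -/
def SecondOrderCondition : Tile → (Fin 6 → ℝ) → Prop
  | two β a, α => excess β a α = 0
  | _, _ => True

/-- The column `integrand maximized`. -/
def maxTable : Tile → (Fin 6 → ℝ) → Set ℝ
  | one β, _ => {swapHalf β (1 / 2)}
  | oneHat γ, _ => {swapHalf γ 0}
  | two β _, _ => {swapHalf β (1 / 2)}
  | three _ _, _ => {0, 1 / 2}
  | threeHat _ T, α => {∑ r ∈ T, α r}

/-- The column `integrand minimized`. -/
def minTable : Tile → (Fin 6 → ℝ) → Set ℝ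
  | one β, _ => {swapHalf β 0}
  | oneHat γ, _ => {swapHalf γ (1 / 2)}
  | two β _, _ => {swapHalf β 0}
  | three _ T, α => {∑ r ∈ T, α r}
  | threeHat _ _, _ => {0, 1 / 2}

/-- For `0 ≤ ζ ≤ 1/2` and `α` in the interior of the tile: the exact description of the locations
of the maximum of `f = fob(α, ·)`. -/
def MaxAt : Tile → (Fin 6 → ℝ) → (ℝ → ℝ) → ℝ → Prop
  | one β, α, _, ζ => HighEnd univ (α - β) (swapHalf β ζ)
  | oneHat γ, _, _, ζ => ζ = swapHalf γ 0
  | two β _, α, _, ζ => HighEnd univ (α - β) (swapHalf β ζ)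
  | three β T, α, f, ζ => (f (1 / 2) ≤ f 0 ∧ LowEnd {r | r ∉ T} (α - β) ζ) ∨
      (f 0 ≤ f (1 / 2) ∧ HighEnd {r | r ∈ T} (α - β) ζ)
  | threeHat _ T, α, _, ζ => Equivalent ζ (∑ r ∈ T, α r)

/-- For `0 ≤ ζ ≤ 1/2` and `α` in the interior of the tile: the exact description of the locations
of the minimum of `f = fob(α, ·)`. -/
def MinAt : Tile → (Fin 6 → ℝ) → (ℝ → ℝ) → ℝ → Prop
  | one β, _, _, ζ => ζ = swapHalf β 0
  | oneHat γ, α, _, ζ => HighEnd univ (γ - α) (swapHalf γ ζ)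
  | two β a, α, _, ζ => LowEnd {r | r ≠ a} (β - α) (swapHalf β ζ)
  | three _ T, α, _, ζ => Equivalent ζ (∑ r ∈ T, α r)
  | threeHat γ T, α, f, ζ => (f 0 ≤ f (1 / 2) ∧ LowEnd {r | r ∉ T} (γ - α) ζ) ∨
      (f (1 / 2) ≤ f 0 ∧ HighEnd {r | r ∈ T} (γ - α) ζ)

end Tile

end BetaTiling

end

namespace BetaTiling

/-! ### Size of the double product -/

/-! Write |p| = |q|^P, so that P = v + log|x| / log|q|. Away from X = 1, log|1 - X| equals max(0,
log|X|) up to an error that decays like exp(-|log|X||). The logarithm of a double product is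
therefore, up to a bounded error, a sum of positive parts of arithmetic progressions, and log|Γ(u
p^a)| is a quadratic polynomial in P (`exists_log_norm_ellGamma_bound`). Its coefficients are made
from B(a) - B({a}) and C(a) - C({a}), where {a} is the fractional part, B is a cubic with B(a+1) -
B(a) = a², and C = B'/2. In the rescaled integrand the polynomial parts cancel, up to a constant,
because the exponents sum to 1 and the u_r multiply to q. What remains are two functions F =
`firstOrder` and Q = `secondOrder` of fractional parts (`exists_log_norm_rescaledIntegrand_bound`).

So F, together with any `sob` of modulus exp(log|x| F + Q), is an order behavior. Conversely,
regular points exist for arbitrarily large v (`exists_regular`). Comparing v with 2v at the same u,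
z shows that every first order behavior equals F on the hyperplane. Since Q is affine in (log|u_r|,
log|z|), ζ is correct exactly when F = 0 and Q vanishes for all admissible log|u_r|, log|z|
(`isCorrect_iff`). The rest is elementary geometry and calculus of F and Q.

Tiling: the vertices lie in the integral and half-integral points of the hyperplane, and each
polytope has an empty circumscribed sphere: all these points have nonnegative power
(`Tile.power_nonneg`). The difference of the powers of two polytopes is affine and separates them.
If the interiors met, it would vanish on all vertices, the two centers would agree up to a multiple
of (1,…,1), and an integrality argument makes the labels equal (`Tile.disjoint_inner`). That the
polytopes cover is checked after sorting the fractional parts of the coordinates (`covered_sorted`).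

Table: translating α by an integral vector does not change F, translating by ρ shifts ζ by 1/2, and
α → -α changes the sign of F. This leaves three model shapes with b = ±(α - β). On 0 ≤ ζ ≤ 1/2, F is
then a continuously differentiable piecewise quadratic function. The sign of its derivative shows
that F increases from 0 on the first simplex, increases through 0 at -b_a on the cross polytope, and
decreases to 0 and then increases on the third simplex. Inside the polytope the intervals of
constancy at the ends are exactly those in the list of extrema. On a closed polytope F may vanish at
further ζ, but Q, tested on a few choices of log|u_r| and log|z|, vanishes identically for at most
the tabulated ζ (`Tile.eq_baseZeta`). On the cross polytope its value there is the excess E times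
log|u_a z|. -/

lemma abs_log_norm_one_sub_le {X : ℂ} (h : ‖X‖ ≤ 1 / 2) : |Real.log ‖1 - X‖| ≤ 2 * ‖X‖ := by
  have h0 := norm_nonneg X
  have h1 : 1 - ‖X‖ ≤ ‖1 - X‖ := by simpa using norm_sub_norm_le (1 : ℂ) X
  have h2 : ‖1 - X‖ ≤ 1 + ‖X‖ := by simpa using norm_sub_le (1 : ℂ) X
  have hp : 0 < ‖1 - X‖ := by linarith
  rw [abs_le]
  constructor
  · have h3 := Real.one_sub_inv_le_log_of_pos hp
    have h4 : ‖1 - X‖⁻¹ ≤ 1 + 2 * ‖X‖ := by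
      rw [inv_le_iff_one_le_mul₀ hp]
      nlinarith
    linarith
  · have := Real.log_le_sub_one_of_pos hp
    linarith

/-- Since 1 - X = -X (1 - 1/X), the difference between log|1 - X| and its tropical approximation is
invariant under X → 1/X. This reduces large |X| to small |X|. -/
lemma log_norm_one_sub_eq {X : ℂ} (hX : X ≠ 0) (h : 1 - 1 / X ≠ 0) :
    1 - X ≠ 0 ∧ Real.log ‖1 - X‖ - max 0 (Real.log ‖X‖) =
      Real.log ‖1 - 1 / X‖ - max 0 (Real.log ‖1 / X‖) := by
  have e1 : 1 - X = -(X * (1 - 1 / X)) := by field_simp; ring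
  have hn : 1 - X ≠ 0 := by rw [e1]; exact neg_ne_zero.2 (mul_ne_zero hX h)
  refine ⟨hn, ?_⟩
  rw [e1, norm_neg, norm_mul, Real.log_mul (norm_ne_zero_iff.2 hX) (norm_ne_zero_iff.2 h),
    norm_div, norm_one, one_div ‖X‖, Real.log_inv]
  rcases le_total 0 (Real.log ‖X‖) with h0 | h0
  · rw [max_eq_right h0, max_eq_left (by linarith)]; ring
  · rw [max_eq_left h0, max_eq_right (by linarith)]; ring

/-- Decay for small |X| comes from the Taylor bound, for large |X| from inversion, and on the
annulus between a constant suffices. The hypothesis allows distance from 1 for X or for 1/X because,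
for the numerator pq/w of the gamma function, the regularity condition controls the inverse of the
factor. -/
theorem exists_log_norm_one_sub_bound {ε : ℝ} (hε : 0 < ε) : ∃ C : ℝ, 0 ≤ C ∧
    ∀ X : ℂ, X ≠ 0 → (ε < ‖1 - X‖ ∨ ε < ‖1 - 1 / X‖) → 1 - X ≠ 0 ∧
      |Real.log ‖1 - X‖ - max 0 (Real.log ‖X‖)| ≤ C * Real.exp (-|Real.log ‖X‖|) := by
  -- The factor 2 compensates for the weight exp(-|log|X||) ≥ 1/2 on the annulus; the final summand
  -- 2 serves the range |X| ≤ 1/2.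
  set C : ℝ := 2 * (|Real.log ε| + Real.log 3 + Real.log 2) + 2 with hC
  have hl2 : 0 < Real.log 2 := Real.log_pos (by norm_num)
  have hl3 : 0 < Real.log 3 := Real.log_pos (by norm_num)
  have hC2 : 2 ≤ C := by have := abs_nonneg (Real.log ε); linarith
  have small : ∀ X : ℂ, X ≠ 0 → ‖X‖ ≤ 1 / 2 →
      |Real.log ‖1 - X‖ - max 0 (Real.log ‖X‖)| ≤ C * Real.exp (-|Real.log ‖X‖|) := by
    intro X hX h
    have hp := norm_pos_iff.2 hX
    have hl : Real.log ‖X‖ ≤ 0 := Real.log_nonpos hp.le (by linarith)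
    rw [max_eq_left hl, abs_of_nonpos hl, neg_neg, Real.exp_log hp, sub_zero]
    exact (abs_log_norm_one_sub_le h).trans (by gcongr)
  have base : ∀ X : ℂ, X ≠ 0 → ε < ‖1 - X‖ → 1 - X ≠ 0 ∧
      |Real.log ‖1 - X‖ - max 0 (Real.log ‖X‖)| ≤ C * Real.exp (-|Real.log ‖X‖|) := by
    intro X hX h
    have hn : 1 - X ≠ 0 := norm_pos_iff.1 (hε.trans h)
    refine ⟨hn, ?_⟩
    have hp := norm_pos_iff.2 hX
    rcases le_total ‖X‖ (1 / 2) with h1 | h1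
    · exact small X hX h1
    rcases le_total ‖X‖ 2 with h2 | h2
    · have e1 : |Real.log ‖X‖| ≤ Real.log 2 := by
        rw [abs_le]
        constructor
        · rw [← Real.log_inv]; exact Real.log_le_log (by norm_num) (by linarith)
        · exact Real.log_le_log hp h2
      have e2 : 1 / 2 ≤ Real.exp (-|Real.log ‖X‖|) := by
        have : Real.exp (-Real.log 2) ≤ Real.exp (-|Real.log ‖X‖|) :=
          Real.exp_le_exp.2 (by linarith)
        rw [Real.exp_neg, Real.exp_log (by norm_num)] at this
        linarith
      have e3 : |Real.log ‖1 - X‖| ≤ |Real.log ε| + Real.log 3 := by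
        have h3 : ‖1 - X‖ ≤ 3 := by
          have : ‖1 - X‖ ≤ 1 + ‖X‖ := by simpa using norm_sub_le (1 : ℂ) X
          linarith
        rw [abs_le]
        constructor
        · have := Real.log_le_log hε h.le
          have := neg_abs_le (Real.log ε)
          linarith
        · have := Real.log_le_log (hε.trans h) h3
          have := abs_nonneg (Real.log ε)
          linarith
      have e4 : |max 0 (Real.log ‖X‖)| ≤ Real.log 2 := by
        rw [abs_of_nonneg (le_max_left _ _)]
        exact max_le hl2.le ((le_abs_self _).trans e1)
      have e5 := abs_sub (Real.log ‖1 - X‖) (max 0 (Real.log ‖X‖))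
      nlinarith
    · have hY : ‖1 / X‖ ≤ 1 / 2 := by
        rw [norm_div, norm_one]; gcongr
      have hY0 : 1 / X ≠ 0 := one_div_ne_zero hX
      have hYn : 1 - 1 / X ≠ 0 := by
        intro h0
        rw [← sub_eq_zero.1 h0] at hY
        norm_num at hY
      have key := (log_norm_one_sub_eq hX hYn).2
      have := small _ hY0 hY
      rw [key]
      rwa [norm_div, norm_one, one_div ‖X‖, Real.log_inv, abs_neg, ← Real.log_inv,
        ← one_div ‖X‖, ← norm_one (α := ℂ), ← norm_div] at this
  refine ⟨C, by linarith, fun X hX h => ?_⟩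
  rcases h with h | h
  · exact base X hX h
  · have hY0 : 1 / X ≠ 0 := one_div_ne_zero hX
    obtain ⟨hn, hb⟩ := base _ hY0 h
    obtain ⟨h1, h2⟩ := log_norm_one_sub_eq hX hn
    refine ⟨h1, ?_⟩
    rw [h2]
    rwa [norm_div (1 : ℂ) X, norm_one, one_div ‖X‖, Real.log_inv, abs_neg, ← Real.log_inv,
      ← one_div ‖X‖, ← norm_one (α := ℂ), ← norm_div] at hb

/-! ### Sums over one row of the double product -/

/-- A bound for the sums of `exp (-|t - j m|)` over `j`, uniform in `t`. -/
noncomputable def rowBound (m : ℝ) : ℝ := Real.exp m * ∑' k : ℤ, Real.exp (-(m * |(k : ℝ)|))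

lemma summable_exp_abs {m : ℝ} (hm : 0 < m) :
    Summable fun k : ℤ => Real.exp (-(m * |(k : ℝ)|)) := by
  have h : Summable fun n : ℕ => Real.exp (-(m * n)) := by
    have := Real.summable_exp_nat_mul_iff.2 (neg_neg_of_pos hm)
    refine this.congr fun n => ?_
    congr 1; ring
  refine Summable.of_nat_of_neg ?_ ?_
  · simpa using h
  · simpa using h

/-- Replacing t by the nearest lower multiple of m costs a factor at most exp m and turns the sum
into part of a fixed two-sided geometric series. Independence of t is what makes the later bounds
uniform in v and the parameters. -/
lemma summable_row {m : ℝ} (hm : 0 < m) (t : ℝ) :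
    Summable (fun j : ℕ => Real.exp (-|t - j * m|)) ∧
      ∑' j : ℕ, Real.exp (-|t - j * m|) ≤ rowBound m := by
  set n : ℤ := ⌊t / m⌋
  have hle : ∀ j : ℕ, Real.exp (-|t - j * m|) ≤
      Real.exp m * Real.exp (-(m * |(((j : ℤ) - n : ℤ) : ℝ)|)) := by
    intro j
    rw [← Real.exp_add, Real.exp_le_exp]
    have h1 : (n : ℝ) * m ≤ t := by
      have := Int.floor_le (t / m); rwa [le_div_iff₀ hm] at this
    have h2 : t < (n + 1) * m := by
      have := Int.lt_floor_add_one (t / m); rwa [div_lt_iff₀ hm] at this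
    have h3 : m * |(((j : ℤ) - n : ℤ) : ℝ)| = |j * m - n * m| := by
      rw [← abs_of_pos hm, ← abs_mul, abs_of_pos hm]; push_cast; ring_nf
    rw [h3]
    have h4 : |(j : ℝ) * m - n * m| ≤ |t - j * m| + |t - n * m| := by
      have := abs_sub (t - n * m) (t - j * m)
      calc |(j : ℝ) * m - n * m| = |(t - n * m) - (t - j * m)| := by ring_nf
        _ ≤ _ := by linarith
    have h5 : |t - n * m| ≤ m := by rw [abs_le]; constructor <;> nlinarith
    linarith
  have hinj : Function.Injective fun j : ℕ => (j : ℤ) - n := by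
    intro a b h; simpa using h
  have hs := (summable_exp_abs hm).comp_injective hinj
  have hs' := hs.mul_left (Real.exp m)
  have hsum : Summable (fun j : ℕ => Real.exp (-|t - j * m|)) :=
    Summable.of_nonneg_of_le (fun _ => (Real.exp_pos _).le) hle hs'
  refine ⟨hsum, (hsum.tsum_le_tsum hle hs').trans ?_⟩
  rw [tsum_mul_left, rowBound]
  gcongr
  exact tsum_comp_le_tsum_of_inj (summable_exp_abs hm) (fun _ => (Real.exp_pos _).le) hinj

lemma tsum_max_sub_bound {m : ℝ} (hm : 0 < m) (t : ℝ) :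
    Summable (fun j : ℕ => max 0 (t - j * m)) ∧
      |∑' j : ℕ, max 0 (t - j * m) - m * ((max 0 (t / m) ^ 2 + max 0 (t / m)) / 2)| ≤ m := by
  rcases lt_or_ge t 0 with ht | ht
  · have h0 : ∀ j : ℕ, max 0 (t - j * m) = 0 := fun j => max_eq_left (by
      have : 0 ≤ (j : ℝ) * m := by positivity
      linarith)
    simp only [h0, tsum_zero, max_eq_left (div_nonpos_of_nonpos_of_nonneg ht.le hm.le)]
    refine ⟨summable_zero, ?_⟩
    simpa using hm.le
  · set n : ℕ := ⌊t / m⌋₊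
    have hy : 0 ≤ t / m := by positivity
    have h1 : (n : ℝ) ≤ t / m := Nat.floor_le hy
    have h2 : t / m < n + 1 := Nat.lt_floor_add_one _
    have ht' : t = t / m * m := by field_simp
    have hz : ∀ j ∉ Finset.range (n + 1), max 0 (t - j * m) = 0 := by
      intro j hj
      have : ((n + 1 : ℕ) : ℝ) ≤ j := by exact_mod_cast not_lt.1 (mt Finset.mem_range.2 hj)
      push_cast at this
      refine max_eq_left ?_
      nlinarith
    refine ⟨summable_of_ne_finset_zero hz, ?_⟩
    rw [tsum_eq_sum hz, max_eq_right hy]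
    have hs : ∀ k : ℕ, k ≤ n + 1 → ∑ j ∈ Finset.range k, max 0 (t - j * m) =
        m * (k * (t / m) - k * (k - 1) / 2) := by
      intro k
      induction k with
      | zero => simp
      | succ k ih =>
        intro hk
        rw [Finset.sum_range_succ, ih (by omega), max_eq_right]
        · push_cast
          conv_lhs => enter [2]; rw [ht']
          ring
        · have : (k : ℝ) ≤ n := by exact_mod_cast (by omega : k ≤ n)
          nlinarith
    rw [hs (n + 1) le_rfl, ← mul_sub, abs_mul, abs_of_pos hm]
    push_cast
    generalize t / m = y at *
    -- With n the integer part of y, the quantity inside equals (y - n)(n + 1 - y)/2.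
    have : |((n : ℝ) + 1) * y - (n + 1) * (n + 1 - 1) / 2 - (y ^ 2 + y) / 2| ≤ 1 := by
      rw [abs_le]; constructor <;> nlinarith [mul_nonneg (sub_nonneg.2 h1) (sub_nonneg.2 h2.le)]
    nlinarith

/-- Expanding (x² + x)/2 at x = -bP - κ leaves only terms in κ after the powers of P are removed.
The positive part changes at x = 0 instead of at b = 0, but between the two places |bP| ≤ |κ|, so
the discrepancy is bounded independently of P. -/
lemma abs_quadratic_sub_le (κ b P : ℝ) (hP : 0 ≤ P) :
    |(max 0 (-(κ + b * P)) ^ 2 + max 0 (-(κ + b * P))) / 2 -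
      (P ^ 2 * max 0 (-b) ^ 2 + P * (1 - 2 * κ) * max 0 (-b)) / 2| ≤ 2 * κ ^ 2 + |κ| := by
  rcases le_total b 0 with hb | hb
  · rw [max_eq_right (by linarith : (0 : ℝ) ≤ -b)]
    have ht : 0 ≤ -b * P := mul_nonneg (by linarith) hP
    obtain ⟨t, h⟩ : ∃ t, t = -b * P := ⟨_, rfl⟩
    rw [← h] at ht
    have e1 : -(κ + b * P) = t - κ := by rw [h]; ring
    have e2 : (P ^ 2 * (-b) ^ 2 + P * (1 - 2 * κ) * -b) / 2 = (t ^ 2 + t - 2 * t * κ) / 2 := by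
      rw [h]; ring
    rw [e1, e2]
    have := neg_abs_le κ
    have := le_abs_self κ
    rcases le_total κ t with h1 | h1
    · rw [max_eq_right (by linarith), abs_le]
      constructor <;> nlinarith [sq_nonneg κ]
    · rw [max_eq_left (by linarith), abs_le]
      constructor <;> nlinarith [sq_nonneg κ, mul_nonneg ht (sub_nonneg.2 h1)]
  · rw [max_eq_left (by linarith : -b ≤ (0 : ℝ))]
    have ht : 0 ≤ b * P := mul_nonneg hb hP
    have h0 : 0 ≤ max 0 (-(κ + b * P)) := le_max_left _ _
    have h1 : max 0 (-(κ + b * P)) ≤ |κ| :=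
      max_le (abs_nonneg _) (by linarith [neg_abs_le κ])
    have := sq_abs κ
    rw [abs_le]
    constructor <;> nlinarith [sq_nonneg κ]

/-- The sum of the squares of the negative parts of `a + i`. -/
noncomputable def negSq (N : ℕ) (a : ℝ) : ℝ := ∑ i ∈ Finset.range N, max 0 (-(a + i)) ^ 2

/-- The sum of the negative parts of `a + i`. -/
noncomputable def negLin (N : ℕ) (a : ℝ) : ℝ := ∑ i ∈ Finset.range N, max 0 (-(a + i))

lemma log_norm_pqSymbol {p q w : ℂ} (hp : ‖p‖ < 1) (hq : ‖q‖ < 1)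
    (h : ∀ i j : ℕ, 1 - w * p ^ i * q ^ j ≠ 0) :
    pqSymbol p q w ≠ 0 ∧
      Summable (fun ij : ℕ × ℕ => Real.log ‖1 - w * p ^ ij.1 * q ^ ij.2‖) ∧
      Real.log ‖pqSymbol p q w‖ = ∑' ij : ℕ × ℕ, Real.log ‖1 - w * p ^ ij.1 * q ^ ij.2‖ := by
  have hs : Summable fun ij : ℕ × ℕ => -(w * p ^ ij.1 * q ^ ij.2) := by
    have h1 : Summable fun ij : ℕ × ℕ => p ^ ij.1 * q ^ ij.2 := by
      refine summable_mul_of_summable_norm ?_ ?_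
      · simpa using summable_geometric_of_lt_one (norm_nonneg p) hp
      · simpa using summable_geometric_of_lt_one (norm_nonneg q) hq
    refine (h1.mul_left (-w)).congr fun ij => ?_
    ring
  have hl := Complex.summable_log_one_add_of_summable hs
  simp only [← sub_eq_add_neg] at hl
  have he := Complex.cexp_tsum_eq_tprod (fun ij : ℕ × ℕ => h ij.1 ij.2) hl
  have hre := Complex.hasSum_re hl.hasSum
  simp only [Complex.log_re] at hre
  rw [pqSymbol, ← he, Complex.norm_exp, Real.log_exp, hre.tsum_eq]
  exact ⟨Complex.exp_ne_zero _, hre.summable, rfl⟩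

/-- The factors are grouped in rows of fixed power p^i. The first N rows give the quadratic
polynomial in P, each with a bounded error. In the later rows all factors are close to 1 and their
logarithms sum geometrically, uniformly in P > 1. -/
theorem exists_log_norm_pqSymbol_bound {ℓ K ε : ℝ} (hℓ : ℓ < 0) (hε : 0 < ε) (N : ℕ)
    (hN : K + K / (-ℓ) ≤ N) : ∃ C : ℝ, ∀ (p q w : ℂ) (P a lam : ℝ), ‖q‖ = Real.exp ℓ → 1 < P →
      ‖p‖ = Real.exp (P * ℓ) → ‖w‖ = Real.exp (lam + a * (P * ℓ)) → |a| ≤ K → |lam| ≤ K →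
      (∀ i j : ℕ, ε < ‖1 - w * p ^ i * q ^ j‖ ∨ ε < ‖1 - 1 / (w * p ^ i * q ^ j)‖) →
      pqSymbol p q w ≠ 0 ∧ |Real.log ‖pqSymbol p q w‖ +
        ℓ / 2 * (P ^ 2 * negSq N a + P * (1 - 2 * (lam / ℓ)) * negLin N a)| ≤ C := by
  obtain ⟨C, hC, hb⟩ := exists_log_norm_one_sub_bound hε
  set m := -ℓ with hm
  have hm0 : 0 < m := by linarith
  -- The three summands are the errors made in replacing factors by positive parts, in summing the
  -- positive parts of a row, and in expanding the result in P.
  set R := C * rowBound m + m + m * (2 * (K / m) ^ 2 + K / m) with hR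
  refine ⟨N * R + C / (1 - Real.exp ℓ) / (1 - Real.exp ℓ), ?_⟩
  intro p q w P a lam hq hP hp hw ha hlam haway
  have hK : 0 ≤ K := (abs_nonneg _).trans ha
  have heℓ : Real.exp ℓ < 1 := Real.exp_lt_one_iff.2 hℓ
  have hq1 : ‖q‖ < 1 := hq ▸ heℓ
  have hp1 : ‖p‖ < 1 := by rw [hp]; exact Real.exp_lt_one_iff.2 (by nlinarith)
  have hq0 : q ≠ 0 := norm_pos_iff.1 (hq ▸ Real.exp_pos _)
  have hp0 : p ≠ 0 := norm_pos_iff.1 (hp ▸ Real.exp_pos _)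
  have hw0 : w ≠ 0 := norm_pos_iff.1 (hw ▸ Real.exp_pos _)
  set t : ℕ → ℝ := fun i => lam + (a + i) * (P * ℓ) with ht
  have hX0 : ∀ i j : ℕ, w * p ^ i * q ^ j ≠ 0 := fun i j => by positivity
  have hX : ∀ i j : ℕ, Real.log ‖w * p ^ i * q ^ j‖ = t i - j * m := by
    intro i j
    rw [norm_mul, norm_mul, norm_pow, norm_pow, hq, hp, hw, ← Real.exp_nat_mul,
      ← Real.exp_nat_mul, ← Real.exp_add, ← Real.exp_add, Real.log_exp]
    simp only [ht, hm]; ring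
  have hfac : ∀ i j : ℕ, |Real.log ‖1 - w * p ^ i * q ^ j‖ - max 0 (t i - j * m)| ≤
      C * Real.exp (-|t i - j * m|) := by
    intro i j
    have := (hb _ (hX0 i j) (haway i j)).2
    rwa [hX] at this
  obtain ⟨hne, hsum, hlog⟩ := log_norm_pqSymbol hp1 hq1
    fun i j => (hb _ (hX0 i j) (haway i j)).1
  refine ⟨hne, ?_⟩
  set g : ℕ → ℝ := fun i => ∑' j : ℕ, Real.log ‖1 - w * p ^ i * q ^ j‖ with hg
  have hgs : Summable g := hsum.prod
  have hlog' : Real.log ‖pqSymbol p q w‖ = ∑ i ∈ Finset.range N, g i + ∑' i, g (i + N) := by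
    rw [hlog, hsum.tsum_prod, hgs.sum_add_tsum_nat_add]
  have hrow : ∀ i : ℕ, |g i - ∑' j : ℕ, max 0 (t i - j * m)| ≤
      C * ∑' j : ℕ, Real.exp (-|t i - j * m|) := by
    intro i
    have h1 : Summable fun j : ℕ => Real.log ‖1 - w * p ^ i * q ^ j‖ := hsum.prod_factor i
    rw [hg, ← h1.tsum_sub (tsum_max_sub_bound hm0 _).1, ← tsum_mul_left]
    have h3 : Summable fun j : ℕ => C * Real.exp (-|t i - j * m|) :=
      (summable_row hm0 (t i)).1.mul_left C
    have := tsum_of_norm_bounded (f := fun j : ℕ => Real.log ‖1 - w * p ^ i * q ^ j‖ -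
      max 0 (t i - j * m)) h3.hasSum (fun j => hfac i j)
    simpa using this
  have hlow : ∀ i : ℕ, |g i - m * ((P ^ 2 * max 0 (-(a + i)) ^ 2 +
      P * (1 - 2 * (lam / ℓ)) * max 0 (-(a + i))) / 2)| ≤ R := by
    intro i
    have h1 := (hrow i).trans (mul_le_mul_of_nonneg_left (summable_row hm0 (t i)).2 hC)
    have h2 := (tsum_max_sub_bound hm0 (t i)).2
    have h3 : t i / m = -(lam / ℓ + (a + i) * P) := by
      simp only [ht, hm]; field_simp [hℓ.ne]
    rw [h3] at h2
    have h4 := mul_le_mul_of_nonneg_left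
      (abs_quadratic_sub_le (lam / ℓ) (a + i) P (by linarith)) hm0.le
    rw [← abs_of_pos hm0, ← abs_mul, abs_of_pos hm0, mul_sub] at h4
    have h5 : |lam / ℓ| ≤ K / m := by
      rw [abs_div, abs_of_neg hℓ]; gcongr
    have h6 : (lam / ℓ) ^ 2 ≤ (K / m) ^ 2 := by
      rw [← sq_abs]; gcongr
    have h7 : m * (2 * (lam / ℓ) ^ 2 + |lam / ℓ|) ≤ m * (2 * (K / m) ^ 2 + K / m) := by gcongr
    have e : ∀ A B D E : ℝ, |A - E| ≤ |A - B| + |B - D| + |D - E| := fun A B D E => by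
      have := abs_sub_le A B E
      have := abs_sub_le B D E
      linarith
    refine (e _ _ _ _).trans ((add_le_add (add_le_add h1 h2) (h4.trans h7)).trans_eq ?_)
    rw [hR]
  have hhigh : ∀ i : ℕ, |g (i + N)| ≤ C / (1 - Real.exp ℓ) * Real.exp ℓ ^ i := by
    intro i
    -- The choice of N gives a + i + N ≥ i + K/(-ℓ). Multiplication by Pℓ ≤ ℓ makes the excess
    -- K/(-ℓ) absorb |lam| ≤ K.
    have hti : t (i + N) ≤ i * ℓ := by
      have h1 : (i : ℝ) + K / m ≤ a + (i + N : ℕ) := by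
        push_cast; linarith [neg_abs_le a]
      have h2 : 0 ≤ a + (i + N : ℕ) := le_trans (by positivity) h1
      have h3 : (a + (i + N : ℕ)) * (P * ℓ) ≤ (i + K / m) * ℓ := by
        have : (a + (i + N : ℕ)) * ((P - 1) * ℓ) ≤ 0 :=
          mul_nonpos_of_nonneg_of_nonpos h2 (by nlinarith)
        nlinarith
      have h4 : K / m * ℓ = -K := by rw [hm]; field_simp [hℓ.ne]
      simp only [ht]
      linarith [le_abs_self lam]
    have hti0 : t (i + N) ≤ 0 := hti.trans (mul_nonpos_of_nonneg_of_nonpos (by positivity) hℓ.le)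
    have h0 : ∀ j : ℕ, t (i + N) - j * m ≤ 0 := fun j => by
      have : 0 ≤ (j : ℝ) * m := by positivity
      linarith
    have h1 := hrow (i + N)
    have h2 : ∀ j : ℕ, max 0 (t (i + N) - j * m) = 0 := fun j => max_eq_left (h0 j)
    simp only [h2, tsum_zero, sub_zero] at h1
    refine h1.trans ?_
    rw [div_mul_eq_mul_div, mul_div_assoc]
    refine mul_le_mul_of_nonneg_left ?_ hC
    have h3 : ∀ j : ℕ, Real.exp (-|t (i + N) - j * m|) = Real.exp (t (i + N)) * Real.exp ℓ ^ j := by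
      intro j
      rw [abs_of_nonpos (h0 j), ← Real.exp_nat_mul, ← Real.exp_add]
      congr 1; rw [hm]; ring
    simp only [h3]
    rw [tsum_mul_left, tsum_geometric_of_lt_one (Real.exp_pos _).le heℓ, ← div_eq_mul_inv]
    have h6 : Real.exp (t (i + N)) ≤ Real.exp ℓ ^ i := by
      rw [← Real.exp_nat_mul]; exact Real.exp_le_exp.2 hti
    exact div_le_div_of_nonneg_right h6 (by linarith)
  have htail : |∑' i, g (i + N)| ≤ C / (1 - Real.exp ℓ) / (1 - Real.exp ℓ) := by
    have h1 := (summable_geometric_of_lt_one (Real.exp_pos ℓ).le heℓ).mul_left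
      (C / (1 - Real.exp ℓ))
    have := tsum_of_norm_bounded (f := fun i => g (i + N)) h1.hasSum hhigh
    rw [tsum_mul_left, tsum_geometric_of_lt_one (Real.exp_pos _).le heℓ, ← div_eq_mul_inv] at this
    simpa using this
  have hmain : |∑ i ∈ Finset.range N, (g i - m * ((P ^ 2 * max 0 (-(a + i)) ^ 2 +
      P * (1 - 2 * (lam / ℓ)) * max 0 (-(a + i))) / 2))| ≤ N * R := by
    refine (Finset.abs_sum_le_sum_abs _ _).trans ?_
    have := Finset.sum_le_sum fun i (_ : i ∈ Finset.range N) => hlow i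
    simpa using this
  have hid : Real.log ‖pqSymbol p q w‖ +
      ℓ / 2 * (P ^ 2 * negSq N a + P * (1 - 2 * (lam / ℓ)) * negLin N a) =
      ∑ i ∈ Finset.range N, (g i - m * ((P ^ 2 * max 0 (-(a + i)) ^ 2 +
      P * (1 - 2 * (lam / ℓ)) * max 0 (-(a + i))) / 2)) + ∑' i, g (i + N) := by
    rw [hlog', Finset.sum_sub_distrib, ← Finset.mul_sum, ← Finset.sum_div,
      Finset.sum_add_distrib, ← Finset.mul_sum, ← Finset.mul_sum, negSq, negLin, hm]
    ring
  rw [hid]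
  exact (abs_add_le _ _).trans (add_le_add hmain htail)

/-! ### The first and second order behavior of the elliptic gamma function -/

/-- The cubic polynomial with `B (a + 1) - B a = a ^ 2` that is odd about `1 / 2`. -/
noncomputable def cubicB (a : ℝ) : ℝ := a * (a - 1) * (2 * a - 1) / 6

/-- Half the derivative of `cubicB`. -/
noncomputable def quadC (a : ℝ) : ℝ := (6 * a ^ 2 - 6 * a + 1) / 12

/-- The first order exponent of `Γ(u p^a)`. -/
noncomputable def gammaFst (a : ℝ) : ℝ := cubicB a - cubicB (Int.fract a)

/-- The second order exponent of `Γ(u p^a)`. -/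
noncomputable def gammaSnd (a : ℝ) : ℝ := quadC a - quadC (Int.fract a)

/-- A telescoping sum of B(x+1) - B(x) = x². The endpoint f = 1 is admitted because the lemma is
also used with f replaced by 1 minus a fractional part. -/
lemma sum_posPart_sq {f : ℝ} (h0 : 0 ≤ f) (h1 : f ≤ 1) : ∀ n N : ℕ, n ≤ N →
    ∑ i ∈ Finset.range N, max 0 (n + f - 1 - i) ^ 2 = cubicB (n + f) - cubicB f := by
  intro n
  induction n with
  | zero =>
    intro N _
    rw [Finset.sum_eq_zero]
    · simp
    · intro i _
      have : (0 : ℝ) ≤ i := by positivity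
      rw [max_eq_left]
      · simp
      · push_cast; linarith
  | succ n ih =>
    intro N hN
    obtain ⟨N, rfl⟩ : ∃ k, N = k + 1 := ⟨N - 1, by omega⟩
    have := ih N (by omega)
    rw [Finset.sum_range_succ']
    have e : ∀ i : ℕ, ((n + 1 : ℕ) : ℝ) + f - 1 - (i + 1 : ℕ) = n + f - 1 - i := fun i => by
      push_cast; ring
    simp only [e, this]
    rw [max_eq_right]
    · simp only [cubicB]; push_cast; ring
    · push_cast
      have : (0 : ℝ) ≤ n := by positivity
      linarith

lemma sum_posPart {f : ℝ} (h0 : 0 ≤ f) (h1 : f ≤ 1) : ∀ n N : ℕ, n ≤ N →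
    ∑ i ∈ Finset.range N, max 0 (n + f - 1 - i) = quadC (n + f) - quadC f := by
  intro n
  induction n with
  | zero =>
    intro N _
    rw [Finset.sum_eq_zero]
    · simp
    · intro i _
      have : (0 : ℝ) ≤ i := by positivity
      rw [max_eq_left]
      push_cast; linarith
  | succ n ih =>
    intro N hN
    obtain ⟨N, rfl⟩ : ∃ k, N = k + 1 := ⟨N - 1, by omega⟩
    have := ih N (by omega)
    rw [Finset.sum_range_succ']
    have e : ∀ i : ℕ, ((n + 1 : ℕ) : ℝ) + f - 1 - (i + 1 : ℕ) = n + f - 1 - i := fun i => by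
      push_cast; ring
    simp only [e, this]
    rw [max_eq_right]
    · simp only [quadC]; push_cast; ring
    · push_cast
      have : (0 : ℝ) ≤ n := by positivity
      linarith

lemma negSum_eq_zero {a : ℝ} (ha : 0 ≤ a) (N : ℕ) : negSq N a = 0 ∧ negLin N a = 0 := by
  have h : ∀ i : ℕ, max 0 (-(a + i)) = 0 := fun i => max_eq_left (by
    have : (0 : ℝ) ≤ i := by positivity
    linarith)
  exact ⟨Finset.sum_eq_zero fun i _ => by simp only [h]; norm_num,
    Finset.sum_eq_zero fun i _ => h i⟩

/-- At least one of a and 1 - a has no negative parts, according to the sign of the floor of a, and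
the sums for the other one telescope. -/
lemma negSum_eq {a : ℝ} {N : ℕ} (h : |a| + 1 ≤ N) :
    negSq N (1 - a) - negSq N a = gammaFst a ∧ negLin N (1 - a) + negLin N a = gammaSnd a := by
  have hf0 := Int.fract_nonneg a
  have hf1 := (Int.fract_lt_one a).le
  have hfl := Int.floor_add_fract a
  rw [gammaFst, gammaSnd]
  generalize Int.fract a = f at *
  rcases le_or_gt 0 ⌊a⌋ with hn | hn
  · obtain ⟨n, hn'⟩ := Int.eq_ofNat_of_zero_le hn
    rw [hn'] at hfl
    have hfl' : a = n + f := by rw [← hfl]; simp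
    have ha : 0 ≤ a := by rw [hfl']; positivity
    have hnN : n ≤ N := by
      have : (n : ℝ) ≤ N := by rw [abs_of_nonneg ha] at h; linarith
      exact_mod_cast this
    rw [(negSum_eq_zero ha N).1, (negSum_eq_zero ha N).2, negSq, negLin]
    have e : ∀ i : ℕ, -(1 - a + i) = n + f - 1 - i := fun i => by rw [hfl']; ring
    simp only [e]
    rw [sum_posPart_sq hf0 hf1 n N hnN, sum_posPart hf0 hf1 n N hnN, ← hfl']
    simp
  -- Here the sums for a telescope between 1 - f and 1 - a; the symmetries of B (odd) and C (even)
  -- about 1/2 bring them back to f and a.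
  · obtain ⟨n, hn'⟩ := Int.eq_ofNat_of_zero_le (a := -⌊a⌋) (by omega)
    have hfl' : a = f - n := by
      have : ((-⌊a⌋ : ℤ) : ℝ) = n := by rw [hn']; simp
      push_cast at this; linarith
    have ha : 0 ≤ 1 - a := by
      have : (1 : ℝ) ≤ n := by
        have : 1 ≤ n := by omega
        exact_mod_cast this
      linarith
    have hnN : n ≤ N := by
      have : (n : ℝ) ≤ N := by linarith [neg_abs_le a]
      exact_mod_cast this
    rw [(negSum_eq_zero ha N).1, (negSum_eq_zero ha N).2, negSq, negLin]
    have e : ∀ i : ℕ, -(a + i) = n + (1 - f) - 1 - i := fun i => by rw [hfl']; ring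
    simp only [e]
    rw [sum_posPart_sq (by linarith) (by linarith) n N hnN,
      sum_posPart (by linarith) (by linarith) n N hnN, hfl']
    simp only [cubicB, quadC]
    constructor <;> ring

/-- The numerator is the double product at pq/w, which exchanges a with 1 - a and κ = lam/ℓ with 1 -
κ. Since 1 - 2κ changes sign, the square sums are subtracted in the quotient and the linear sums are
added. -/
theorem exists_log_norm_ellGamma_bound {ℓ ε : ℝ} (K : ℝ) (hℓ : ℓ < 0) (hε : 0 < ε) :
    ∃ C : ℝ, ∀ (p q w : ℂ) (P a lam : ℝ), ‖q‖ = Real.exp ℓ → 1 < P →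
      ‖p‖ = Real.exp (P * ℓ) → ‖w‖ = Real.exp (lam + a * (P * ℓ)) → |a| ≤ K → |lam| ≤ K →
      Away ε p q w → ellGamma p q w ≠ 0 ∧ |Real.log ‖ellGamma p q w‖ +
        ℓ / 2 * (P ^ 2 * gammaFst a + P * (2 * (lam / ℓ) - 1) * gammaSnd a)| ≤ C := by
  -- Large enough for the parameters 1 - a and ℓ - lam of the numerator as well.
  set K' := |K| + 1 + (-ℓ) with hK'
  have hKK : K ≤ |K| := le_abs_self K
  obtain ⟨N, hN⟩ := exists_nat_ge (K' + K' / (-ℓ) + 1)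
  have hpos : 0 ≤ K' / (-ℓ) := div_nonneg (by have := abs_nonneg K; linarith) (by linarith)
  obtain ⟨C, hC⟩ := exists_log_norm_pqSymbol_bound (K := K') hℓ hε N (by linarith)
  refine ⟨C + C, ?_⟩
  intro p q w P a lam hq hP hp hw ha hlam haway
  have hq0 : q ≠ 0 := norm_pos_iff.1 (hq ▸ Real.exp_pos _)
  have hp0 : p ≠ 0 := norm_pos_iff.1 (hp ▸ Real.exp_pos _)
  have hw0 : w ≠ 0 := norm_pos_iff.1 (hw ▸ Real.exp_pos _)
  obtain ⟨h1, h2⟩ := hC p q w P a lam hq hP hp hw (by linarith) (by linarith) fun i j => by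
    left
    rw [mul_assoc]; exact (haway i j).1
  have hw' : ‖p * q / w‖ = Real.exp ((ℓ - lam) + (1 - a) * (P * ℓ)) := by
    rw [norm_div, norm_mul, hp, hq, hw, ← Real.exp_add, ← Real.exp_sub]; congr 1; ring
  have ha' := abs_le.1 ha
  have hlam' := abs_le.1 hlam
  obtain ⟨h3, h4⟩ := hC p q (p * q / w) P (1 - a) (ℓ - lam) hq hP hp hw'
    (abs_le.2 ⟨by linarith, by linarith⟩) (abs_le.2 ⟨by linarith, by linarith⟩) fun i j => by
      right
      have e : 1 / (p * q / w * p ^ i * q ^ j) = w / (p ^ (i + 1) * q ^ (j + 1)) := by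
        field_simp
        ring
      rw [e]; exact (haway i j).2
  refine ⟨div_ne_zero h3 h1, ?_⟩
  rw [ellGamma, norm_div, Real.log_div (norm_ne_zero_iff.2 h3) (norm_ne_zero_iff.2 h1)]
  obtain ⟨e1, e2⟩ := negSum_eq (a := a) (N := N) (by linarith)
  rw [← e1, ← e2]
  have e3 : (ℓ - lam) / ℓ = 1 - lam / ℓ := by field_simp [hℓ.ne]
  rw [e3] at h4
  rw [abs_le] at h2 h4 ⊢
  constructor <;> linarith

/-! ### The rescaled integrand -/

lemma sum_pairs (f : Fin 6 × Fin 6 → ℝ) : ∑ rs ∈ pairs, f rs =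
    f (0, 1) + f (0, 2) + f (0, 3) + f (0, 4) + f (0, 5) + f (1, 2) + f (1, 3) + f (1, 4) +
      f (1, 5) + f (2, 3) + f (2, 4) + f (2, 5) + f (3, 4) + f (3, 5) + f (4, 5) := by
  have : pairs = {(0, 1), (0, 2), (0, 3), (0, 4), (0, 5), (1, 2), (1, 3), (1, 4), (1, 5), (2, 3),
      (2, 4), (2, 5), (3, 4), (3, 5), (4, 5)} := by decide
  rw [this]
  simp [add_assoc]

/-- The first order behavior of the rescaled integrand, as a periodic function. -/
noncomputable def firstOrder (α : Fin 6 → ℝ) (ζ : ℝ) : ℝ :=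
  ∑ rs ∈ pairs, cubicB (Int.fract (α rs.1 + α rs.2)) -
    ∑ r, (cubicB (Int.fract (α r - ζ)) + cubicB (Int.fract (α r + ζ)))

/-- The logarithm of the second order behavior of the rescaled integrand where the first order
behavior vanishes, as a periodic function; `lam r = log |u_r|` and `mu = log |z|`. -/
noncomputable def secondOrder (ℓ : ℝ) (α : Fin 6 → ℝ) (ζ : ℝ) (lam : Fin 6 → ℝ) (mu : ℝ) : ℝ :=
  ∑ rs ∈ pairs, (lam rs.1 + lam rs.2 - ℓ / 2) * quadC (Int.fract (α rs.1 + α rs.2)) -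
    ∑ r, ((lam r + mu - ℓ / 2) * quadC (Int.fract (α r - ζ)) +
      (lam r - mu - ℓ / 2) * quadC (Int.fract (α r + ζ))) - ℓ * quadC (Int.fract (2 * ζ)) -
    ℓ / 24

lemma cubicB_one_sub (x : ℝ) : cubicB (1 - x) = -cubicB x := by simp only [cubicB]; ring

lemma quadC_one_sub (x : ℝ) : quadC (1 - x) = quadC x := by simp only [quadC]; ring

lemma cubicB_fract_neg (x : ℝ) : cubicB (Int.fract (-x)) = -cubicB (Int.fract x) := by
  by_cases h : Int.fract x = 0
  · rw [Int.fract_neg_eq_zero.2 h, h]; simp [cubicB]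
  · rw [Int.fract_neg h, cubicB_one_sub]

lemma quadC_fract_neg (x : ℝ) : quadC (Int.fract (-x)) = quadC (Int.fract x) := by
  by_cases h : Int.fract x = 0
  · rw [Int.fract_neg_eq_zero.2 h, h]
  · rw [Int.fract_neg h, quadC_one_sub]

/-- The cubic parts of all the gamma factors cancel identically on the balancing hyperplane. The
form with `gammaFst` is the useful one for explicit values, since `gammaFst` vanishes on [0, 1]; the
form with fractional parts shows the symmetries. -/
lemma firstOrder_eq {α : Fin 6 → ℝ} (h : ∑ r, α r = 1) (ζ : ℝ) : firstOrder α ζ =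
    ∑ r, (gammaFst (α r - ζ) + gammaFst (α r + ζ)) - gammaFst (-(2 * ζ)) - gammaFst (2 * ζ) -
      ∑ rs ∈ pairs, gammaFst (α rs.1 + α rs.2) := by
  have h5 : α 5 = 1 - (α 0 + α 1 + α 2 + α 3 + α 4) := by
    rw [Fin.sum_univ_six] at h; linarith
  simp only [firstOrder, gammaFst, cubicB_fract_neg, Finset.sum_sub_distrib,
    Finset.sum_add_distrib]
  have key : ∑ r, cubicB (α r - ζ) + ∑ r, cubicB (α r + ζ) - cubicB (-(2 * ζ)) - cubicB (2 * ζ) -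
      ∑ rs ∈ pairs, cubicB (α rs.1 + α rs.2) = 0 := by
    rw [sum_pairs, Fin.sum_univ_six, Fin.sum_univ_six]
    simp only [h5, cubicB]
    ring
  linarith

/-- The polynomial parts cancel as in the first order, now using both balancing conditions, except
for the constant -ℓ/24; this is why that constant occurs in `secondOrder`. -/
lemma secondOrder_eq {ℓ : ℝ} {α lam : Fin 6 → ℝ} (h : ∑ r, α r = 1) (hl : ∑ r, lam r = ℓ)
    (ζ mu : ℝ) : secondOrder ℓ α ζ lam mu =
    ∑ r, ((lam r + mu - ℓ / 2) * gammaSnd (α r - ζ) + (lam r - mu - ℓ / 2) * gammaSnd (α r + ζ)) -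
      (2 * mu - ℓ / 2) * gammaSnd (-(2 * ζ)) - (-2 * mu - ℓ / 2) * gammaSnd (2 * ζ) -
      ∑ rs ∈ pairs, (lam rs.1 + lam rs.2 - ℓ / 2) * gammaSnd (α rs.1 + α rs.2) := by
  have h5 : α 5 = 1 - (α 0 + α 1 + α 2 + α 3 + α 4) := by
    rw [Fin.sum_univ_six] at h; linarith
  have hl5 : lam 5 = ℓ - (lam 0 + lam 1 + lam 2 + lam 3 + lam 4) := by
    rw [Fin.sum_univ_six] at hl; linarith
  simp only [secondOrder, gammaSnd, quadC_fract_neg, Finset.sum_sub_distrib, mul_sub,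
    Finset.sum_add_distrib]
  have key : ∑ r, (lam r + mu - ℓ / 2) * quadC (α r - ζ) +
      ∑ r, (lam r - mu - ℓ / 2) * quadC (α r + ζ) - (2 * mu - ℓ / 2) * quadC (-(2 * ζ)) -
      (-2 * mu - ℓ / 2) * quadC (2 * ζ) -
      ∑ rs ∈ pairs, (lam rs.1 + lam rs.2 - ℓ / 2) * quadC (α rs.1 + α rs.2) = -(ℓ / 24) := by
    rw [sum_pairs, Fin.sum_univ_six, Fin.sum_univ_six]
    simp only [h5, hl5, quadC]
    ring
  linarith

lemma norm_pPow (lq lx : ℂ) (v : ℤ) (c : ℝ) :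
    ‖pPow lq lx v c‖ = Real.exp (c * (lx.re + v * lq.re)) := by
  rw [pPow, Complex.norm_exp]; simp

lemma abs_cubicB_fract_le (x : ℝ) : |cubicB (Int.fract x)| ≤ 1 := by
  have h0 := Int.fract_nonneg x
  have h1 := (Int.fract_lt_one x).le
  generalize Int.fract x = f at *
  have h2 : |f| ≤ 1 := abs_le.2 ⟨by linarith, h1⟩
  have h3 : |f - 1| ≤ 1 := abs_le.2 ⟨by linarith, by linarith⟩
  have h4 : |2 * f - 1| ≤ 1 := abs_le.2 ⟨by linarith, by linarith⟩
  rw [cubicB, abs_div, abs_mul, abs_mul]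
  have h5 : |f| * |f - 1| * |2 * f - 1| ≤ 1 * 1 * 1 := by gcongr
  rw [div_le_one (by norm_num)]
  have : |(6 : ℝ)| = 6 := by norm_num
  linarith

lemma abs_quadC_fract_le (x : ℝ) : |quadC (Int.fract x)| ≤ 1 := by
  have h0 := Int.fract_nonneg x
  have h1 := (Int.fract_lt_one x).le
  generalize Int.fract x = f at *
  rw [quadC, abs_le]
  constructor <;> nlinarith

lemma card_pairs : pairs.card = 15 := by decide

lemma lt_of_mem_pairs {rs : Fin 6 × Fin 6} (h : rs ∈ pairs) : rs.1 < rs.2 :=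
  (Finset.mem_filter.1 h).2

lemma abs_firstOrder_le (α : Fin 6 → ℝ) (ζ : ℝ) : |firstOrder α ζ| ≤ 27 := by
  rw [firstOrder]
  refine (abs_sub _ _).trans ?_
  have h1 : |∑ rs ∈ pairs, cubicB (Int.fract (α rs.1 + α rs.2))| ≤ 15 := by
    refine (Finset.abs_sum_le_sum_abs _ _).trans ?_
    refine (Finset.sum_le_card_nsmul _ _ 1 fun _ _ => abs_cubicB_fract_le _).trans ?_
    rw [card_pairs]; norm_num
  have h2 : |∑ r, (cubicB (Int.fract (α r - ζ)) + cubicB (Int.fract (α r + ζ)))| ≤ 12 := by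
    refine (Finset.abs_sum_le_sum_abs _ _).trans ?_
    refine (Finset.sum_le_card_nsmul _ _ 2 fun r _ => (abs_add_le _ _).trans
      (add_le_add (abs_cubicB_fract_le _) (abs_cubicB_fract_le _) |>.trans
        (by norm_num))).trans ?_
    simp; norm_num
  linarith

lemma abs_secondOrder_le {ℓ Λ mu : ℝ} (α : Fin 6 → ℝ) (ζ : ℝ) {lam : Fin 6 → ℝ}
    (hl : ∀ r, |lam r| ≤ Λ) (hm : |mu| ≤ Λ) :
    |secondOrder ℓ α ζ lam mu| ≤ 27 * (2 * Λ + |ℓ|) + 2 * |ℓ| := by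
  have hΛ : 0 ≤ Λ := (abs_nonneg _).trans hm
  have hb : ∀ x a : ℝ, |x| ≤ 2 * Λ → |(x - ℓ / 2) * quadC (Int.fract a)| ≤ 2 * Λ + |ℓ| := by
    intro x a hx
    rw [abs_mul]
    have h1 : |x - ℓ / 2| ≤ 2 * Λ + |ℓ| := by
      refine (abs_sub _ _).trans ?_
      rw [abs_div]
      have : |(2 : ℝ)| = 2 := by norm_num
      rw [this]
      linarith [abs_nonneg ℓ]
    calc |x - ℓ / 2| * |quadC (Int.fract a)| ≤ (2 * Λ + |ℓ|) * 1 := by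
          gcongr
          exact abs_quadC_fract_le a
      _ = _ := mul_one _
  rw [secondOrder]
  have h1 : |∑ rs ∈ pairs, (lam rs.1 + lam rs.2 - ℓ / 2) *
      quadC (Int.fract (α rs.1 + α rs.2))| ≤ 15 * (2 * Λ + |ℓ|) := by
    refine (Finset.abs_sum_le_sum_abs _ _).trans ?_
    refine (Finset.sum_le_card_nsmul _ _ (2 * Λ + |ℓ|) fun rs _ => hb _ _ ?_).trans ?_
    · exact (abs_add_le _ _).trans (by linarith [hl rs.1, hl rs.2])
    · rw [card_pairs]; simp; linarith
  have h2 : |∑ r, ((lam r + mu - ℓ / 2) * quadC (Int.fract (α r - ζ)) +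
      (lam r - mu - ℓ / 2) * quadC (Int.fract (α r + ζ)))| ≤ 12 * (2 * Λ + |ℓ|) := by
    refine (Finset.abs_sum_le_sum_abs _ _).trans ?_
    refine (Finset.sum_le_card_nsmul _ _ (2 * (2 * Λ + |ℓ|)) fun r _ => (abs_add_le _ _).trans
      ?_).trans ?_
    · have e1 := hb (lam r + mu) (α r - ζ) ((abs_add_le _ _).trans (by linarith [hl r]))
      have e2 := hb (lam r - mu) (α r + ζ) ((abs_sub _ _).trans (by linarith [hl r]))
      linarith
    · simp; linarith
  have h3 : |ℓ * quadC (Int.fract (2 * ζ))| ≤ |ℓ| := by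
    rw [abs_mul]
    exact mul_le_of_le_one_right (abs_nonneg _) (abs_quadC_fract_le _)
  have h4 : |ℓ / 24| ≤ |ℓ| := by
    rw [abs_div]
    exact div_le_self (abs_nonneg _) (by norm_num)
  refine (abs_sub _ _).trans ?_
  refine (add_le_add_left ((abs_sub _ _).trans (add_le_add_left (abs_sub _ _) _)) _).trans ?_
  linarith

lemma log_norm_rescaledIntegrand {p q z : ℂ} {t : Fin 6 → ℂ}
    (h1 : ∀ r, ellGamma p q (t r * z) ≠ 0) (h2 : ∀ r, ellGamma p q (t r / z) ≠ 0)
    (h3 : ellGamma p q (z ^ 2) ≠ 0) (h4 : ellGamma p q (1 / z ^ 2) ≠ 0)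
    (h5 : ∀ r s, r < s → ellGamma p q (t r * t s) ≠ 0) :
    rescaledIntegrand p q t z ≠ 0 ∧ Real.log ‖rescaledIntegrand p q t z‖ =
      ∑ r, (Real.log ‖ellGamma p q (t r * z)‖ + Real.log ‖ellGamma p q (t r / z)‖) -
        Real.log ‖ellGamma p q (z ^ 2)‖ - Real.log ‖ellGamma p q (1 / z ^ 2)‖ -
        ∑ rs ∈ pairs, Real.log ‖ellGamma p q (t rs.1 * t rs.2)‖ := by
  have hp : ∀ rs ∈ pairs, ellGamma p q (t rs.1 * t rs.2) ≠ 0 := fun rs h =>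
    h5 _ _ (lt_of_mem_pairs h)
  have hA : ∏ r, ellGamma p q (t r * z) * ellGamma p q (t r / z) ≠ 0 :=
    Finset.prod_ne_zero_iff.2 fun r _ => mul_ne_zero (h1 r) (h2 r)
  have hB : betaValue p q t ≠ 0 := Finset.prod_ne_zero_iff.2 hp
  have hI : integrand p q t z ≠ 0 := div_ne_zero hA (mul_ne_zero h3 h4)
  refine ⟨div_ne_zero hI hB, ?_⟩
  rw [rescaledIntegrand, norm_div, Real.log_div (norm_ne_zero_iff.2 hI) (norm_ne_zero_iff.2 hB),
    integrand, norm_div, Real.log_div (norm_ne_zero_iff.2 hA)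
      (norm_ne_zero_iff.2 (mul_ne_zero h3 h4)), norm_mul,
    Real.log_mul (norm_ne_zero_iff.2 h3) (norm_ne_zero_iff.2 h4), betaValue, norm_prod, norm_prod,
    Real.log_prod fun rs h => norm_ne_zero_iff.2 (hp rs h),
    Real.log_prod fun r _ => norm_ne_zero_iff.2 (mul_ne_zero (h1 r) (h2 r))]
  simp only [norm_mul]
  rw [Finset.sum_congr rfl fun r _ =>
    Real.log_mul (norm_ne_zero_iff.2 (h1 r)) (norm_ne_zero_iff.2 (h2 r))]
  ring

lemma abs_log_le_of_mem {M x : ℝ} (hM : 0 < M) (h1 : 1 / M ≤ x) (h2 : x ≤ M) :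
    |Real.log x| ≤ |Real.log M| := by
  have hx : 0 < x := lt_of_lt_of_le (by positivity) h1
  have e1 := Real.log_le_log (by positivity) h1
  have e2 := Real.log_le_log hx h2
  rw [one_div, Real.log_inv] at e1
  exact abs_le.2 ⟨by linarith [le_abs_self (Real.log M)], by linarith [le_abs_self (Real.log M)]⟩

/-- Sum of the estimates for the 29 gamma functions: 12 with t_r, 2 with z², and 15 in the value of
the integral. They give ℓP²F/2 + PQ, which is then rewritten in powers of v. -/
theorem exists_log_norm_rescaledIntegrand_bound {lq lx : ℂ} (hlq : lq.re < 0) {M ε : ℝ}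
    (hM : 0 < M) (hε : 0 < ε) : ∃ C : ℝ, ∀ (α : Fin 6 → ℝ) (ζ : ℝ) (u : Fin 6 → ℂ) (z : ℂ) (v : ℤ),
      ∑ r, α r = 1 → (∀ r, |α r| ≤ M) → |ζ| ≤ M →
      ∏ r, u r = Complex.exp lq → (∀ r, 1 / M ≤ ‖u r‖ ∧ ‖u r‖ ≤ M) →
      1 / M ≤ ‖z‖ → ‖z‖ ≤ M →
      ‖pPow lq lx v 1‖ < ‖Complex.exp lq‖ →
      Regular ε (pPow lq lx v 1) (Complex.exp lq) (fun r => u r * pPow lq lx v (α r))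
        (z * pPow lq lx v (-ζ)) →
      rescaledIntegrand (pPow lq lx v 1) (Complex.exp lq)
        (fun r => u r * pPow lq lx v (α r)) (z * pPow lq lx v (-ζ)) ≠ 0 ∧
      |Real.log ‖rescaledIntegrand (pPow lq lx v 1) (Complex.exp lq)
        (fun r => u r * pPow lq lx v (α r)) (z * pPow lq lx v (-ζ))‖ +
        (lq.re * (v ^ 2 * firstOrder α ζ / 2) + v * (lx.re * firstOrder α ζ +
          secondOrder lq.re α ζ (fun r => Real.log ‖u r‖) (Real.log ‖z‖)))| ≤ C := by
  set ℓ := lq.re with hℓ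
  set ξ := lx.re with hξ
  set Λ := |Real.log M| with hΛ
  set K := 2 * M + 2 * Λ with hK
  have hΛ0 : 0 ≤ Λ := abs_nonneg _
  obtain ⟨C, hC⟩ := exists_log_norm_ellGamma_bound K hlq hε
  refine ⟨29 * C + (|ξ ^ 2 / (2 * ℓ)| * 27 + |ξ / ℓ| * (27 * (2 * Λ + |ℓ|) + 2 * |ℓ|)), ?_⟩
  intro α ζ u z v hα hαM hζ hu huM hz1 hz2 hpq hreg
  have hpos : ∀ {x : ℂ}, 1 / M ≤ ‖x‖ → x ≠ 0 := fun h =>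
    norm_pos_iff.1 (lt_of_lt_of_le (by positivity) h)
  have hz0 : z ≠ 0 := hpos hz1
  have hu0 : ∀ r, u r ≠ 0 := fun r => hpos (huM r).1
  set lam : Fin 6 → ℝ := fun r => Real.log ‖u r‖ with hlam
  set mu := Real.log ‖z‖ with hmu
  have hlamb : ∀ r, |lam r| ≤ Λ := fun r => abs_log_le_of_mem hM (huM r).1 (huM r).2
  have hmub : |mu| ≤ Λ := abs_log_le_of_mem hM hz1 hz2
  have hun : ∀ r, ‖u r‖ = Real.exp (lam r) := fun r =>
    (Real.exp_log (norm_pos_iff.2 (hu0 r))).symm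
  have hzn : ‖z‖ = Real.exp mu := (Real.exp_log (norm_pos_iff.2 hz0)).symm
  have hlsum : ∑ r, lam r = ℓ := by
    rw [hlam, ← Real.log_prod fun r _ => norm_ne_zero_iff.2 (hu0 r), ← norm_prod, hu,
      Complex.norm_exp, Real.log_exp]
  -- P is the exponent with |p| = |q|^P. Passing from P to v adds ξF to the linear coefficient and
  -- changes the constant term by a bounded amount.
  set P : ℝ := v + ξ / ℓ with hP
  have hPℓ : P * ℓ = ξ + v * ℓ := by rw [hP]; field_simp [hlq.ne]; ring
  have hpn : ∀ c : ℝ, ‖pPow lq lx v c‖ = Real.exp (c * (P * ℓ)) := fun c => by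
    rw [norm_pPow, hPℓ]
  have hp1 : ‖pPow lq lx v 1‖ = Real.exp (P * ℓ) := by rw [hpn, one_mul]
  have hq1 : ‖Complex.exp lq‖ = Real.exp ℓ := Complex.norm_exp _
  have hP1 : 1 < P := by
    rw [hp1, hq1, Real.exp_lt_exp] at hpq
    nlinarith
  set p := pPow lq lx v 1
  set q := Complex.exp lq
  set Z := z * pPow lq lx v (-ζ) with hZ
  set t : Fin 6 → ℂ := fun r => u r * pPow lq lx v (α r) with ht
  have htn : ∀ r, ‖t r‖ = Real.exp (lam r + α r * (P * ℓ)) := fun r => by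
    rw [ht, norm_mul, hun, hpn, Real.exp_add]
  have hZn : ‖Z‖ = Real.exp (mu + -ζ * (P * ℓ)) := by
    rw [hZ, norm_mul, hzn, hpn, Real.exp_add]
  obtain ⟨r1, r2, r3, r4⟩ := hreg
  have ab : ∀ {x y X Y : ℝ}, |x| ≤ X → |y| ≤ Y → |x + y| ≤ X + Y ∧ |x - y| ≤ X + Y := by
    intro x y X Y h1 h2
    exact ⟨(abs_add_le _ _).trans (by linarith), (abs_sub _ _).trans (by linarith)⟩
  have g1 := fun r => hC p q (t r * Z) P (α r - ζ) (lam r + mu) hq1 hP1 hp1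
    (by rw [norm_mul, htn, hZn, ← Real.exp_add]; congr 1; ring)
    ((ab (hαM r) hζ).2.trans (by linarith)) ((ab (hlamb r) hmub).1.trans (by linarith)) (r1 r).1
  have g2 := fun r => hC p q (t r / Z) P (α r + ζ) (lam r - mu) hq1 hP1 hp1
    (by rw [norm_div, htn, hZn, ← Real.exp_sub]; congr 1; ring)
    ((ab (hαM r) hζ).1.trans (by linarith)) ((ab (hlamb r) hmub).2.trans (by linarith)) (r1 r).2
  have hζ2 : |2 * ζ| ≤ K := by
    rw [two_mul]; exact (ab hζ hζ).1.trans (by linarith)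
  have hmu2 : |2 * mu| ≤ K := by
    rw [two_mul]; exact (ab hmub hmub).1.trans (by linarith)
  have g3 := hC p q (Z ^ 2) P (-(2 * ζ)) (2 * mu) hq1 hP1 hp1
    (by rw [norm_pow, hZn, ← Real.exp_nat_mul]; congr 1; push_cast; ring)
    (by rwa [abs_neg]) hmu2 r3
  have g4 := hC p q (1 / Z ^ 2) P (2 * ζ) (-(2 * mu)) hq1 hP1 hp1
    (by rw [norm_div, norm_one, norm_pow, hZn, ← Real.exp_nat_mul, one_div, ← Real.exp_neg]
        congr 1; push_cast; ring)
    hζ2 (by rwa [abs_neg]) r4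
  have g5 := fun r s (h : r < s) => hC p q (t r * t s) P (α r + α s) (lam r + lam s) hq1 hP1 hp1
    (by rw [norm_mul, htn, htn, ← Real.exp_add]; congr 1; ring)
    ((ab (hαM r) (hαM s)).1.trans (by linarith)) ((ab (hlamb r) (hlamb s)).1.trans (by linarith))
    (r2 r s h)
  obtain ⟨hne, hlog⟩ := log_norm_rescaledIntegrand (fun r => (g1 r).1) (fun r => (g2 r).1) g3.1
    g4.1 (fun r s h => (g5 r s h).1)
  refine ⟨hne, ?_⟩
  rw [hlog]
  have b1 : |∑ r, ((Real.log ‖ellGamma p q (t r * Z)‖ + ℓ / 2 * (P ^ 2 * gammaFst (α r - ζ) +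
        P * (2 * ((lam r + mu) / ℓ) - 1) * gammaSnd (α r - ζ))) +
      (Real.log ‖ellGamma p q (t r / Z)‖ + ℓ / 2 * (P ^ 2 * gammaFst (α r + ζ) +
        P * (2 * ((lam r - mu) / ℓ) - 1) * gammaSnd (α r + ζ))))| ≤ 12 * C := by
    refine (Finset.abs_sum_le_sum_abs _ _).trans ?_
    refine (Finset.sum_le_card_nsmul _ _ (2 * C) fun r _ => (abs_add_le _ _).trans ?_).trans ?_
    · linarith [(g1 r).2, (g2 r).2]
    · simp; linarith
  have b2 : |∑ rs ∈ pairs, (Real.log ‖ellGamma p q (t rs.1 * t rs.2)‖ +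
      ℓ / 2 * (P ^ 2 * gammaFst (α rs.1 + α rs.2) +
        P * (2 * ((lam rs.1 + lam rs.2) / ℓ) - 1) * gammaSnd (α rs.1 + α rs.2)))| ≤ 15 * C := by
    refine (Finset.abs_sum_le_sum_abs _ _).trans ?_
    refine (Finset.sum_le_card_nsmul _ _ C fun rs h =>
      (g5 _ _ (lt_of_mem_pairs h)).2).trans ?_
    rw [card_pairs]; simp
  have b3 := g3.2
  have b4 := g4.2
  have hFb := abs_firstOrder_le α ζ
  have hQb := abs_secondOrder_le (ℓ := ℓ) α ζ hlamb hmub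
  have b5 : |ξ ^ 2 / (2 * ℓ) * firstOrder α ζ + ξ / ℓ * secondOrder ℓ α ζ lam mu| ≤
      |ξ ^ 2 / (2 * ℓ)| * 27 + |ξ / ℓ| * (27 * (2 * Λ + |ℓ|) + 2 * |ℓ|) := by
    refine (abs_add_le _ _).trans ?_
    rw [abs_mul, abs_mul]
    gcongr
  have hF := firstOrder_eq hα ζ
  have hQ := secondOrder_eq hα hlsum ζ mu
  set X1 := ∑ r, ((Real.log ‖ellGamma p q (t r * Z)‖ + ℓ / 2 * (P ^ 2 * gammaFst (α r - ζ) +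
        P * (2 * ((lam r + mu) / ℓ) - 1) * gammaSnd (α r - ζ))) +
      (Real.log ‖ellGamma p q (t r / Z)‖ + ℓ / 2 * (P ^ 2 * gammaFst (α r + ζ) +
        P * (2 * ((lam r - mu) / ℓ) - 1) * gammaSnd (α r + ζ)))) with hX1
  set X2 := ∑ rs ∈ pairs, (Real.log ‖ellGamma p q (t rs.1 * t rs.2)‖ +
      ℓ / 2 * (P ^ 2 * gammaFst (α rs.1 + α rs.2) +
        P * (2 * ((lam rs.1 + lam rs.2) / ℓ) - 1) * gammaSnd (α rs.1 + α rs.2))) with hX2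
  have hX1' : X1 = ∑ r, (Real.log ‖ellGamma p q (t r * Z)‖ + Real.log ‖ellGamma p q (t r / Z)‖) +
      ℓ / 2 * P ^ 2 * ∑ r, (gammaFst (α r - ζ) + gammaFst (α r + ζ)) +
      P * ∑ r, ((lam r + mu - ℓ / 2) * gammaSnd (α r - ζ) +
        (lam r - mu - ℓ / 2) * gammaSnd (α r + ζ)) := by
    rw [hX1, Finset.mul_sum, Finset.mul_sum, ← Finset.sum_add_distrib, ← Finset.sum_add_distrib]
    refine Finset.sum_congr rfl fun r _ => ?_
    field_simp [hlq.ne]; ring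
  have hX2' : X2 = ∑ rs ∈ pairs, Real.log ‖ellGamma p q (t rs.1 * t rs.2)‖ +
      ℓ / 2 * P ^ 2 * ∑ rs ∈ pairs, gammaFst (α rs.1 + α rs.2) +
      P * ∑ rs ∈ pairs, (lam rs.1 + lam rs.2 - ℓ / 2) * gammaSnd (α rs.1 + α rs.2) := by
    rw [hX2, Finset.mul_sum, Finset.mul_sum, ← Finset.sum_add_distrib, ← Finset.sum_add_distrib]
    refine Finset.sum_congr rfl fun r _ => ?_
    field_simp [hlq.ne]
    ring
  have e3 : ℓ / 2 * (P ^ 2 * gammaFst (-(2 * ζ)) + P * (2 * (2 * mu / ℓ) - 1) *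
      gammaSnd (-(2 * ζ))) = ℓ / 2 * P ^ 2 * gammaFst (-(2 * ζ)) +
      P * ((2 * mu - ℓ / 2) * gammaSnd (-(2 * ζ))) := by
    field_simp [hlq.ne]
  have e4 : ℓ / 2 * (P ^ 2 * gammaFst (2 * ζ) + P * (2 * (-(2 * mu) / ℓ) - 1) *
      gammaSnd (2 * ζ)) = ℓ / 2 * P ^ 2 * gammaFst (2 * ζ) +
      P * ((-2 * mu - ℓ / 2) * gammaSnd (2 * ζ)) := by
    field_simp [hlq.ne]
  rw [e3] at b3
  rw [e4] at b4
  have e5 : ℓ * (v ^ 2 * firstOrder α ζ / 2) + v * (ξ * firstOrder α ζ +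
      secondOrder ℓ α ζ lam mu) = (ℓ / 2 * P ^ 2 * firstOrder α ζ + P * secondOrder ℓ α ζ lam mu) -
      (ξ ^ 2 / (2 * ℓ) * firstOrder α ζ + ξ / ℓ * secondOrder ℓ α ζ lam mu) := by
    rw [hP]; field_simp [hlq.ne]; ring
  rw [e5]
  have id : ∀ S1 S2 G1 G2 G3 G4 H1 H2 H3 H4 A3 A4 Y x1 x2 : ℝ,
      x1 = S1 + ℓ / 2 * P ^ 2 * G1 + P * H1 → x2 = S2 + ℓ / 2 * P ^ 2 * G2 + P * H2 →
      |x1| ≤ 12 * C → |x2| ≤ 15 * C → |A3 + (ℓ / 2 * P ^ 2 * G3 + P * H3)| ≤ C →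
      |A4 + (ℓ / 2 * P ^ 2 * G4 + P * H4)| ≤ C →
      |Y| ≤ |ξ ^ 2 / (2 * ℓ)| * 27 + |ξ / ℓ| * (27 * (2 * Λ + |ℓ|) + 2 * |ℓ|) →
      |S1 - A3 - A4 - S2 + (ℓ / 2 * P ^ 2 * (G1 - G3 - G4 - G2) + P * (H1 - H3 - H4 - H2) - Y)| ≤
        29 * C + (|ξ ^ 2 / (2 * ℓ)| * 27 + |ξ / ℓ| * (27 * (2 * Λ + |ℓ|) + 2 * |ℓ|)) := by
    clear * -
    intro S1 S2 G1 G2 G3 G4 H1 H2 H3 H4 A3 A4 Y x1 x2 h1 h2 c1 c2 c3 c4 c5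
    generalize |ξ ^ 2 / (2 * ℓ)| * 27 + |ξ / ℓ| * (27 * (2 * Λ + |ℓ|) + 2 * |ℓ|) = W at *
    rw [abs_le] at c1 c2 c3 c4 c5 ⊢
    constructor <;> linarith
  have := id _ _ _ _ _ _ _ _ _ _ _ _ _ _ _ hX1' hX2' b1 b2 b3 b4 b5
  rwa [← hF, ← hQ] at this

/-! ### Existence of the order behavior -/

lemma log_norm_mul_exp_mul_zpow {x s lq : ℂ} (hx : x ≠ 0) (hs : s ≠ 0) (v : ℤ) (f : ℝ) :
    x * Complex.exp (lq * ((v : ℂ) ^ 2 * (f : ℂ) / 2)) * s ^ v ≠ 0 ∧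
    Real.log ‖x * Complex.exp (lq * ((v : ℂ) ^ 2 * (f : ℂ) / 2)) * s ^ v‖ =
      Real.log ‖x‖ + lq.re * (v ^ 2 * f / 2) + v * Real.log ‖s‖ := by
  have h1 := Complex.exp_ne_zero (lq * ((v : ℂ) ^ 2 * (f : ℂ) / 2))
  have h2 : s ^ v ≠ 0 := zpow_ne_zero _ hs
  refine ⟨mul_ne_zero (mul_ne_zero hx h1) h2, ?_⟩
  rw [norm_mul, norm_mul, Real.log_mul (by simp [hx]) (norm_ne_zero_iff.2 h2),
    Real.log_mul (by simpa using hx) (by simp), Complex.norm_exp, Real.log_exp, norm_zpow,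
    Real.log_zpow]
  have : (v : ℂ) ^ 2 * (f : ℂ) / 2 = ((v ^ 2 * f / 2 : ℝ) : ℂ) := by push_cast; ring
  rw [this, Complex.re_mul_ofReal]

/-- Only the modulus of `sob` matters, so its argument stays free. This freedom allows `sob` to be
prescribed exactly at a chosen point, such as the value 1. -/
theorem isOrderBehavior_firstOrder {lq lx : ℂ} (hlq : lq.re < 0)
    {sob : (Fin 6 → ℝ) → ℝ → (Fin 6 → ℂ) → ℂ → ℂ}
    (h0 : ∀ α ζ u z, (∀ r, u r ≠ 0) → z ≠ 0 → sob α ζ u z ≠ 0)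
    (h : ∀ α ζ u z, ∑ r, α r = 1 → ∏ r, u r = Complex.exp lq → (∀ r, u r ≠ 0) → z ≠ 0 →
      Real.log ‖sob α ζ u z‖ = lx.re * firstOrder α ζ +
        secondOrder lq.re α ζ (fun r => Real.log ‖u r‖) (Real.log ‖z‖)) :
    IsOrderBehavior lq lx firstOrder sob := by
  refine ⟨h0, fun M hM ε hε => ?_⟩
  obtain ⟨C, hC⟩ := exists_log_norm_rescaledIntegrand_bound (lx := lx) hlq hM hε
  refine ⟨Real.exp (-C - 1), Real.exp_pos _, Real.exp (C + 1), Real.exp_pos _, ?_⟩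
  intro α ζ u z v hα hαM hζ hu huM hz1 hz2 hpq hreg
  obtain ⟨hne, hb⟩ := hC α ζ u z v hα hαM hζ hu huM hz1 hz2 hpq hreg
  have hpos : ∀ {x : ℂ}, 1 / M ≤ ‖x‖ → x ≠ 0 := fun h =>
    norm_pos_iff.1 (lt_of_lt_of_le (by positivity) h)
  have hu0 : ∀ r, u r ≠ 0 := fun r => hpos (huM r).1
  obtain ⟨hn, hl⟩ := log_norm_mul_exp_mul_zpow (lq := lq) hne (h0 α ζ u z hu0 (hpos hz1)) v
    (firstOrder α ζ)
  rw [h α ζ u z hα hu hu0 (hpos hz1), add_assoc] at hl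
  rw [← Real.lt_log_iff_exp_lt (norm_pos_iff.2 hn), ← Real.log_lt_iff_lt_exp (norm_pos_iff.2 hn),
    hl]
  rw [abs_le] at hb
  constructor <;> linarith

/-! ### Regular points -/

lemma half_one_sub_exp_neg_lt {η x : ℝ} (hη : 0 < η) (hx : η ≤ |x|) {X : ℂ}
    (hX : ‖X‖ = Real.exp x) : (1 - Real.exp (-η)) / 2 < ‖1 - X‖ := by
  have h1 : Real.exp (-η) < 1 := Real.exp_lt_one_iff.2 (by linarith)
  have h2 : |1 - ‖X‖| ≤ ‖1 - X‖ := by simpa using abs_norm_sub_norm_le (1 : ℂ) X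
  have h3 : 1 - Real.exp (-η) ≤ |1 - ‖X‖| := by
    rw [hX]
    rcases le_abs.1 hx with h | h
    · have h4 : Real.exp η ≤ Real.exp x := Real.exp_le_exp.2 h
      have h5 : 1 - Real.exp (-η) ≤ Real.exp η - 1 := by
        have := Real.add_one_le_exp η
        have := Real.add_one_le_exp (-η)
        linarith
      exact (by linarith : 1 - Real.exp (-η) ≤ -(1 - Real.exp x)).trans (neg_le_abs _)
    · have h4 : Real.exp x ≤ Real.exp (-η) := Real.exp_le_exp.2 (by linarith)
      exact (by linarith : 1 - Real.exp (-η) ≤ 1 - Real.exp x).trans (le_abs_self _)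
  linarith

lemma away_of_log {p q w : ℂ} {π ℓ x η : ℝ} (hη : 0 < η) (hp : ‖p‖ = Real.exp π)
    (hq : ‖q‖ = Real.exp ℓ) (hw : ‖w‖ = Real.exp x)
    (h1 : ∀ i j : ℕ, η ≤ |x + i * π + j * ℓ|)
    (h2 : ∀ i j : ℕ, η ≤ |x - (i + 1) * π - (j + 1) * ℓ|) :
    Away ((1 - Real.exp (-η)) / 2) p q w := by
  intro i j
  refine ⟨half_one_sub_exp_neg_lt hη (h1 i j) ?_, half_one_sub_exp_neg_lt hη (h2 i j) ?_⟩
  · rw [norm_mul, norm_mul, norm_pow, norm_pow, hp, hq, hw, ← Real.exp_nat_mul,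
      ← Real.exp_nat_mul, ← Real.exp_add, ← Real.exp_add]
    congr 1; ring
  · rw [norm_div, norm_mul, norm_pow, norm_pow, hp, hq, hw, ← Real.exp_nat_mul,
      ← Real.exp_nat_mul, ← Real.exp_add, ← Real.exp_sub]
    congr 1; push_cast; ring

/-- Pigeonhole: among more shifts than labels, if each shift were bad for some label, two would be
bad for the same one. The difference of the two conditions then puts a nonzero multiple of the step
τ too close to a multiple of ℓ. The bound η does not depend on the offsets b, hence not on v in the
application. -/
lemma exists_shift (ι : Type*) [Fintype ι] {ℓ δ : ℝ} (hℓ : ℓ < 0) (hδ : 0 < δ) :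
    ∃ η > (0 : ℝ), η ≤ 1 ∧ ∀ (b : ι → ℝ) (n : ι → ℤ), (∀ c, n c ≠ 0) → (∀ c, |n c| ≤ 40) →
      ∃ σ : ℝ, 0 ≤ σ ∧ σ ≤ δ ∧ ∀ c (j : ℤ), η ≤ |b c + n c * σ + j * ℓ| := by
  set N : ℕ := Fintype.card ι + 1 with hN
  have hN0 : (0 : ℝ) < N := by rw [hN]; positivity
  -- With velocities at most 40, the total movement is at most 40D ≤ |ℓ|/2, which is too short to
  -- pass from one multiple of ℓ to another.
  set D := min (min δ (-ℓ / 80)) 1 with hD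
  have hD0 : 0 < D := lt_min (lt_min hδ (by linarith)) one_pos
  set τ := D / N with hτ
  have hτ0 : 0 < τ := by positivity
  have hNτ : N * τ = D := by rw [hτ]; field_simp
  have hDδ : D ≤ δ := (min_le_left _ _).trans (min_le_left _ _)
  have hDℓ : D ≤ -ℓ / 80 := (min_le_left _ _).trans (min_le_right _ _)
  have hD1 : D ≤ 1 := min_le_right _ _
  have hN1 : (1 : ℝ) ≤ N := by rw [hN]; push_cast; linarith [Nat.cast_nonneg (α := ℝ) (Fintype.card ι)]
  have hτD : τ ≤ D := by nlinarith
  refine ⟨τ / 3, by positivity, by linarith, fun b n hn hn40 => ?_⟩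
  by_contra hcon
  push Not at hcon
  have hk : ∀ k : Fin N, ∃ c, ∃ j : ℤ, |b c + n c * (k * τ) + j * ℓ| < τ / 3 := by
    intro k
    refine hcon (k * τ) (by positivity) ?_
    have : (k : ℝ) ≤ N := by exact_mod_cast k.2.le
    nlinarith
  choose c j hcj using hk
  obtain ⟨k, k', hkk, hc⟩ := Fintype.exists_ne_map_eq_of_card_lt c (by simp [hN])
  have h1 := hcj k
  have h2 := hcj k'
  rw [← hc] at h2
  set m := n (c k)
  have hm0 : m ≠ 0 := hn _
  have hm40 : |m| ≤ 40 := hn40 _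
  have h3 : |((m * ((k : ℤ) - (k' : ℤ)) : ℤ) : ℝ) * τ + ((j k - j k' : ℤ) : ℝ) * ℓ| < τ := by
    rw [abs_lt] at h1 h2 ⊢
    push_cast
    constructor <;> nlinarith
  have hkz : (k : ℤ) - (k' : ℤ) ≠ 0 := by
    intro h
    apply hkk
    ext
    omega
  by_cases hj : j k = j k'
  · rw [hj, sub_self, Int.cast_zero, zero_mul, add_zero, abs_mul, abs_of_pos hτ0] at h3
    have : (1 : ℝ) ≤ |((m * ((k : ℤ) - (k' : ℤ)) : ℤ) : ℝ)| := by
      rw [← Int.cast_abs]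
      exact_mod_cast Int.one_le_abs (mul_ne_zero hm0 hkz)
    nlinarith
  · have e1 : (1 : ℝ) ≤ |((j k - j k' : ℤ) : ℝ)| := by
      rw [← Int.cast_abs]
      exact_mod_cast Int.one_le_abs (sub_ne_zero.2 hj)
    have e2 : |((m * ((k : ℤ) - (k' : ℤ)) : ℤ) : ℝ)| ≤ 40 * N := by
      have h5 : |(k : ℤ) - (k' : ℤ)| ≤ N := by
        have := k.2; have := k'.2
        rw [abs_le]; constructor <;> omega
      rw [← Int.cast_abs, abs_mul]
      have : |m| * |(k : ℤ) - (k' : ℤ)| ≤ 40 * N := by gcongr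
      exact_mod_cast this
    have e3 := abs_sub (((m * ((k : ℤ) - (k' : ℤ)) : ℤ) : ℝ) * τ + ((j k - j k' : ℤ) : ℝ) * ℓ)
      (((m * ((k : ℤ) - (k' : ℤ)) : ℤ) : ℝ) * τ)
    rw [add_sub_cancel_left, abs_mul, abs_of_neg hℓ, abs_mul (((m * _ : ℤ) : ℝ)),
      abs_of_pos hτ0] at e3
    have e4 : |((m * ((k : ℤ) - (k' : ℤ)) : ℤ) : ℝ)| * τ ≤ 40 * D := by
      calc _ ≤ 40 * N * τ := by gcongr
        _ = _ := by rw [mul_assoc, hNτ]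
    nlinarith

/-- The exponents of a one-parameter family of parameters along which the arguments of all the
gamma functions move. -/
def drift : Fin 6 → ℤ := ![1, 2, 3, 4, 5, -15]

lemma sum_drift : ∑ r, drift r = 0 := by decide

/-- Labels of the gamma functions in the rescaled integrand. -/
abbrev ArgIndex := Fin 6 × Bool ⊕ Fin 6 × Fin 6 ⊕ Bool

/-- The exponent of the argument of a gamma function, as an additive function. -/
def argForm {R : Type*} [AddGroup R] (x : Fin 6 → R) (y : R) : ArgIndex → R
  | .inl (r, true) => x r + y
  | .inl (r, false) => x r - y
  | .inr (.inl (r, s)) => x r + x s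
  | .inr (.inr true) => y + y
  | .inr (.inr false) => -(y + y)

/-- The velocities 1, 2, 3, 4, 5, -15 of the log|u_r| sum to zero, so the product of the u_r is
kept, and with the velocity 20 of log|z| every gamma argument really moves. Even the unneeded
diagonal pairs are covered. -/
lemma argForm_drift (c : ArgIndex) : argForm drift 20 c ≠ 0 ∧ |argForm drift 20 c| ≤ 40 := by
  rcases c with ⟨r, _ | _⟩ | ⟨r, s⟩ | _ | _
  · fin_cases r <;> decide
  · fin_cases r <;> decide
  · fin_cases r <;> fin_cases s <;> decide
  · decide
  · decide

lemma abs_argForm_le {x : Fin 6 → ℝ} {y B : ℝ} (hx : ∀ r, |x r| ≤ B) (hy : |y| ≤ B)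
    (c : ArgIndex) : |argForm x y c| ≤ 2 * B := by
  rcases c with ⟨r, _ | _⟩ | ⟨r, s⟩ | _ | _
  · exact (abs_sub _ _).trans (by linarith [hx r])
  · exact (abs_add_le _ _).trans (by linarith [hx r])
  · exact (abs_add_le _ _).trans (by linarith [hx r, hx s])
  · simp only [argForm, abs_neg]
    exact (abs_add_le _ _).trans (by linarith)
  · exact (abs_add_le _ _).trans (by linarith)

lemma regular_of_log {p q z : ℂ} {t : Fin 6 → ℂ} {π ℓ η y : ℝ} {x : Fin 6 → ℝ} (hη : 0 < η)
    (hp : ‖p‖ = Real.exp π) (hq : ‖q‖ = Real.exp ℓ) (ht : ∀ r, ‖t r‖ = Real.exp (x r))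
    (hz : ‖z‖ = Real.exp y)
    (h1 : ∀ c, ∀ i j : ℕ, η ≤ |argForm x y c + i * π + j * ℓ|)
    (h2 : ∀ c, ∀ i j : ℕ, η ≤ |argForm x y c - (i + 1) * π - (j + 1) * ℓ|) :
    Regular ((1 - Real.exp (-η)) / 2) p q t z := by
  refine ⟨fun r => ⟨?_, ?_⟩, fun r s _ => ?_, ?_, ?_⟩
  · exact away_of_log hη hp hq (x := x r + y) (by rw [norm_mul, ht, hz, Real.exp_add])
      (h1 (.inl (r, true))) (h2 (.inl (r, true)))
  · exact away_of_log hη hp hq (x := x r - y) (by rw [norm_div, ht, hz, Real.exp_sub])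
      (h1 (.inl (r, false))) (h2 (.inl (r, false)))
  · exact away_of_log hη hp hq (x := x r + x s) (by rw [norm_mul, ht, ht, Real.exp_add])
      (h1 (.inr (.inl (r, s)))) (h2 (.inr (.inl (r, s))))
  · exact away_of_log hη hp hq (x := y + y) (by rw [norm_pow, hz, sq, Real.exp_add])
      (h1 (.inr (.inr true))) (h2 (.inr (.inr true)))
  · exact away_of_log hη hp hq (x := -(y + y))
      (by rw [norm_div, norm_one, norm_pow, hz, sq, Real.exp_neg, Real.exp_add, one_div])
      (h1 (.inr (.inr false))) (h2 (.inr (.inr false)))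

lemma argForm_add_smul (x x' : Fin 6 → ℝ) (y y' a : ℝ) (c : ArgIndex) :
    argForm (fun r => x r + x' r * a) (y + y' * a) c = argForm x y c + argForm x' y' c * a := by
  rcases c with ⟨r, _ | _⟩ | ⟨r, s⟩ | _ | _ <;> simp only [argForm] <;> ring

lemma argForm_intCast (x : Fin 6 → ℤ) (y : ℤ) (c : ArgIndex) :
    argForm (fun r => (x r : ℝ)) (y : ℝ) c = (argForm x y c : ℤ) := by
  rcases c with ⟨r, _ | _⟩ | ⟨r, s⟩ | _ | _ <;> simp [argForm]

/-- Uniqueness can only be tested where the integrand is regular, so such points are needed for all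
large v with M and ε fixed. The same u and z serve v and 2v, because `sob` may depend on u and z in
an arbitrary way and its value has to be eliminated. The shift σ may vary with v but stays below δ.
-/
theorem exists_regular {lq : ℂ} (lx : ℂ) (hlq : lq.re < 0) (α : Fin 6 → ℝ) (ζ : ℝ)
    {lam : Fin 6 → ℝ} (mu : ℝ) (hl : ∑ r, lam r = lq.re) {δ : ℝ} (hδ : 0 < δ) :
    ∃ M > (0 : ℝ), ∃ ε > (0 : ℝ), ∃ V : ℕ, (∀ r, |α r| ≤ M) ∧ |ζ| ≤ M ∧ ∀ v : ℕ, V ≤ v →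
      ∃ σ : ℝ, 0 ≤ σ ∧ σ ≤ δ ∧ ∃ (u : Fin 6 → ℂ) (z : ℂ), ∏ r, u r = Complex.exp lq ∧
        (∀ r, 1 / M ≤ ‖u r‖ ∧ ‖u r‖ ≤ M) ∧ 1 / M ≤ ‖z‖ ∧ ‖z‖ ≤ M ∧
        (∀ r, Real.log ‖u r‖ = lam r + drift r * σ) ∧ Real.log ‖z‖ = mu + 20 * σ ∧
        ∀ s : Bool, ‖pPow lq lx (bif s then 2 * v else v) 1‖ < ‖Complex.exp lq‖ ∧
          Regular ε (pPow lq lx (bif s then 2 * v else v) 1) (Complex.exp lq)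
            (fun r => u r * pPow lq lx (bif s then 2 * v else v) (α r))
            (z * pPow lq lx (bif s then 2 * v else v) (-ζ)) := by
  set ℓ := lq.re with hℓ
  set ξ := lx.re with hξ
  set S := ∑ r, |α r| + |ζ| + ∑ r, |lam r| + |mu| + 20 * δ with hS
  have hs1 : 0 ≤ ∑ r, |α r| := Finset.sum_nonneg fun _ _ => abs_nonneg _
  have hs2 : 0 ≤ ∑ r, |lam r| := Finset.sum_nonneg fun _ _ => abs_nonneg _
  have hs3 : 0 ≤ |ζ| := abs_nonneg _
  have hs4 : 0 ≤ |mu| := abs_nonneg _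
  have hαr : ∀ r, |α r| ≤ ∑ r, |α r| := fun r =>
    Finset.single_le_sum (fun r _ => abs_nonneg (α r)) (Finset.mem_univ r)
  have hlr : ∀ r, |lam r| ≤ ∑ r, |lam r| := fun r =>
    Finset.single_le_sum (fun r _ => abs_nonneg (lam r)) (Finset.mem_univ r)
  have hSe : S ≤ Real.exp S := by linarith [Real.add_one_le_exp S]
  -- The exponents of p in the arguments are at most 2S in absolute value. Beyond K a power of p
  -- dominates everything else, so only finitely many powers of p enter the pigeonhole argument.
  obtain ⟨K, hK⟩ := exists_nat_ge (2 * S + 1)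
  set B := 2 * S + 40 * δ + 1 with hB
  -- Makes log|p| ≤ -B and |p| < |q| for v and for 2v.
  obtain ⟨V, hV⟩ := exists_nat_ge ((B + |ξ| + |ℓ| + 1) / (-ℓ))
  obtain ⟨η, hη0, hη1, hη⟩ :=
    exists_shift (ArgIndex × ↥(Finset.Icc (-(K : ℤ)) K) × Bool) hlq hδ
  have hε : 0 < (1 - Real.exp (-η)) / 2 := by
    have : Real.exp (-η) < 1 := Real.exp_lt_one_iff.2 (by linarith)
    linarith
  refine ⟨Real.exp S, Real.exp_pos _, _, hε, V, fun r => by linarith [hαr r], by linarith, ?_⟩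
  intro v hv
  set π : Bool → ℝ := fun s => ξ + ((bif s then 2 * v else v : ℤ) : ℝ) * ℓ with hπ
  have hπB : ∀ s, π s ≤ -B ∧ π s < ℓ := by
    intro s
    rw [div_le_iff₀ (by linarith)] at hV
    have h1 : (V : ℝ) ≤ ((bif s then 2 * v else v : ℤ) : ℝ) := by
      cases s
      · simpa using hv
      · have : V ≤ 2 * v := by omega
        simp only [cond_true]
        exact_mod_cast this
    have h2 : (V : ℝ) * -ℓ ≤ ((bif s then 2 * v else v : ℤ) : ℝ) * -ℓ :=
      mul_le_mul_of_nonneg_right h1 (by linarith)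
    have := le_abs_self ξ
    have := neg_abs_le ℓ
    have := abs_nonneg ℓ
    constructor <;> simp only [hπ] <;> linarith
  obtain ⟨σ, hσ0, hσδ, hσ⟩ := hη
    (fun c => argForm lam mu c.1 + (argForm α (-ζ) c.1 + (c.2.1 : ℤ)) * π c.2.2)
    (fun c => argForm drift 20 c.1) (fun c => (argForm_drift c.1).1) (fun c => (argForm_drift c.1).2)
  have hdr : ∀ r, |(drift r : ℝ) * σ| ≤ 20 * δ := by
    intro r
    have h1 : |drift r| ≤ 20 := by fin_cases r <;> decide
    have h2 : |(drift r : ℝ)| ≤ 20 := by rw [← Int.cast_abs]; exact_mod_cast h1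
    rw [abs_mul, abs_of_nonneg hσ0]
    gcongr
  have h20 : |20 * σ| ≤ 20 * δ := by
    rw [abs_of_nonneg (by positivity)]; linarith
  -- The phase of q is put into u_0, since the product of the u_r has to equal q and not merely have
  -- its modulus.
  set u : Fin 6 → ℂ := fun r => Complex.exp (((lam r + drift r * σ : ℝ) : ℂ) +
    if r = 0 then (lq.im : ℂ) * Complex.I else 0) with hu
  set z : ℂ := ((Real.exp (mu + 20 * σ) : ℝ) : ℂ) with hz
  have hun : ∀ r, ‖u r‖ = Real.exp (lam r + drift r * σ) := by
    intro r
    rw [hu, Complex.norm_exp]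
    split_ifs <;> simp
  have hzn : ‖z‖ = Real.exp (mu + 20 * σ) := by
    rw [hz, Complex.norm_real, Real.norm_of_nonneg (Real.exp_pos _).le]
  have hbd : ∀ x : ℝ, |x| ≤ S → 1 / Real.exp S ≤ Real.exp x ∧ Real.exp x ≤ Real.exp S := by
    intro x hx
    rw [one_div, ← Real.exp_neg]
    exact ⟨Real.exp_le_exp.2 (abs_le.1 hx).1, Real.exp_le_exp.2 (abs_le.1 hx).2⟩
  have hzb := hbd (mu + 20 * σ) ((abs_add_le _ _).trans (by linarith))
  refine ⟨σ, hσ0, hσδ, u, z, ?_, fun r => ?_, ?_, ?_, fun r => ?_, ?_, ?_⟩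
  · rw [hu, ← Complex.exp_sum, Finset.sum_add_distrib, ← Complex.ofReal_sum,
      Finset.sum_add_distrib, hl, ← Finset.sum_mul]
    have : ∑ r, (drift r : ℝ) = 0 := by exact_mod_cast sum_drift
    rw [this]
    congr 1
    simp only [Finset.sum_ite_eq', Finset.mem_univ, if_true]
    rw [zero_mul, add_zero]
    exact Complex.re_add_im lq
  · rw [hun]
    exact hbd _ ((abs_add_le _ _).trans (by linarith [hlr r, hdr r]))
  · rw [hzn]; exact hzb.1
  · rw [hzn]; exact hzb.2
  · rw [hun, Real.log_exp]
  · rw [hzn, Real.log_exp]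
  intro s
  have hpn : ‖pPow lq lx (bif s then 2 * v else v) 1‖ = Real.exp (π s) := by
    rw [norm_pPow, one_mul]
  have hqn : ‖Complex.exp lq‖ = Real.exp ℓ := Complex.norm_exp _
  refine ⟨by rw [hpn, hqn]; exact Real.exp_lt_exp.2 (hπB s).2, ?_⟩
  set x : Fin 6 → ℝ := fun r => (lam r + α r * π s) + drift r * σ with hx
  set y : ℝ := (mu + -ζ * π s) + (20 : ℤ) * σ with hy
  have harg : ∀ c, argForm x y c = argForm lam mu c + argForm α (-ζ) c * π s +
      ((argForm drift 20 c : ℤ) : ℝ) * σ := by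
    intro c
    rw [hx, hy, argForm_add_smul (fun r => lam r + α r * π s) (fun r => (drift r : ℝ)),
      argForm_add_smul, argForm_intCast]
  have a1 : ∀ c, |argForm lam mu c| ≤ 2 * S := abs_argForm_le
    (fun r => by linarith [hlr r]) (by linarith)
  have a2 : ∀ c, |argForm α (-ζ) c| ≤ 2 * S := abs_argForm_le
    (fun r => by linarith [hαr r]) (by rw [abs_neg]; linarith)
  have a3 : ∀ c, |((argForm drift 20 c : ℤ) : ℝ) * σ| ≤ 40 * δ := by
    intro c
    have h2 : |((argForm drift 20 c : ℤ) : ℝ)| ≤ 40 := by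
      rw [← Int.cast_abs]; exact_mod_cast (argForm_drift c).2
    rw [abs_mul, abs_of_nonneg hσ0]
    gcongr
  have hB0 : 0 ≤ B := by linarith
  refine regular_of_log (x := x) (y := y) hη0 hpn hqn (fun r => ?_) ?_ ?_ ?_
  · rw [norm_mul, hun, norm_pPow, ← Real.exp_add]
    congr 1; simp only [hx, hπ]; ring
  · rw [norm_mul, hzn, norm_pPow, ← Real.exp_add]
    congr 1; simp only [hy, hπ]; push_cast; ring
  · intro c i j
    rw [harg]
    by_cases hi : i ≤ K
    · have := hσ (c, ⟨(i : ℤ), Finset.mem_Icc.2 ⟨by omega, by omega⟩⟩, s) j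
      refine this.trans_eq ?_
      congr 1; push_cast; ring
    · have hi' : (K : ℝ) ≤ i := by exact_mod_cast (not_le.1 hi).le
      have b1 := abs_le.1 (a1 c)
      have b2 := abs_le.1 (a2 c)
      have b3 := abs_le.1 (a3 c)
      have h1 : (1 : ℝ) ≤ argForm α (-ζ) c + i := by linarith
      have h2 : (argForm α (-ζ) c + i) * π s ≤ -B := by nlinarith [(hπB s).1]
      have h3 : (j : ℝ) * ℓ ≤ 0 := mul_nonpos_of_nonneg_of_nonpos (by positivity) hlq.le
      refine hη1.trans (le_abs.2 (Or.inr ?_))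
      linarith
  · intro c i j
    rw [harg]
    by_cases hi : i + 1 ≤ K
    · have := hσ (c, ⟨-(i + 1 : ℤ), Finset.mem_Icc.2 ⟨by omega, by omega⟩⟩, s) (-(j + 1))
      refine this.trans_eq ?_
      congr 1; push_cast; ring
    · have hi' : (K : ℝ) ≤ i + 1 := by exact_mod_cast (not_le.1 hi).le
      have b1 := abs_le.1 (a1 c)
      have b2 := abs_le.1 (a2 c)
      have b3 := abs_le.1 (a3 c)
      have h1 : argForm α (-ζ) c - (i + 1) ≤ (-1 : ℝ) := by linarith
      have h2 : B ≤ (argForm α (-ζ) c - (i + 1)) * π s := by nlinarith [(hπB s).1]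
      have h3 : ((j : ℝ) + 1) * ℓ ≤ 0 := mul_nonpos_of_nonneg_of_nonpos (by positivity) hlq.le
      refine hη1.trans (le_abs.2 (Or.inl ?_))
      linarith

/-! ### Uniqueness of the order behavior -/

/-- Along the parameters of `exists_regular`, two order behaviors differ by a bounded factor. -/
theorem IsOrderBehavior.exists_bound {lq lx : ℂ} (hlq : lq.re < 0) {fob : (Fin 6 → ℝ) → ℝ → ℝ}
    {sob : (Fin 6 → ℝ) → ℝ → (Fin 6 → ℂ) → ℂ → ℂ} (h : IsOrderBehavior lq lx fob sob)
    {α : Fin 6 → ℝ} (hα : ∑ r, α r = 1) (ζ : ℝ) {lam : Fin 6 → ℝ} (mu : ℝ)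
    (hl : ∑ r, lam r = lq.re) {δ : ℝ} (hδ : 0 < δ) :
    ∃ (C : ℝ) (V : ℕ), ∀ v : ℕ, V ≤ v → ∃ σ : ℝ, 0 ≤ σ ∧ σ ≤ δ ∧ ∃ (u : Fin 6 → ℂ) (z : ℂ),
      (∀ r, u r ≠ 0) ∧ z ≠ 0 ∧ ∀ s : Bool, |lq.re * ((bif s then 2 * v else v : ℤ) ^ 2 *
        (fob α ζ - firstOrder α ζ) / 2) + (bif s then 2 * v else v : ℤ) *
          (Real.log ‖sob α ζ u z‖ - (lx.re * firstOrder α ζ + secondOrder lq.re α ζ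
            (fun r => lam r + drift r * σ) (mu + 20 * σ)))| ≤ C := by
  obtain ⟨M, hM, ε, hε, V, hαM, hζM, hreg⟩ := exists_regular lx hlq α ζ mu hl hδ
  obtain ⟨C, hC⟩ := exists_log_norm_rescaledIntegrand_bound (lx := lx) hlq hM hε
  obtain ⟨C₁, hC₁, C₂, hC₂, hb⟩ := h.2 M hM ε hε
  refine ⟨C + (|Real.log C₁| + |Real.log C₂|), V, fun v hv => ?_⟩
  obtain ⟨σ, hσ0, hσδ, u, z, hu, huM, hz1, hz2, hlu, hlz, hs⟩ := hreg v hv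
  have hpos : ∀ {x : ℂ}, 1 / M ≤ ‖x‖ → x ≠ 0 := fun h =>
    norm_pos_iff.1 (lt_of_lt_of_le (by positivity) h)
  have hu0 : ∀ r, u r ≠ 0 := fun r => hpos (huM r).1
  refine ⟨σ, hσ0, hσδ, u, z, hu0, hpos hz1, fun s => ?_⟩
  obtain ⟨hpq, hr⟩ := hs s
  obtain ⟨hne, h1⟩ := hC α ζ u z _ hα hαM hζM hu huM hz1 hz2 hpq hr
  obtain ⟨h2, h3⟩ := hb α ζ u z _ hα hαM hζM hu huM hz1 hz2 hpq hr
  obtain ⟨hn, hlog⟩ := log_norm_mul_exp_mul_zpow (lq := lq) hne (h.1 α ζ u z hu0 (hpos hz1))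
    (bif s then 2 * v else v) (fob α ζ)
  have h4 := Real.log_le_log hC₁ h2.le
  have h5 := Real.log_le_log (hC₁.trans h2) h3.le
  rw [hlog] at h4 h5
  simp only [hlu, hlz] at h1
  have := neg_abs_le (Real.log C₁)
  have := le_abs_self (Real.log C₂)
  have := abs_nonneg (Real.log C₁)
  have := abs_nonneg (Real.log C₂)
  rw [abs_le] at h1 ⊢
  constructor <;> linarith

lemma eq_zero_of_nat_mul_abs_le {x C : ℝ} {V : ℕ} (h : ∀ v : ℕ, V ≤ v → v * |x| ≤ C) : x = 0 := by
  by_contra hx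
  have hp := abs_pos.2 hx
  obtain ⟨n, hn⟩ := exists_nat_gt (C / |x|)
  have h1 := h (max V n) (le_max_left _ _)
  have h2 : (n : ℝ) ≤ (max V n : ℕ) := by exact_mod_cast le_max_right V n
  rw [div_lt_iff₀ hp] at hn
  nlinarith

/-- At fixed u and z the unknown log|sob| contributes linearly in v, so it cancels in the estimate
at 2v minus twice the estimate at v. What is left is v² times the difference of the first orders. -/
theorem IsOrderBehavior.eq_firstOrder {lq lx : ℂ} (hlq : lq.re < 0) {fob : (Fin 6 → ℝ) → ℝ → ℝ}
    {sob : (Fin 6 → ℝ) → ℝ → (Fin 6 → ℂ) → ℂ → ℂ} (h : IsOrderBehavior lq lx fob sob)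
    {α : Fin 6 → ℝ} (hα : ∑ r, α r = 1) (ζ : ℝ) : fob α ζ = firstOrder α ζ := by
  obtain ⟨C, V, hC⟩ := h.exists_bound hlq hα ζ (lam := fun _ => lq.re / 6) 0 (by simp; ring)
    one_pos
  have h0 : lq.re * (fob α ζ - firstOrder α ζ) = 0 := by
    refine eq_zero_of_nat_mul_abs_le (C := 3 * C) (V := V + 1) fun v hv => ?_
    obtain ⟨σ, -, -, u, z, -, -, hs⟩ := hC v (by omega)
    have h1 := hs false
    have h2 := hs true
    simp only [cond_true, cond_false] at h1 h2
    push_cast at h1 h2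
    generalize Real.log ‖sob α ζ u z‖ - _ = T at h1 h2
    have hv1 : (1 : ℝ) ≤ v := by exact_mod_cast (by omega : 1 ≤ v)
    -- The coefficient is 4/2 - 2/2 = 1, and the errors add up to C + 2C.
    have h3 : |(v : ℝ) ^ 2 * (lq.re * (fob α ζ - firstOrder α ζ))| ≤ 3 * C := by
      rw [abs_le] at h1 h2 ⊢
      constructor <;> linarith
    rw [abs_mul, abs_of_nonneg (by positivity)] at h3
    have : (v : ℝ) ≤ v ^ 2 := by nlinarith
    exact (mul_le_mul_of_nonneg_right this (abs_nonneg _)).trans h3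
  rcases mul_eq_zero.1 h0 with h1 | h1
  · exact absurd h1 hlq.ne
  · linarith

lemma secondOrder_add_smul (ℓ : ℝ) (α lam k : Fin 6 → ℝ) (ζ mu m σ : ℝ) :
    secondOrder ℓ α ζ (fun r => lam r + k r * σ) (mu + m * σ) = secondOrder ℓ α ζ lam mu +
      σ * (secondOrder ℓ α ζ (fun r => lam r + k r) (mu + m) - secondOrder ℓ α ζ lam mu) := by
  simp only [secondOrder, sum_pairs, Fin.sum_univ_six]
  ring

/-- With trivial orders at (α, ζ), v times Q at the regular point stays bounded. The regular point
differs from the prescribed one by the shift σ, but Q is affine, so for small δ it keeps at least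
half of a nonzero value. -/
theorem IsOrderBehavior.secondOrder_eq_zero {lq lx : ℂ} (hlq : lq.re < 0)
    {fob : (Fin 6 → ℝ) → ℝ → ℝ} {sob : (Fin 6 → ℝ) → ℝ → (Fin 6 → ℂ) → ℂ → ℂ}
    (h : IsOrderBehavior lq lx fob sob) {α : Fin 6 → ℝ} (hα : ∑ r, α r = 1) {ζ : ℝ}
    (h0 : fob α ζ = 0)
    (h1 : ∀ (u : Fin 6 → ℂ) (z : ℂ), (∀ r, u r ≠ 0) → z ≠ 0 → sob α ζ u z = 1)
    {lam : Fin 6 → ℝ} (hl : ∑ r, lam r = lq.re) (mu : ℝ) :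
    secondOrder lq.re α ζ lam mu = 0 := by
  have hF := h.eq_firstOrder hlq hα ζ
  rw [h0] at hF
  by_contra hne
  set Q := secondOrder lq.re α ζ lam mu with hQ
  set L := secondOrder lq.re α ζ (fun r => lam r + drift r) (mu + 20) - Q with hL
  have hp := abs_pos.2 hne
  obtain ⟨C, V, hC⟩ := h.exists_bound hlq hα ζ mu hl (δ := |Q| / (2 * (|L| + 1))) (by positivity)
  refine hne (eq_zero_of_nat_mul_abs_le (C := 2 * C) (V := V) fun v hv => ?_)
  obtain ⟨σ, hσ0, hσ, u, z, hu, hz, hs⟩ := hC v hv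
  have h2 := hs false
  rw [h0, ← hF, h1 u z hu hz, secondOrder_add_smul, ← hQ, ← hL] at h2
  simp only [norm_one, Real.log_one, sub_zero, mul_zero, zero_div, zero_add, zero_sub, cond_false,
    Int.cast_natCast, abs_mul, abs_neg, Nat.abs_cast] at h2
  have h3 : σ * |L| ≤ |Q| / 2 := by
    rw [le_div_iff₀ (by positivity)] at hσ
    nlinarith [abs_nonneg L]
  have h4 : |Q| / 2 ≤ |Q + σ * L| := by
    have := abs_sub (Q + σ * L) (σ * L)
    rw [add_sub_cancel_right, abs_mul, abs_of_nonneg hσ0] at this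
    linarith
  have h5 : (0 : ℝ) ≤ v := by positivity
  nlinarith

/-! ### The polytopes in terms of inequalities -/

lemma e_apply (r k : Fin 6) : e r k = if k = r then 1 else 0 := by
  simp [e, Pi.single_apply]

lemma sum_e (S : Finset (Fin 6)) (r : Fin 6) : ∑ k ∈ S, e r k = if r ∈ S then 1 else 0 := by
  simp [e_apply]

lemma sum_mul_e (S : Finset (Fin 6)) (w : Fin 6 → ℝ) (k : Fin 6) :
    ∑ r ∈ S, w r * e r k = if k ∈ S then w k else 0 := by
  simp [e_apply]

/-- The simplex with vertices `e r`. -/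
def ShapeOne (b : Fin 6 → ℝ) : Prop := ∑ r, b r = 1 ∧ ∀ r, 0 ≤ b r

/-- The cross polytope with vertices `e r` and `rho - e a - e r`, `r ≠ a`. -/
def ShapeTwo (a : Fin 6) (b : Fin 6 → ℝ) : Prop :=
  ∑ r, b r = 1 ∧ ∑ r ∈ Finset.univ.erase a, |b r + b a| ≤ 1

/-- The simplex with vertices `e r`, `r ∈ T`, and `rho - e r - e s`, `r, s ∉ T`. -/
def ShapeThree (T : Finset (Fin 6)) (b : Fin 6 → ℝ) : Prop :=
  ∑ r, b r = 1 ∧ (∀ r ∈ T, 0 ≤ b r - (∑ s ∈ T, b s - 1)) ∧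
    ∀ r ∉ T, 0 ≤ b r + (∑ s ∈ T, b s - 1)

lemma convex_shapeOne : Convex ℝ {b | ShapeOne b} := by
  rintro x ⟨hx1, hx2⟩ y ⟨hy1, hy2⟩ c d hc hd hcd
  refine ⟨?_, fun r => ?_⟩
  · simp only [Pi.add_apply, Pi.smul_apply, smul_eq_mul, Finset.sum_add_distrib, ← Finset.mul_sum,
      hx1, hy1]
    linarith
  · simp only [Pi.add_apply, Pi.smul_apply, smul_eq_mul]
    nlinarith [hx2 r, hy2 r, mul_nonneg hc (hx2 r), mul_nonneg hd (hy2 r)]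

lemma convex_shapeTwo (a : Fin 6) : Convex ℝ {b | ShapeTwo a b} := by
  rintro x ⟨hx1, hx2⟩ y ⟨hy1, hy2⟩ c d hc hd hcd
  refine ⟨?_, ?_⟩
  · simp only [Pi.add_apply, Pi.smul_apply, smul_eq_mul, Finset.sum_add_distrib, ← Finset.mul_sum,
      hx1, hy1]
    linarith
  · simp only [Pi.add_apply, Pi.smul_apply, smul_eq_mul]
    have : ∀ r, |c * x r + d * y r + (c * x a + d * y a)| ≤
        c * |x r + x a| + d * |y r + y a| := fun r => by
      have e : c * x r + d * y r + (c * x a + d * y a) = c * (x r + x a) + d * (y r + y a) := by ring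
      rw [e]
      refine (abs_add_le _ _).trans_eq ?_
      rw [abs_mul, abs_mul, abs_of_nonneg hc, abs_of_nonneg hd]
    refine (Finset.sum_le_sum fun r _ => this r).trans ?_
    rw [Finset.sum_add_distrib, ← Finset.mul_sum, ← Finset.mul_sum]
    nlinarith

lemma convex_shapeThree (T : Finset (Fin 6)) : Convex ℝ {b | ShapeThree T b} := by
  rintro x ⟨hx1, hx2, hx3⟩ y ⟨hy1, hy2, hy3⟩ c d hc hd hcd
  have hd' : d = 1 - c := by linarith
  refine ⟨?_, fun r hr => ?_, fun r hr => ?_⟩ <;>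
    simp only [Pi.add_apply, Pi.smul_apply, smul_eq_mul, Finset.sum_add_distrib, ← Finset.mul_sum]
  · rw [hx1, hy1]; linarith
  · have := mul_nonneg hc (hx2 r hr)
    have := mul_nonneg hd (hy2 r hr)
    subst hd'; linarith
  · have := mul_nonneg hc (hx3 r hr)
    have := mul_nonneg hd (hy3 r hr)
    subst hd'; linarith

/-- The vertices of the simplex `ShapeOne`. -/
def verticesOne : Set (Fin 6 → ℝ) := {x | ∃ r, x = e r}

/-- The vertices of the cross polytope `ShapeTwo`. -/
def verticesTwo (a : Fin 6) : Set (Fin 6 → ℝ) :=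
  {x | ∃ r, r ≠ a ∧ (x = e r ∨ x = rho - e a - e r)}

/-- The vertices of the simplex `ShapeThree`. -/
def verticesThree (T : Finset (Fin 6)) : Set (Fin 6 → ℝ) :=
  {x | (∃ r ∈ T, x = e r) ∨ ∃ r s, r ∉ T ∧ s ∉ T ∧ r ≠ s ∧ x = rho - e r - e s}

/-- The `r`-th vertex of the simplex `ShapeThree`. -/
noncomputable def vertexThree (T : Finset (Fin 6)) (r : Fin 6) : Fin 6 → ℝ :=
  if r ∈ T then e r else fun k => 1 / 2 + e r k - if k ∈ T then 0 else 1

lemma compl_eq_of_card {T : Finset (Fin 6)} (hT : T.card = 3) {r : Fin 6} (hr : r ∉ T) :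
    ∃ s t, s ∉ T ∧ t ∉ T ∧ s ≠ t ∧ s ≠ r ∧ t ≠ r ∧ ∀ k, k ∉ T → k = r ∨ k = s ∨ k = t := by
  have h1 : (Tᶜ.erase r).card = 2 := by
    rw [Finset.card_erase_of_mem (Finset.mem_compl.2 hr), Finset.card_compl, hT]; rfl
  obtain ⟨s, t, hst, h⟩ := Finset.card_eq_two.1 h1
  have hs : s ∈ Tᶜ.erase r := by rw [h]; simp
  have ht : t ∈ Tᶜ.erase r := by rw [h]; simp
  simp only [Finset.mem_erase, Finset.mem_compl] at hs ht
  refine ⟨s, t, hs.2, ht.2, hst, hs.1, ht.1, fun k hk => ?_⟩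
  by_cases hkr : k = r
  · exact Or.inl hkr
  · have : k ∈ Tᶜ.erase r := by simp [hkr, hk]
    rw [h] at this
    simpa [hkr] using this

lemma rho_sub_e_sub_e {T : Finset (Fin 6)} {r s t : Fin 6} (hr : r ∉ T)
    (hs : s ∉ T) (ht : t ∉ T) (hst : s ≠ t) (hsr : s ≠ r) (htr : t ≠ r)
    (h : ∀ k, k ∉ T → k = r ∨ k = s ∨ k = t) : vertexThree T r = rho - e s - e t := by
  funext k
  simp only [vertexThree, if_neg hr, Pi.sub_apply, rho, e_apply]
  by_cases hk : k ∈ T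
  · have h1 : k ≠ r := fun h => hr (h ▸ hk)
    have h2 : k ≠ s := fun h => hs (h ▸ hk)
    have h3 : k ≠ t := fun h => ht (h ▸ hk)
    simp [hk, h1, h2, h3]
  · rcases h k hk with rfl | rfl | rfl
    · simp [hk, hsr.symm, htr.symm]
    · simp [hk, hst, hsr]
    · simp [hk, hst.symm, htr]

lemma verticesThree_eq_range {T : Finset (Fin 6)} (hT : T.card = 3) :
    verticesThree T = Set.range (vertexThree T) := by
  ext x
  constructor
  · rintro (⟨r, hr, rfl⟩ | ⟨s, t, hs, ht, hst, rfl⟩)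
    · exact ⟨r, by simp [vertexThree, hr]⟩
    · obtain ⟨s', r, hs', hr, h1, h2, h3, h4⟩ := compl_eq_of_card hT hs
      have : ∃ r, r ∉ T ∧ s ≠ r ∧ t ≠ r ∧ ∀ k, k ∉ T → k = r ∨ k = s ∨ k = t := by
        rcases h4 t ht with h | h | h
        · exact absurd h.symm hst
        · subst h
          exact ⟨r, hr, h3.symm, h1, fun k hk => by have := h4 k hk; tauto⟩
        · subst h
          exact ⟨s', hs', h2.symm, h1.symm, fun k hk => by have := h4 k hk; tauto⟩
      obtain ⟨r, hr, h1, h2, h3⟩ := this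
      exact ⟨r, rho_sub_e_sub_e hr hs ht hst h1 h2 h3⟩
  · rintro ⟨r, rfl⟩
    by_cases hr : r ∈ T
    · exact Or.inl ⟨r, hr, by simp [vertexThree, hr]⟩
    · obtain ⟨s, t, hs, ht, hst, h1, h2, h3⟩ := compl_eq_of_card hT hr
      exact Or.inr ⟨s, t, hs, ht, hst, rho_sub_e_sub_e hr hs ht hst h1 h2 h3⟩

lemma convexHull_verticesOne : convexHull ℝ verticesOne = {b | ShapeOne b} := by
  refine Subset.antisymm (convexHull_min ?_ convex_shapeOne) ?_
  · rintro x ⟨r, rfl⟩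
    refine ⟨by simp [sum_e], fun k => ?_⟩
    rw [e_apply]; split_ifs <;> norm_num
  · rintro b ⟨h1, h2⟩
    have h := (convex_convexHull ℝ verticesOne).sum_mem (t := Finset.univ) (w := b) (z := e)
      (fun r _ => h2 r) h1 (fun r _ => subset_convexHull ℝ _ ⟨r, rfl⟩)
    have e1 : ∑ r, b r • e r = b := by
      funext k
      simp [Finset.sum_apply, sum_mul_e]
    rwa [e1] at h

/-- The numbers n_r = b_r + b_a, r ≠ a, are coordinates in which the polytope is the unit ball of
the ℓ¹ norm: e_r and its opposite vertex ρ - e_a - e_r have n equal to plus and minus the r-th unit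
vector. -/
lemma convexHull_verticesTwo (a : Fin 6) : convexHull ℝ (verticesTwo a) = {b | ShapeTwo a b} := by
  have hsum : ∀ f : Fin 6 → ℝ, ∑ r ∈ Finset.univ.erase a, f r = ∑ r, f r - f a := fun f => by
    rw [Finset.sum_erase_eq_sub (Finset.mem_univ a)]
  refine Subset.antisymm (convexHull_min ?_ (convex_shapeTwo a)) ?_
  · rintro x ⟨r, hr, rfl | rfl⟩
    · refine ⟨by simp [sum_e], ?_⟩
      have : ∀ k ∈ Finset.univ.erase a, |e r k + e r a| = e r k := by
        intro k hk
        rw [e_apply r a, if_neg hr.symm, add_zero, abs_of_nonneg]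
        rw [e_apply]; split_ifs <;> norm_num
      rw [Finset.sum_congr rfl this, sum_e]
      simp [hr]
    · refine ⟨?_, ?_⟩
      · simp only [Pi.sub_apply, Finset.sum_sub_distrib, sum_e, rho]
        simp; norm_num
      have : ∀ k ∈ Finset.univ.erase a,
          |(rho - e a - e r) k + (rho - e a - e r) a| = e r k := by
        intro k hk
        have hka := Finset.ne_of_mem_erase hk
        simp only [Pi.sub_apply, rho, e_apply, if_neg hr.symm, if_neg hka]
        split_ifs <;> norm_num
      rw [Finset.sum_congr rfl this, sum_e]
      simp [hr]
  · rintro b ⟨h1, h2⟩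
    set n : Fin 6 → ℝ := fun r => b r + b a with hn
    set s := 1 - ∑ r ∈ Finset.univ.erase a, |n r| with hs
    have hs0 : 0 ≤ s := by linarith
    have hcard : (Finset.univ.erase a).card = 5 := by
      rw [Finset.card_erase_of_mem (Finset.mem_univ a)]; rfl
    have hN : ∑ r ∈ Finset.univ.erase a, n r = 1 + 4 * b a := by
      rw [Finset.sum_add_distrib, hsum, h1, Finset.sum_const, hcard]; simp; ring
    have hpm : ∀ x : ℝ, max 0 x = (|x| + x) / 2 ∧ max 0 (-x) = (|x| - x) / 2 := by
      intro x
      rcases le_total 0 x with h | h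
      · rw [max_eq_right h, max_eq_left (by linarith), abs_of_nonneg h]; constructor <;> ring
      · rw [max_eq_left h, max_eq_right (by linarith), abs_of_nonpos h]; constructor <;> ring
    -- Positive and negative parts of n_r are the weights of the two opposite vertices, and the
    -- slack s is spread evenly over all ten, which changes no difference of opposite weights.
    set wp : Fin 6 → ℝ := fun r => max 0 (n r) + s / 10 with hwp
    set wm : Fin 6 → ℝ := fun r => max 0 (-n r) + s / 10 with hwm
    have hWm : ∑ r ∈ Finset.univ.erase a, wm r = -2 * b a := by
      simp only [hwm, (hpm _).2, Finset.sum_add_distrib, ← Finset.sum_div, Finset.sum_sub_distrib,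
        hN, Finset.sum_const, hcard]
      simp only [hs, nsmul_eq_mul]; push_cast; ring
    have hWp : ∑ r ∈ Finset.univ.erase a, wp r = 1 + 2 * b a := by
      simp only [hwp, (hpm _).1, Finset.sum_add_distrib, ← Finset.sum_div,
        hN, Finset.sum_const, hcard]
      simp only [hs, nsmul_eq_mul]; push_cast; ring
    have h := (convex_convexHull ℝ (verticesTwo a)).sum_mem
      (t := Finset.univ.erase a ×ˢ (Finset.univ : Finset Bool))
      (w := fun c => bif c.2 then wp c.1 else wm c.1)
      (z := fun c => bif c.2 then e c.1 else rho - e a - e c.1)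
      (by rintro ⟨r, _ | _⟩ _ <;> simp only [hwp, hwm, cond_true, cond_false] <;> positivity)
      (by simp only [Finset.sum_product, Fintype.sum_bool, cond_true, cond_false,
            Finset.sum_add_distrib, hWp, hWm]; ring)
      (by rintro ⟨r, _ | _⟩ hr
          · exact subset_convexHull ℝ _ ⟨r, by simpa using hr, Or.inr rfl⟩
          · exact subset_convexHull ℝ _ ⟨r, by simpa using hr, Or.inl rfl⟩)
    convert h using 1
    simp only [Finset.sum_product, Fintype.sum_bool, cond_true, cond_false, Finset.sum_add_distrib]
    funext k
    simp only [Pi.add_apply, Finset.sum_apply, Pi.smul_apply, smul_eq_mul, sum_mul_e,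
      Pi.sub_apply, mul_sub, Finset.sum_sub_distrib, ← Finset.sum_mul, hWm, rho]
    by_cases hk : k = a
    · subst hk
      simp [e_apply]; ring
    · simp only [Finset.mem_erase, Finset.mem_univ, and_true, ne_eq, hk, not_false_eq_true, if_true,
        e_apply, if_false]
      have h3 : wp k - wm k = n k := by
        simp only [hwp, hwm]
        rw [(hpm (n k)).1, (hpm (n k)).2]; ring
      have h4 : n k = b k + b a := rfl
      linarith

/-- The six linear forms in the inequalities are the barycentric coordinates. For r ∉ T the r-th one
belongs to ρ - e_s - e_t, where r, s, t are the elements outside T. -/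
lemma convexHull_verticesThree {T : Finset (Fin 6)} (hT : T.card = 3) :
    convexHull ℝ (verticesThree T) = {b | ShapeThree T b} := by
  refine Subset.antisymm (convexHull_min ?_ (convex_shapeThree T)) ?_
  · rintro x (⟨r, hr, rfl⟩ | ⟨s, t, hs, ht, hst, rfl⟩)
    · refine ⟨by simp [sum_e], fun k _ => ?_, fun k _ => ?_⟩ <;>
      · rw [sum_e, if_pos hr, e_apply]; split_ifs <;> norm_num
    · have hT' : ∑ k ∈ T, (rho - e s - e t) k = 3 / 2 := by
        simp only [Pi.sub_apply, Finset.sum_sub_distrib, sum_e, if_neg hs, if_neg ht, rho,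
          Finset.sum_const, hT]
        norm_num
      refine ⟨?_, fun k hk => ?_, fun k hk => ?_⟩
      · simp only [Pi.sub_apply, Finset.sum_sub_distrib, sum_e, rho]
        simp; norm_num
      · have h1 : k ≠ s := fun h => hs (h ▸ hk)
        have h2 : k ≠ t := fun h => ht (h ▸ hk)
        rw [hT']
        simp only [Pi.sub_apply, rho, e_apply, if_neg h1, if_neg h2]; norm_num
      · rw [hT']
        simp only [Pi.sub_apply, rho, e_apply]
        by_cases h1 : k = s
        · subst h1; simp [hst]; norm_num
        · simp only [if_neg h1]; split_ifs <;> norm_num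
  · rintro b ⟨h1, h2, h3⟩
    set m := ∑ s ∈ T, b s - 1 with hm
    set w : Fin 6 → ℝ := fun r => if r ∈ T then b r - m else b r + m with hw
    have hcard : Tᶜ.card = 3 := by rw [Finset.card_compl, hT]; rfl
    have hsplit : ∀ f : Fin 6 → ℝ, ∑ r, f r = ∑ r ∈ T, f r + ∑ r ∈ Tᶜ, f r := fun f =>
      (Finset.sum_add_sum_compl T f).symm
    have hwT : ∑ r ∈ T, w r = 1 - 2 * m := by
      have : ∀ r ∈ T, w r = b r - m := fun r hr => if_pos hr
      rw [Finset.sum_congr rfl this, Finset.sum_sub_distrib, Finset.sum_const, hT]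
      simp only [nsmul_eq_mul]; push_cast; linarith
    have hwc : ∑ r ∈ Tᶜ, w r = 2 * m := by
      have : ∀ r ∈ Tᶜ, w r = b r + m := fun r hr => if_neg (Finset.mem_compl.1 hr)
      rw [Finset.sum_congr rfl this, Finset.sum_add_distrib, Finset.sum_const, hcard]
      have := hsplit b
      simp only [nsmul_eq_mul]; push_cast; linarith
    have h := (convex_convexHull ℝ (verticesThree T)).sum_mem (t := Finset.univ) (w := w)
      (z := vertexThree T)
      (fun r _ => by
        simp only [hw]
        split_ifs with hr
        · exact h2 r hr
        · exact h3 r hr)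
      (by rw [hsplit, hwT, hwc]; ring)
      (fun r _ => subset_convexHull ℝ _ (by rw [verticesThree_eq_range hT]; exact ⟨r, rfl⟩))
    convert h using 1
    rw [← Finset.sum_add_sum_compl T]
    have e1 : ∀ r ∈ T, w r • vertexThree T r = w r • e r := fun r hr => by
      simp [vertexThree, hr]
    have e2 : ∀ r ∈ Tᶜ, w r • vertexThree T r = w r • e r +
        w r • (fun k => 1 / 2 - if k ∈ T then 0 else 1 : Fin 6 → ℝ) := fun r hr => by
      rw [← smul_add, vertexThree, if_neg (Finset.mem_compl.1 hr)]
      congr 1; funext k; simp only [Pi.add_apply]; ring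
    rw [Finset.sum_congr rfl e1, Finset.sum_congr rfl e2, Finset.sum_add_distrib, ← Finset.sum_smul,
      hwc]
    funext k
    simp only [Pi.add_apply, Finset.sum_apply, Pi.smul_apply, smul_eq_mul, sum_mul_e,
      Finset.mem_compl]
    by_cases hk : k ∈ T
    · simp [hk, hw]; ring
    · simp [hk, hw]; ring

/-! ### From the three model shapes to the labelled polytopes -/

namespace Tile

/-- The point of the lattice in the label. -/
def origin : Tile → Fin 6 → ℝ
  | one β => β
  | oneHat γ => γ
  | two β _ => β
  | three β _ => β
  | threeHat γ _ => γ

/-- The sign of the reflection that is part of the label. -/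
noncomputable def sign : Tile → ℝ
  | oneHat _ => -1
  | threeHat _ _ => -1
  | _ => 1

/-- Coordinates relative to the label. -/
noncomputable def localize (t : Tile) (α : Fin 6 → ℝ) : Fin 6 → ℝ := t.sign • (α - t.origin)

/-- The vertices in the coordinates relative to the label. -/
def baseVertices : Tile → Set (Fin 6 → ℝ)
  | one _ => verticesOne
  | oneHat _ => verticesOne
  | two _ a => verticesTwo a
  | three _ T => verticesThree T
  | threeHat _ T => verticesThree T

/-- The inequalities that define the polytope, in the coordinates relative to the label. -/
def Shape : Tile → (Fin 6 → ℝ) → Prop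
  | one _ => ShapeOne
  | oneHat _ => ShapeOne
  | two _ a => ShapeTwo a
  | three _ T => ShapeThree T
  | threeHat _ T => ShapeThree T

lemma sign_mul_self (t : Tile) : t.sign * t.sign = 1 := by cases t <;> simp [sign]

lemma origin_add_sign_smul_localize (t : Tile) (α : Fin 6 → ℝ) :
    t.origin + t.sign • t.localize α = α := by
  rw [localize, smul_smul, sign_mul_self, one_smul, add_sub_cancel]

lemma localize_origin_add (t : Tile) (b : Fin 6 → ℝ) :
    t.localize (t.origin + t.sign • b) = b := by
  rw [localize, add_sub_cancel_left, smul_smul, sign_mul_self, one_smul]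

lemma vertices_eq (t : Tile) : t.vertices = {x | t.localize x ∈ t.baseVertices} := by
  ext x
  have h1 : ∀ t : Tile, ∀ y, t.localize x = y ↔ x = t.origin + t.sign • y := fun t y =>
    ⟨fun h => by rw [← h, origin_add_sign_smul_localize], fun h => by
      rw [h, localize_origin_add]⟩
  cases t <;>
    simp only [vertices, baseVertices, verticesOne, verticesTwo, verticesThree, mem_ofPred_eq, h1,
      origin, sign, one_smul, neg_smul, ← sub_eq_add_neg, add_sub_assoc]
  rename_i γ T
  have : ∀ r s : Fin 6, γ - (rho - e r - e s) = γ + ((-rho + e r) + e s) := fun r s => by abel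
  have h2 : ∀ r s : Fin 6, γ - rho + e r + e s = γ + ((-rho + e r) + e s) := fun r s => by abel
  constructor
  · rintro (h | ⟨r, s, hr, hs, hrs, h⟩)
    · exact Or.inl h
    · exact Or.inr ⟨r, s, hr, hs, hrs, by rw [h]; abel⟩
  · rintro (h | ⟨r, s, hr, hs, hrs, h⟩)
    · exact Or.inl h
    · exact Or.inr ⟨r, s, hr, hs, hrs, by rw [h]; abel⟩

lemma convexHull_baseVertices {t : Tile} (ht : t.Admissible) :
    convexHull ℝ t.baseVertices = {b | t.Shape b} := by
  cases t with
  | one β => exact convexHull_verticesOne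
  | oneHat γ => exact convexHull_verticesOne
  | two β a => exact convexHull_verticesTwo a
  | three β T => exact convexHull_verticesThree ht.2.2
  | threeHat γ T => exact convexHull_verticesThree ht.2.2

theorem mem_body_iff {t : Tile} (ht : t.Admissible) (α : Fin 6 → ℝ) :
    α ∈ t.body ↔ t.Shape (t.localize α) := by
  set f : (Fin 6 → ℝ) →ᵃ[ℝ] (Fin 6 → ℝ) :=
    (t.sign • LinearMap.id : (Fin 6 → ℝ) →ₗ[ℝ] (Fin 6 → ℝ)).toAffineMap +
      AffineMap.const ℝ _ t.origin with hf
  have hfa : ∀ y, f y = t.origin + t.sign • y := fun y => by simp [hf, add_comm]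
  have hv : t.vertices = f '' t.baseVertices := by
    rw [vertices_eq]
    ext x
    constructor
    · intro hx
      exact ⟨_, hx, by rw [hfa, origin_add_sign_smul_localize]⟩
    · rintro ⟨y, hy, rfl⟩
      rw [mem_ofPred_eq, hfa, localize_origin_add]
      exact hy
  rw [body, hv, ← AffineMap.image_convexHull, convexHull_baseVertices ht]
  constructor
  · rintro ⟨y, hy, rfl⟩
    rw [hfa, localize_origin_add]
    exact hy
  · intro h
    exact ⟨_, h, by rw [hfa, origin_add_sign_smul_localize]⟩

/-- From a relative interior point one can move a little further along the line away from any point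
of the body. This form of interiority turns weak inequalities into strict ones without computing the
interior. -/
lemma exists_extend_of_mem_inner {t : Tile} {α x : Fin 6 → ℝ} (hα : α ∈ t.inner)
    (hx : x ∈ t.body) : α ∈ t.body ∧ ∃ δ > (0 : ℝ), α + δ • (α - x) ∈ t.body := by
  refine ⟨intrinsicInterior_subset hα, ?_⟩
  obtain ⟨y, hy, rfl⟩ := hα
  have hmem : ∀ δ : ℝ, (y : Fin 6 → ℝ) + δ • ((y : Fin 6 → ℝ) - x) ∈ affineSpan ℝ t.body := fun δ => by
    have := AffineMap.lineMap_mem (-δ) y.2 (subset_affineSpan ℝ _ hx)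
    rw [AffineMap.lineMap_apply] at this
    simp only [vsub_eq_sub, vadd_eq_add] at this
    convert this using 1
    rw [add_comm, neg_smul, ← smul_neg, neg_sub]
  set g : ℝ → affineSpan ℝ t.body := fun δ => ⟨_, hmem δ⟩ with hg
  have hgc : Continuous g := by
    refine Continuous.subtype_mk ?_ _
    fun_prop
  have hg0 : g 0 = y := by
    apply Subtype.ext
    simp [hg]
  have hn : g ⁻¹' (interior ((↑) ⁻¹' t.body)) ∈ nhds (0 : ℝ) :=
    hgc.continuousAt.preimage_mem_nhds (isOpen_interior.mem_nhds (by rw [hg0]; exact hy))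
  obtain ⟨ε, hε, hb⟩ := Metric.mem_nhds_iff.1 hn
  have : ε / 2 ∈ Metric.ball (0 : ℝ) ε := by
    rw [Metric.mem_ball, Real.dist_eq, sub_zero, abs_of_pos (by linarith)]; linarith
  have hm : g (ε / 2) ∈ (↑) ⁻¹' t.body := interior_subset (hb this)
  exact ⟨ε / 2, by linarith, hm⟩

lemma localize_extend (t : Tile) (α x : Fin 6 → ℝ) (δ : ℝ) :
    t.localize (α + δ • (α - x)) = t.localize α + δ • (t.localize α - t.localize x) := by
  simp only [localize]; module

/-- In the interior, every weakly positive affine function that is positive somewhere on the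
polytope is positive. -/
lemma exists_extend_shape {t : Tile} (ht : t.Admissible) {α : Fin 6 → ℝ} (hα : α ∈ t.inner)
    {y : Fin 6 → ℝ} (hy : t.Shape y) :
    ∃ δ > (0 : ℝ), t.Shape (t.localize α + δ • (t.localize α - y)) := by
  obtain ⟨-, δ, hδ, h⟩ := exists_extend_of_mem_inner hα (x := t.origin + t.sign • y)
    ((mem_body_iff ht _).2 (by rwa [localize_origin_add]))
  refine ⟨δ, hδ, ?_⟩
  rw [mem_body_iff ht, localize_extend, localize_origin_add] at h
  exact h

end Tile

/-! ### The combinatorial types of the polytopes -/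

lemma linearIndependent_e : LinearIndependent ℝ e := by
  rw [Fintype.linearIndependent_iff]
  intro w hw k
  have := congrFun hw k
  simpa [Finset.sum_apply, sum_mul_e] using this

lemma linearIndependent_vertexThree {T : Finset (Fin 6)} (hT : T.card = 3) :
    LinearIndependent ℝ (vertexThree T) := by
  rw [Fintype.linearIndependent_iff]
  intro w hw
  have hcard : Tᶜ.card = 3 := by rw [Finset.card_compl, hT]; rfl
  set M := ∑ r ∈ Tᶜ, w r with hM
  have h : ∀ k, w k + M * (1 / 2 - if k ∈ T then 0 else 1) = 0 := by
    intro k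
    have h1 := congrFun hw k
    have h2 : ∀ r, (w r • vertexThree T r) k = w r * e r k +
        if r ∈ T then 0 else w r * (1 / 2 - if k ∈ T then 0 else 1) := by
      intro r
      simp only [vertexThree, Pi.smul_apply, smul_eq_mul]
      by_cases hr : r ∈ T
      · simp [hr]
      · simp only [if_neg hr]; ring
    rw [Finset.sum_apply, Finset.sum_congr rfl fun r _ => h2 r, Finset.sum_add_distrib, sum_mul_e,
      if_pos (Finset.mem_univ _), Finset.sum_ite, Finset.sum_const_zero, zero_add,
      ← Finset.sum_mul] at h1
    have h3 : (Finset.univ.filter fun r => r ∉ T) = Tᶜ := by ext; simp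
    rw [h3] at h1
    exact h1
  -- Summing the relations over the three indices outside T gives M - 3M/2 = 0.
  have hM0 : M = 0 := by
    have : ∑ k ∈ Tᶜ, (w k + M * (1 / 2 - if k ∈ T then 0 else 1)) =
        ∑ k ∈ Tᶜ, (w k - M / 2) := Finset.sum_congr rfl fun k hk => by
      rw [if_neg (Finset.mem_compl.1 hk)]; ring
    rw [Finset.sum_congr rfl fun k _ => h k, Finset.sum_const_zero, Finset.sum_sub_distrib, ← hM,
      Finset.sum_const, hcard] at this
    simp only [nsmul_eq_mul] at this
    push_cast at this
    linarith
  intro k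
  have := h k
  rw [hM0] at this
  linarith

namespace Tile

lemma simplex_of_linearIndependent {t : Tile} {V : Fin 6 → Fin 6 → ℝ}
    (hV : LinearIndependent ℝ V) (h : t.baseVertices = Set.range V) :
    t.vertices.ncard = 6 ∧ AffineIndependent ℝ ((↑) : t.vertices → (Fin 6 → ℝ)) := by
  set f : Fin 6 → Fin 6 → ℝ := fun r => t.origin + t.sign • V r with hf
  have hr : t.vertices = Set.range f := by
    rw [vertices_eq, h]
    ext x
    constructor
    · rintro ⟨r, hr⟩
      exact ⟨r, by rw [hf]; simp only; rw [hr, origin_add_sign_smul_localize]⟩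
    · rintro ⟨r, rfl⟩
      exact ⟨r, by rw [hf, localize_origin_add]⟩
  have hs : t.sign ≠ 0 := fun h0 => by
    have := sign_mul_self t
    rw [h0] at this; norm_num at this
  have hA : AffineIndependent ℝ f := by
    rw [affineIndependent_iff]
    intro s w hw h0
    simp only [hf, smul_add, Finset.sum_add_distrib, ← Finset.sum_smul, hw, zero_smul, zero_add] at h0
    have h1 : t.sign • ∑ r ∈ s, w r • V r = 0 := by
      rw [Finset.smul_sum, ← h0]
      exact Finset.sum_congr rfl fun r _ => smul_comm _ _ _
    exact linearIndependent_iff'.1 hV s w ((smul_eq_zero.1 h1).resolve_left hs)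
  rw [hr]
  refine ⟨?_, hA.range⟩
  rw [← Set.image_univ, Set.ncard_image_of_injective _ hA.injective, Set.ncard_univ]
  simp

theorem hasShape {t : Tile} (ht : t.Admissible) : t.HasShape := by
  have hone : verticesOne = Set.range e := by
    ext x; exact ⟨fun ⟨r, h⟩ => ⟨r, h.symm⟩, fun ⟨r, h⟩ => ⟨r, h.symm⟩⟩
  cases t with
  | one β => exact simplex_of_linearIndependent linearIndependent_e hone
  | oneHat γ => exact simplex_of_linearIndependent linearIndependent_e hone
  | three β T =>
    exact simplex_of_linearIndependent (linearIndependent_vertexThree ht.2.2)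
      (verticesThree_eq_range ht.2.2)
  | threeHat γ T =>
    exact simplex_of_linearIndependent (linearIndependent_vertexThree ht.2.2)
      (verticesThree_eq_range ht.2.2)
  | two β a =>
    -- The center is the midpoint of each of the five pairs of opposite vertices β + e_r and β + ρ -
    -- e_a - e_r.
    refine ⟨β + (1 / 2 : ℝ) • (rho - e a), fun i => e (a.succAbove i) - (1 / 2 : ℝ) • (rho - e a),
      ?_, ?_⟩
    · rw [Fintype.linearIndependent_iff]
      intro w hw j
      have h1 := congrFun hw (a.succAbove j)
      have h2 := congrFun hw a
      simp only [Finset.sum_apply, Pi.smul_apply, smul_eq_mul, Pi.sub_apply, e_apply, rho,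
        Pi.zero_apply, Fin.succAbove_ne, (Fin.succAbove_ne a _).symm, if_true, if_false] at h1 h2
      have h3 : ∑ x, (w x * ((if a.succAbove j = a.succAbove x then 1 else 0) -
          1 / 2 * (1 / 2 - 0)) + w x * (0 - 1 / 2 * (1 / 2 - 1))) = w j := by
        rw [Finset.sum_congr rfl fun x _ => (by
          split_ifs with h <;> ring :
          w x * ((if a.succAbove j = a.succAbove x then (1 : ℝ) else 0) - 1 / 2 * (1 / 2 - 0)) +
            w x * (0 - 1 / 2 * (1 / 2 - 1)) = if a.succAbove j = a.succAbove x then w x else 0)]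
        simp [Fin.succAbove_right_injective.eq_iff]
      rw [Finset.sum_add_distrib, h1, h2, add_zero] at h3
      exact h3.symm
    · ext x
      have h1 : ∀ r : Fin 6, β + (1 / 2 : ℝ) • (rho - e a) + (e r - (1 / 2 : ℝ) • (rho - e a)) =
          β + e r := fun r => by module
      have h2 : ∀ r : Fin 6, β + (1 / 2 : ℝ) • (rho - e a) - (e r - (1 / 2 : ℝ) • (rho - e a)) =
          β + rho - e a - e r := fun r => by module
      simp only [vertices, mem_ofPred_eq, h1, h2]
      constructor
      · rintro ⟨r, hr, h⟩
        obtain ⟨i, rfl⟩ := Fin.exists_succAbove_eq hr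
        exact ⟨i, h⟩
      · rintro ⟨i, h⟩
        exact ⟨_, Fin.succAbove_ne a i, h⟩

/-! ### Disjointness of the interiors -/

/-- The power of a point with respect to the circumscribed sphere of the polytope. -/
noncomputable def power : Tile → (Fin 6 → ℝ) → ℝ
  | one _, b => ∑ r, b r ^ 2 - 1
  | oneHat _, b => ∑ r, b r ^ 2 - 1
  | two _ a, b => ∑ r, b r ^ 2 + b a - 1
  | three _ T, b => ∑ r, b r ^ 2 - ∑ r ∈ T, b r
  | threeHat _ T, b => ∑ r, b r ^ 2 - ∑ r ∈ T, b r

/-- Twice the center of the circumscribed sphere, up to a multiple of `(1, …, 1)`. -/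
noncomputable def dcenter : Tile → (Fin 6 → ℝ)
  | one β => fun r => 2 * β r
  | oneHat γ => fun r => 2 * γ r
  | two β a => fun r => 2 * β r - if r = a then 1 else 0
  | three β T => fun r => 2 * β r + if r ∈ T then 1 else 0
  | threeHat γ T => fun r => 2 * γ r - if r ∈ T then 1 else 0

/-- The quadratic part is the sum of the squares for every polytope, so the difference of two powers
is affine, with linear part the difference of the doubled centers. -/
lemma exists_power_eq (t : Tile) : ∃ c : ℝ, ∀ x, t.power (t.localize x) =
    ∑ r, x r ^ 2 - ∑ r, t.dcenter r * x r + c := by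
  have h1 : ∀ β x : Fin 6 → ℝ, ∑ r, (x r - β r) ^ 2 =
      ∑ r, x r ^ 2 - ∑ r, 2 * β r * x r + ∑ r, β r ^ 2 := fun β x => by
    rw [← Finset.sum_sub_distrib, ← Finset.sum_add_distrib]
    exact Finset.sum_congr rfl fun r _ => by ring
  have h2 : ∀ (T : Finset (Fin 6)) (x : Fin 6 → ℝ),
      ∑ r, (if r ∈ T then (1 : ℝ) else 0) * x r = ∑ r ∈ T, x r := fun T x => by
    simp [Finset.sum_ite_mem]
  cases t with
  | one β =>
    refine ⟨∑ r, β r ^ 2 - 1, fun x => ?_⟩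
    simp only [power, localize, sign, origin, one_smul, Pi.sub_apply, h1, dcenter]; ring
  | oneHat β =>
    refine ⟨∑ r, β r ^ 2 - 1, fun x => ?_⟩
    simp only [power, localize, sign, origin, Pi.smul_apply, smul_eq_mul, neg_mul, one_mul, neg_sq,
      Pi.sub_apply, h1, dcenter]; ring
  | two β a =>
    refine ⟨∑ r, β r ^ 2 - β a - 1, fun x => ?_⟩
    simp only [power, localize, sign, origin, one_smul, Pi.sub_apply, h1, dcenter, sub_mul,
      Finset.sum_sub_distrib]
    simp; ring
  | three β T =>
    refine ⟨∑ r, β r ^ 2 + ∑ r ∈ T, β r, fun x => ?_⟩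
    simp only [power, localize, sign, origin, one_smul, Pi.sub_apply, h1, dcenter, add_mul,
      Finset.sum_add_distrib, h2, Finset.sum_sub_distrib]
    ring
  | threeHat β T =>
    refine ⟨∑ r, β r ^ 2 - ∑ r ∈ T, β r, fun x => ?_⟩
    simp only [power, localize, sign, origin, Pi.smul_apply, smul_eq_mul, neg_mul, one_mul, neg_sq,
      Pi.sub_apply, h1, dcenter, sub_mul, Finset.sum_sub_distrib, h2, Finset.sum_neg_distrib]
    ring

lemma _root_.BetaTiling.IsIntVec.sub {x y : Fin 6 → ℝ} (hx : IsIntVec x) (hy : IsIntVec y) :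
    IsIntVec (x - y) := by
  obtain ⟨k, hk⟩ := hx
  obtain ⟨l, hl⟩ := hy
  exact ⟨fun r => k r - l r, fun r => by simp [hk, hl]⟩

lemma _root_.BetaTiling.isIntVec_two_rho : IsIntVec (rho + rho) :=
  ⟨fun _ => 1, fun r => by simp [rho]; norm_num⟩

lemma _root_.BetaTiling.InLattice.sub {x y : Fin 6 → ℝ} (hx : InLattice x) (hy : InLattice y) :
    InLattice (x - y) := by
  rcases hx with hx | hx <;> rcases hy with hy | hy
  · exact Or.inl (hx.sub hy)
  · right
    have := (hx.sub hy).sub isIntVec_two_rho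
    convert this using 1; abel
  · right
    convert hx.sub hy using 1; abel
  · left
    convert hx.sub hy using 1; abel

lemma _root_.BetaTiling.IsIntVec.inLattice {x : Fin 6 → ℝ} (hx : IsIntVec x) : InLattice x :=
  Or.inl hx

lemma Admissible.origin_mem {t : Tile} (ht : t.Admissible) : InLattice t.origin := by
  cases t with
  | one β => exact ht.1
  | oneHat γ => exact ht.1
  | two β a => exact ht.1
  | three β T => exact ht.1.inLattice
  | threeHat γ T => exact ht.1.inLattice

lemma Admissible.sum_localize {t : Tile} (ht : t.Admissible) {x : Fin 6 → ℝ}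
    (hx : ∑ r, x r = 1) : ∑ r, t.localize x r = 1 := by
  have h : ∑ r, t.localize x r = t.sign * (1 - ∑ r, t.origin r) := by
    simp only [localize, Pi.smul_apply, smul_eq_mul, Pi.sub_apply, ← Finset.mul_sum,
      Finset.sum_sub_distrib, hx]
  rw [h]
  cases t with
  | one β => simp only [sign, origin, ht.2]; norm_num
  | oneHat γ => simp only [sign, origin, ht.2]; norm_num
  | two β a => simp only [sign, origin, ht.2]; norm_num
  | three β T => simp only [sign, origin, ht.2.1]; norm_num
  | threeHat γ T => simp only [sign, origin, ht.2.1]; norm_num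

lemma Admissible.localize_mem {t : Tile} (ht : t.Admissible) {x : Fin 6 → ℝ} (hx : InLattice x) :
    InLattice (t.localize x) := by
  have h1 := hx.sub ht.origin_mem
  have h2 := ht.origin_mem.sub hx
  cases t <;> simp only [localize, sign, one_smul, neg_smul, neg_sub] <;> assumption

/-- The empty sphere property. Integral points use k² ≥ k coordinatewise. At half-integral points
squares are at least 1/4 and b² - b ≥ -1/4, while the cross polytope leaves exactly (b_a + 1/2)². -/
lemma power_nonneg {t : Tile} (ht : t.Admissible) {b : Fin 6 → ℝ} (hb : InLattice b)
    (h1 : ∑ r, b r = 1) : 0 ≤ t.power b := by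
  rcases hb with ⟨k, hk⟩ | ⟨k, hk⟩
  · have hsq : ∀ r, 0 ≤ b r ^ 2 - b r := fun r => by
      rw [hk r]
      have : (k r) ≤ (k r) ^ 2 := Int.le_self_sq _
      have : ((k r : ℤ) : ℝ) ≤ (k r : ℝ) ^ 2 := by exact_mod_cast this
      linarith
    have hS : ∀ S : Finset (Fin 6), ∑ r ∈ S, b r ≤ ∑ r ∈ S, b r ^ 2 := fun S =>
      Finset.sum_le_sum fun r _ => by linarith [hsq r]
    have hT : ∀ T : Finset (Fin 6), 0 ≤ ∑ r, b r ^ 2 - ∑ r ∈ T, b r := fun T => by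
      have h2 := hS T
      have : ∑ r ∈ T, b r ^ 2 ≤ ∑ r, b r ^ 2 :=
        Finset.sum_le_univ_sum_of_nonneg fun r => sq_nonneg _
      linarith
    have hU := hS Finset.univ
    cases t with
    | one β => simp only [power]; linarith
    | oneHat β => simp only [power]; linarith
    | three β T => exact hT T
    | threeHat β T => exact hT T
    | two β a =>
      have h2 := hS (Finset.univ.erase a)
      rw [Finset.sum_erase_eq_sub (Finset.mem_univ a),
        Finset.sum_erase_eq_sub (Finset.mem_univ a)] at h2
      simp only [power]
      nlinarith [sq_nonneg (b a)]
  · have hsq : ∀ r, 0 ≤ b r ^ 2 - 1 / 4 := fun r => by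
      have : b r = k r + 1 / 2 := by
        have := hk r
        simp only [Pi.sub_apply, rho] at this
        linarith
      rw [this]
      have : 0 ≤ k r * (k r + 1) := by
        rcases le_or_gt 0 (k r) with h | h
        · positivity
        · nlinarith
      have : (0 : ℝ) ≤ (k r : ℝ) * (k r + 1) := by exact_mod_cast this
      linarith
    have hS : ∀ S : Finset (Fin 6), (S.card : ℝ) / 4 ≤ ∑ r ∈ S, b r ^ 2 := fun S => by
      have := Finset.card_nsmul_le_sum S (fun r => b r ^ 2) (1 / 4) fun r _ => by linarith [hsq r]
      rw [nsmul_eq_mul] at this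
      linarith
    have hT : ∀ T : Finset (Fin 6), T.card = 3 → 0 ≤ ∑ r, b r ^ 2 - ∑ r ∈ T, b r := by
      intro T hT
      have hc : Tᶜ.card = 3 := by rw [Finset.card_compl, hT]; rfl
      have h2 := hS Tᶜ
      have h3 : ∑ r ∈ T, (-(1 / 4) : ℝ) ≤ ∑ r ∈ T, (b r ^ 2 - b r) :=
        Finset.sum_le_sum fun r _ => by nlinarith [sq_nonneg (b r - 1 / 2)]
      rw [Finset.sum_const, hT, Finset.sum_sub_distrib] at h3
      rw [hc] at h2
      simp only [nsmul_eq_mul] at h3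
      push_cast at h2 h3
      rw [← Finset.sum_add_sum_compl T]
      linarith
    have hU := hS Finset.univ
    simp only [Finset.card_univ, Fintype.card_fin] at hU
    push_cast at hU
    cases t with
    | one β => simp only [power]; linarith
    | oneHat β => simp only [power]; linarith
    | three β T => exact hT T ht.2.2
    | threeHat β T => exact hT T ht.2.2
    | two β a =>
      have h2 := hS (Finset.univ.erase a)
      rw [Finset.sum_erase_eq_sub (Finset.mem_univ a),
        Finset.card_erase_of_mem (Finset.mem_univ a)] at h2
      simp only [Finset.card_univ, Fintype.card_fin] at h2
      norm_num at h2
      simp only [power]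
      nlinarith [sq_nonneg (b a + 1 / 2)]

lemma _root_.BetaTiling.isIntVec_e (r : Fin 6) : IsIntVec (e r) :=
  ⟨fun k => if k = r then 1 else 0, fun k => by simp [e_apply]⟩

lemma baseVertices_props {t : Tile} (ht : t.Admissible) {y : Fin 6 → ℝ} (hy : y ∈ t.baseVertices) :
    InLattice y ∧ ∑ r, y r = 1 ∧ t.power y = 0 := by
  have hsq : ∀ r k, e r k ^ 2 = e r k := fun r k => by rw [e_apply]; split_ifs <;> norm_num
  have hsum : ∀ r, ∑ k, e r k = 1 := fun r => by simp [sum_e]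
  have hlat : ∀ r s, InLattice (rho - e r - e s) := fun r s => by
    refine Or.inr ⟨fun k => -(if k = r then 1 else 0) - (if k = s then 1 else 0), fun k => ?_⟩
    simp only [Pi.sub_apply, rho, e_apply]; push_cast; ring
  have hsum2 : ∀ r s, ∑ k, (rho - e r - e s) k = 1 := fun r s => by
    simp only [Pi.sub_apply, Finset.sum_sub_distrib, hsum, rho]
    simp; norm_num
  have hsq2 : ∀ r s, r ≠ s → ∑ k, (rho - e r - e s) k ^ 2 = 3 / 2 := fun r s hrs => by
    have : ∀ k, (rho - e r - e s) k ^ 2 = 1 / 4 := fun k => by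
      simp only [Pi.sub_apply, rho, e_apply]
      by_cases h1 : k = r
      · have h2 : k ≠ s := fun h => hrs (h1 ▸ h)
        rw [if_pos h1, if_neg h2]; norm_num
      · rw [if_neg h1]; split_ifs <;> norm_num
    simp only [this]; simp; norm_num
  have hpow1 : ∀ r, ∑ k, e r k ^ 2 = 1 := fun r => by simp only [hsq, hsum]
  have hthree : ∀ T : Finset (Fin 6), T.card = 3 → y ∈ verticesThree T → InLattice y ∧
      ∑ r, y r = 1 ∧ ∑ r, y r ^ 2 - ∑ r ∈ T, y r = 0 := by
    rintro T hT (⟨r, hr, rfl⟩ | ⟨r, s, hr, hs, hrs, rfl⟩)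
    · exact ⟨(isIntVec_e r).inLattice, hsum r, by rw [hpow1, sum_e, if_pos hr, sub_self]⟩
    · refine ⟨hlat r s, hsum2 r s, ?_⟩
      rw [hsq2 r s hrs]
      simp only [Pi.sub_apply, Finset.sum_sub_distrib, sum_e, if_neg hr, if_neg hs, rho,
        Finset.sum_const, hT]
      norm_num
  cases t with
  | one β =>
    obtain ⟨r, rfl⟩ := hy
    exact ⟨(isIntVec_e r).inLattice, hsum r, by simp only [power, hpow1, sub_self]⟩
  | oneHat β =>
    obtain ⟨r, rfl⟩ := hy
    exact ⟨(isIntVec_e r).inLattice, hsum r, by simp only [power, hpow1, sub_self]⟩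
  | two β a =>
    obtain ⟨r, hr, rfl | rfl⟩ := hy
    · exact ⟨(isIntVec_e r).inLattice, hsum r, by simp [power, e_apply, hr.symm]⟩
    · refine ⟨hlat a r, hsum2 a r, ?_⟩
      simp only [power, hsq2 a r hr.symm]
      simp [e_apply, hr.symm, rho]; norm_num
  | three β T => exact hthree T ht.2.2 hy
  | threeHat β T => exact hthree T ht.2.2 hy

/-- The vertices span the hyperplane, so an affine function vanishing on them is a multiple of the
equation of the hyperplane. -/
lemma const_of_affine_eq_zero {t : Tile} (ht : t.Admissible) {d : Fin 6 → ℝ} {c : ℝ}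
    (h : ∀ y ∈ t.baseVertices, ∑ r, d r * y r + c = 0) : ∀ r, d r = -c := by
  have he : ∀ r, ∑ k, d k * e r k = d r := fun r => by simp [e_apply]
  have he2 : ∀ r s, ∑ k, d k * (rho - e r - e s) k = (∑ k, d k) / 2 - d r - d s := fun r s => by
    simp only [Pi.sub_apply, mul_sub, Finset.sum_sub_distrib, he, rho, Finset.sum_div]
    congr 2
    exact Finset.sum_congr rfl fun k _ => by ring
  have hone : (∀ y ∈ verticesOne, ∑ r, d r * y r + c = 0) → ∀ r, d r = -c := fun h r => by
    have := h _ ⟨r, rfl⟩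
    rw [he] at this; linarith
  have hthree : ∀ T : Finset (Fin 6), T.card = 3 →
      (∀ y ∈ verticesThree T, ∑ r, d r * y r + c = 0) → ∀ r, d r = -c := by
    intro T hT h
    have h1 : ∀ r ∈ T, d r = -c := fun r hr => by
      have := h _ (Or.inl ⟨r, hr, rfl⟩)
      rw [he] at this; linarith
    intro r
    by_cases hr : r ∈ T
    · exact h1 r hr
    obtain ⟨s, t, hs, ht, hst, hsr, htr, hall⟩ := compl_eq_of_card hT hr
    have e1 := h _ (Or.inr ⟨r, s, hr, hs, hsr.symm, rfl⟩)
    have e2 := h _ (Or.inr ⟨r, t, hr, ht, htr.symm, rfl⟩)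
    have e3 := h _ (Or.inr ⟨s, t, hs, ht, hst, rfl⟩)
    rw [he2] at e1 e2 e3
    have hc : Tᶜ = {r, s, t} := by
      ext k
      simp only [Finset.mem_compl, Finset.mem_insert, Finset.mem_singleton]
      refine ⟨hall k, ?_⟩
      rintro (rfl | rfl | rfl) <;> assumption
    have hsum : ∑ k, d k = -3 * c + (d r + (d s + d t)) := by
      rw [← Finset.sum_add_sum_compl T, Finset.sum_congr rfl h1, Finset.sum_const, hT, hc,
        Finset.sum_insert (by simp [hsr.symm, htr.symm]), Finset.sum_pair hst]
      simp
    rw [hsum] at e1 e2 e3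
    linarith
  cases t with
  | one β => exact hone h
  | oneHat β => exact hone h
  | three β T => exact hthree T ht.2.2 h
  | threeHat β T => exact hthree T ht.2.2 h
  | two β a =>
    have h1 : ∀ r, r ≠ a → d r = -c := fun r hr => by
      have := h _ ⟨r, hr, Or.inl rfl⟩
      rw [he] at this; linarith
    obtain ⟨s, hs⟩ := exists_ne a
    intro r
    by_cases hr : r = a
    · have e1 := h _ ⟨s, hs, Or.inr rfl⟩
      rw [he2] at e1
      have hsum : ∑ k, d k = -5 * c + d a := by
        rw [← Finset.sum_erase_add _ _ (Finset.mem_univ a),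
          Finset.sum_congr rfl fun k hk => h1 k (Finset.ne_of_mem_erase hk), Finset.sum_const,
          Finset.card_erase_of_mem (Finset.mem_univ a)]
        simp
      rw [hsum, h1 s hs] at e1
      rw [hr]; linarith
    · exact h1 r hr

end Tile

/-! ### The circumscribed center determines the label -/

namespace Tile

lemma exists_int_of_inLattice {β : Fin 6 → ℝ} (h : InLattice β) :
    ∃ k : Fin 6 → ℤ, ∀ r, 2 * β r = k r := by
  rcases h with ⟨k, hk⟩ | ⟨k, hk⟩
  · exact ⟨fun r => 2 * k r, fun r => by rw [hk]; push_cast; ring⟩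
  · refine ⟨fun r => 2 * k r + 1, fun r => ?_⟩
    have := hk r
    simp only [Pi.sub_apply, rho] at this
    push_cast; linarith

lemma exists_int_dcenter {t : Tile} (ht : t.Admissible) :
    ∃ k : Fin 6 → ℤ, ∀ r, t.dcenter r = k r := by
  obtain ⟨k, hk⟩ := exists_int_of_inLattice ht.origin_mem
  cases t with
  | one β => exact ⟨k, hk⟩
  | oneHat β => exact ⟨k, hk⟩
  | two β a =>
    refine ⟨fun r => k r - if r = a then 1 else 0, fun r => ?_⟩
    rw [Int.cast_sub, ← hk]; simp [dcenter, origin]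
  | three β T =>
    refine ⟨fun r => k r + if r ∈ T then 1 else 0, fun r => ?_⟩
    rw [Int.cast_add, ← hk]; simp [dcenter, origin]
  | threeHat β T =>
    refine ⟨fun r => k r - if r ∈ T then 1 else 0, fun r => ?_⟩
    rw [Int.cast_sub, ← hk]; simp [dcenter, origin]

/-- The sum of the coordinates of `dcenter`; it determines the type of the polytope. -/
def dsum : Tile → ℤ
  | one _ => 0
  | oneHat _ => 4
  | two _ _ => -1
  | three _ _ => 3
  | threeHat _ _ => 1

lemma sum_dcenter {t : Tile} (ht : t.Admissible) : ∑ r, t.dcenter r = t.dsum := by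
  cases t with
  | one β => simp only [dcenter, dsum, ← Finset.mul_sum, ht.2]; norm_num
  | oneHat β => simp only [dcenter, dsum, ← Finset.mul_sum, ht.2]; norm_num
  | two β a => simp only [dcenter, dsum, Finset.sum_sub_distrib, ← Finset.mul_sum, ht.2]; simp
  | three β T =>
    simp only [dcenter, dsum, Finset.sum_add_distrib, ← Finset.mul_sum, ht.2.1]
    simp [ht.2.2]
  | threeHat β T =>
    simp only [dcenter, dsum, Finset.sum_sub_distrib, ← Finset.mul_sum, ht.2.1]
    simp [ht.2.2]; norm_num

lemma eq_of_two_mul_add_indicator {β β' : Fin 6 → ℝ} {T T' : Finset (Fin 6)} (hβ : IsIntVec β)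
    (hβ' : IsIntVec β')
    (h : ∀ r, 2 * β r + (if r ∈ T then 1 else 0) = 2 * β' r + if r ∈ T' then 1 else 0) :
    β = β' ∧ T = T' := by
  obtain ⟨k, hk⟩ := hβ
  obtain ⟨l, hl⟩ := hβ'
  have h1 : ∀ r, 2 * k r + (if r ∈ T then 1 else 0) = 2 * l r + if r ∈ T' then 1 else 0 := by
    intro r
    have := h r
    rw [hk, hl] at this
    exact_mod_cast this
  have h2 : ∀ r, k r = l r ∧ (r ∈ T ↔ r ∈ T') := by
    intro r
    have := h1 r
    by_cases h3 : r ∈ T <;> by_cases h4 : r ∈ T' <;> simp [h3, h4] at this ⊢ <;> omega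
  exact ⟨funext fun r => by rw [hk, hl, (h2 r).1], Finset.ext fun r => (h2 r).2⟩

lemma exists_ne_ne : ∀ a a' : Fin 6, ∃ k : Fin 6, k ≠ a ∧ k ≠ a' := by decide

/-- The five kinds have distinct coordinate sums. For the third kinds, parity of the coordinates
recovers T because the lattice point is integral. -/
lemma eq_of_dcenter_eq {s t : Tile} (hs : s.Admissible) (ht : t.Admissible)
    (h : s.dcenter = t.dcenter) : s = t := by
  have hsum : s.dsum = t.dsum := by
    have := sum_dcenter hs
    rw [h, sum_dcenter ht] at this
    exact_mod_cast this.symm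
  cases s <;> cases t <;> simp only [dsum] at hsum <;> first | omega | skip
  · congr 1; funext r
    have := congrFun h r
    simp only [dcenter] at this; linarith
  · congr 1; funext r
    have := congrFun h r
    simp only [dcenter] at this; linarith
  · rename_i β a β' a'
    have haa : a = a' := by
      by_contra hne
      -- For cross polytopes the lattice point may lie in either coset, so parity alone does not
      -- give a. If a ≠ a', the two lattice points would differ by a half-integer at a and by 0 at
      -- k, impossible for a difference in the lattice.
      obtain ⟨k, hk⟩ : ∃ k : Fin 6, k ≠ a ∧ k ≠ a' := exists_ne_ne a a'
      have h1 := congrFun h a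
      have h2 := congrFun h k
      simp only [dcenter, if_true, if_neg hk.1, if_neg hk.2, if_neg hne] at h1 h2
      have h3 : InLattice (β - β') := hs.1.sub ht.1
      rcases h3 with ⟨m, hm⟩ | ⟨m, hm⟩
      · have e1 := hm a
        have e2 := hm k
        simp only [Pi.sub_apply] at e1 e2
        have : (2 * m a : ℝ) = 1 := by linarith
        have : 2 * m a = 1 := by exact_mod_cast this
        omega
      · have e1 := hm a
        have e2 := hm k
        simp only [Pi.sub_apply, rho] at e1 e2
        have : (2 * m k : ℝ) = -1 := by linarith
        have : 2 * m k = -1 := by exact_mod_cast this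
        omega
    subst haa
    congr 1; funext r
    have := congrFun h r
    simp only [dcenter] at this; linarith
  · rename_i β T β' T'
    obtain ⟨rfl, rfl⟩ := eq_of_two_mul_add_indicator hs.1 ht.1 fun r => congrFun h r
    rfl
  · rename_i β T β' T'
    obtain ⟨rfl, rfl⟩ := eq_of_two_mul_add_indicator (T := T') (T' := T) hs.1 ht.1 fun r => by
      have := congrFun h r
      simp only [dcenter] at this; linarith
    rfl

lemma halfspace_convex (d : Fin 6 → ℝ) (c : ℝ) : Convex ℝ {x : Fin 6 → ℝ | 0 ≤ ∑ r, d r * x r + c} := by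
  intro x hx y hy a b ha hb hab
  simp only [mem_ofPred_eq, Pi.add_apply, Pi.smul_apply, smul_eq_mul] at hx hy ⊢
  have : ∑ r, d r * (a * x r + b * y r) + c =
      a * (∑ r, d r * x r + c) + b * (∑ r, d r * y r + c) := by
    simp only [mul_add, Finset.sum_add_distrib, mul_left_comm (d _), ← Finset.mul_sum]
    linear_combination c * (-hab)
  rw [this]
  positivity

/-- The difference of the two powers is nonnegative on s and nonpositive on t, by the empty spheres.
A common interior point forces it to vanish on s, and then the centers, hence the labels, agree. -/
theorem disjoint_inner {s t : Tile} (hs : s.Admissible) (ht : t.Admissible) (hst : s ≠ t) :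
    Disjoint s.inner t.inner := by
  rw [Set.disjoint_left]
  intro α hαs hαt
  obtain ⟨cs, hcs⟩ := exists_power_eq s
  obtain ⟨ct, hct⟩ := exists_power_eq t
  set d : Fin 6 → ℝ := fun r => s.dcenter r - t.dcenter r with hd
  have hdiff : ∀ x, ∑ r, d r * x r + (ct - cs) =
      t.power (t.localize x) - s.power (s.localize x) := fun x => by
    rw [hcs, hct]
    simp only [hd, sub_mul, Finset.sum_sub_distrib]; ring
  have hprops : ∀ {t : Tile}, t.Admissible → ∀ x ∈ t.vertices, InLattice x ∧ ∑ r, x r = 1 ∧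
      t.power (t.localize x) = 0 := by
    intro t ht x hx
    rw [vertices_eq] at hx
    obtain ⟨h1, h2, h3⟩ := baseVertices_props ht hx
    have hx' := origin_add_sign_smul_localize t x
    refine ⟨?_, ?_, h3⟩
    · have e1 := ht.origin_mem
      have e2 : InLattice (0 - t.localize x) := by
        refine InLattice.sub (Or.inl ⟨fun _ => 0, fun r => by simp⟩) h1
      have e3 := e1.sub e2
      have e4 := e1.sub h1
      cases t <;> simp only [sign, one_smul, neg_smul, origin] at hx' e3 e4 <;> rw [← hx']
      · simpa using e3
      · simpa [sub_eq_add_neg] using e4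
      · simpa using e3
      · simpa using e3
      · simpa [sub_eq_add_neg] using e4
    · have e1 : ∑ r, x r = ∑ r, t.origin r + t.sign * ∑ r, t.localize x r := by
        rw [Finset.mul_sum, ← Finset.sum_add_distrib]
        exact Finset.sum_congr rfl fun r _ => (congrFun hx' r).symm
      rw [e1, h2]
      cases t with
      | one β => simp only [sign, origin, ht.2]; norm_num
      | oneHat γ => simp only [sign, origin, ht.2]; norm_num
      | two β a => simp only [sign, origin, ht.2]; norm_num
      | three β T => simp only [sign, origin, ht.2.1]; norm_num
      | threeHat γ T => simp only [sign, origin, ht.2.1]; norm_num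
  have hnn : ∀ x ∈ s.vertices, 0 ≤ ∑ r, d r * x r + (ct - cs) := by
    intro x hx
    obtain ⟨h1, h2, h3⟩ := hprops hs x hx
    rw [hdiff, h3, sub_zero]
    exact power_nonneg ht (ht.localize_mem h1) (ht.sum_localize h2)
  have hnp : ∀ x ∈ t.vertices, 0 ≤ ∑ r, (-d r) * x r + -(ct - cs) := by
    intro x hx
    obtain ⟨h1, h2, h3⟩ := hprops ht x hx
    have := power_nonneg hs (hs.localize_mem h1) (hs.sum_localize h2)
    have h4 := hdiff x
    simp only [neg_mul, Finset.sum_neg_distrib]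
    linarith
  have hbs : s.body ⊆ {x | 0 ≤ ∑ r, d r * x r + (ct - cs)} :=
    convexHull_min hnn (halfspace_convex _ _)
  have hbt : t.body ⊆ {x | 0 ≤ ∑ r, (-d r) * x r + -(ct - cs)} :=
    convexHull_min hnp (halfspace_convex _ _)
  have hαle : ∑ r, d r * α r + (ct - cs) ≤ 0 := by
    have := hbt (intrinsicInterior_subset hαt)
    simp only [mem_ofPred_eq, neg_mul, Finset.sum_neg_distrib] at this
    linarith
  -- If the function were positive at a vertex, moving from α slightly away from that vertex would
  -- make it negative inside the body of s.
  have hzero : ∀ x ∈ s.vertices, ∑ r, d r * x r + (ct - cs) = 0 := by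
    intro x hx
    obtain ⟨-, δ, hδ, hy⟩ := exists_extend_of_mem_inner hαs (subset_convexHull ℝ _ hx)
    have h1 := hbs hy
    have h2 : ∑ r, d r * (α + δ • (α - x)) r + (ct - cs) =
        (1 + δ) * (∑ r, d r * α r + (ct - cs)) - δ * (∑ r, d r * x r + (ct - cs)) := by
      simp only [Pi.add_apply, Pi.smul_apply, Pi.sub_apply, smul_eq_mul, mul_add, mul_sub,
        Finset.sum_add_distrib, Finset.sum_sub_distrib, mul_left_comm (d _), ← Finset.mul_sum]
      ring
    rw [mem_ofPred_eq, h2] at h1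
    have h3 := hnn x hx
    have h4 : δ * (∑ r, d r * x r + (ct - cs)) ≤ 0 := by
      have : (1 + δ) * (∑ r, d r * α r + (ct - cs)) ≤ 0 :=
        mul_nonpos_of_nonneg_of_nonpos (by linarith) hαle
      linarith
    nlinarith
  set c' := ∑ r, d r * s.origin r + (ct - cs) with hc'
  have hbase : ∀ y ∈ s.baseVertices, ∑ r, d r * y r + s.sign * c' = 0 := by
    intro y hy
    have h1 := hzero (s.origin + s.sign • y) (by
      rw [vertices_eq, mem_ofPred_eq, localize_origin_add]; exact hy)
    simp only [Pi.add_apply, Pi.smul_apply, smul_eq_mul, mul_add, Finset.sum_add_distrib,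
      mul_left_comm (d _), ← Finset.mul_sum] at h1
    have h2 := sign_mul_self s
    have h3 : s.sign * (c' + s.sign * ∑ r, d r * y r) = 0 := by
      rw [hc']
      have : ∑ r, d r * s.origin r + (ct - cs) + s.sign * ∑ r, d r * y r = 0 := by linarith
      rw [this, mul_zero]
    linear_combination h3 - (∑ r, d r * y r) * h2
  have hconst := const_of_affine_eq_zero hs hbase
  obtain ⟨k, hk⟩ := exists_int_dcenter hs
  obtain ⟨l, hl⟩ := exists_int_dcenter ht
  have hsum : (s.dsum - t.dsum : ℝ) = 6 * (k 0 - l 0) := by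
    rw [← sum_dcenter hs, ← sum_dcenter ht, ← Finset.sum_sub_distrib, ← hk, ← hl]
    have : ∀ r, s.dcenter r - t.dcenter r = s.dcenter 0 - t.dcenter 0 := fun r => by
      have h1 := hconst r
      have h2 := hconst 0
      simp only [hd] at h1 h2
      rw [h1, h2]
    rw [Finset.sum_congr rfl fun r _ => this r]
    simp; ring
  have hsum' : s.dsum - t.dsum = 6 * (k 0 - l 0) := by exact_mod_cast hsum
  -- The doubled centers differ by an integral multiple of (1,…,1), so their coordinate sums differ
  -- by a multiple of 6; the range of length 5 leaves only 0.
  have hb : ∀ t : Tile, -1 ≤ t.dsum ∧ t.dsum ≤ 4 := fun t => by cases t <;> simp [dsum]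
  have h0 : k 0 = l 0 := by
    have := hb s
    have := hb t
    omega
  apply hst
  refine eq_of_dcenter_eq hs ht (funext fun r => ?_)
  have h1 := hconst r
  have h2 := hconst 0
  simp only [hd] at h1 h2
  have h3 : s.dcenter 0 = t.dcenter 0 := by rw [hk, hl, h0]
  linarith

end Tile

/-! ### The polytopes cover the hyperplane -/

lemma ShapeOne.of_comp {b : Fin 6 → ℝ} (σ : Equiv.Perm (Fin 6)) (h : ShapeOne (b ∘ σ)) :
    ShapeOne b := by
  refine ⟨by rw [← h.1]; exact (Equiv.sum_comp σ b).symm, fun r => ?_⟩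
  simpa using h.2 (σ.symm r)

lemma ShapeTwo.of_comp {a : Fin 6} {b : Fin 6 → ℝ} (σ : Equiv.Perm (Fin 6))
    (h : ShapeTwo a (b ∘ σ)) : ShapeTwo (σ a) b := by
  refine ⟨by rw [← h.1]; exact (Equiv.sum_comp σ b).symm, ?_⟩
  have := h.2
  rw [Finset.sum_erase_eq_sub (Finset.mem_univ _)] at this ⊢
  rw [← Equiv.sum_comp σ]
  exact this

lemma ShapeThree.of_comp {T : Finset (Fin 6)} {b : Fin 6 → ℝ} (σ : Equiv.Perm (Fin 6))
    (h : ShapeThree T (b ∘ σ)) : ShapeThree (T.map σ.toEmbedding) b := by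
  have hs : ∑ s ∈ T.map σ.toEmbedding, b s = ∑ s ∈ T, (b ∘ σ) s := by
    rw [Finset.sum_map]; rfl
  refine ⟨by rw [← h.1]; exact (Equiv.sum_comp σ b).symm, fun r hr => ?_, fun r hr => ?_⟩
  · rw [hs]
    simpa using h.2.1 (σ.symm r) (by simpa using hr)
  · rw [hs]
    simpa using h.2.2 (σ.symm r) (by simpa using hr)

/-- `α` satisfies the inequalities of one of the polytopes. -/
def Covered (α : Fin 6 → ℝ) : Prop := ∃ t : Tile, t.Admissible ∧ t.Shape (t.localize α)

lemma IsIntVec.comp {β : Fin 6 → ℝ} (h : IsIntVec β) (σ : Equiv.Perm (Fin 6)) :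
    IsIntVec (β ∘ σ) := by
  obtain ⟨k, hk⟩ := h
  exact ⟨k ∘ σ, fun r => hk _⟩

lemma InLattice.comp {β : Fin 6 → ℝ} (h : InLattice β) (σ : Equiv.Perm (Fin 6)) :
    InLattice (β ∘ σ) := by
  rcases h with h | h
  · exact Or.inl (h.comp σ)
  · exact Or.inr (h.comp σ)

lemma Covered.of_comp {α : Fin 6 → ℝ} (σ : Equiv.Perm (Fin 6)) (h : Covered (α ∘ σ)) :
    Covered α := by
  obtain ⟨t, ht, hs⟩ := h
  have hsum : ∀ β : Fin 6 → ℝ, ∑ r, (β ∘ σ.symm) r = ∑ r, β r := fun β => Equiv.sum_comp σ.symm β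
  have hloc : ∀ (c : ℝ) (β : Fin 6 → ℝ), c • (α ∘ σ - β) = (c • (α - β ∘ σ.symm)) ∘ σ :=
    fun c β => by funext r; simp
  cases t with
  | one β =>
    refine ⟨.one (β ∘ σ.symm), ⟨ht.1.comp _, by rw [hsum]; exact ht.2⟩, ?_⟩
    simp only [Tile.Shape, Tile.localize, Tile.sign, Tile.origin, hloc] at hs ⊢
    exact hs.of_comp σ
  | oneHat β =>
    refine ⟨.oneHat (β ∘ σ.symm), ⟨ht.1.comp _, by rw [hsum]; exact ht.2⟩, ?_⟩
    simp only [Tile.Shape, Tile.localize, Tile.sign, Tile.origin, hloc] at hs ⊢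
    exact hs.of_comp σ
  | two β a =>
    refine ⟨.two (β ∘ σ.symm) (σ a), ⟨ht.1.comp _, by rw [hsum]; exact ht.2⟩, ?_⟩
    simp only [Tile.Shape, Tile.localize, Tile.sign, Tile.origin, hloc] at hs ⊢
    exact hs.of_comp σ
  | three β T =>
    refine ⟨.three (β ∘ σ.symm) (T.map σ.toEmbedding),
      ⟨ht.1.comp _, by rw [hsum]; exact ht.2.1, by simpa using ht.2.2⟩, ?_⟩
    simp only [Tile.Shape, Tile.localize, Tile.sign, Tile.origin, hloc] at hs ⊢
    exact hs.of_comp σ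
  | threeHat β T =>
    refine ⟨.threeHat (β ∘ σ.symm) (T.map σ.toEmbedding),
      ⟨ht.1.comp _, by rw [hsum]; exact ht.2.1, by simpa using ht.2.2⟩, ?_⟩
    simp only [Tile.Shape, Tile.localize, Tile.sign, Tile.origin, hloc] at hs ⊢
    exact hs.of_comp σ

lemma IsIntVec.neg {x : Fin 6 → ℝ} (hx : IsIntVec x) : IsIntVec (-x) := by
  obtain ⟨k, hk⟩ := hx
  exact ⟨fun r => -k r, fun r => by simp [hk]⟩

lemma IsIntVec.add {x y : Fin 6 → ℝ} (hx : IsIntVec x) (hy : IsIntVec y) : IsIntVec (x + y) := by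
  have := hx.sub hy.neg
  rwa [sub_neg_eq_add] at this

lemma InLattice.add_isIntVec {x y : Fin 6 → ℝ} (hx : InLattice x) (hy : IsIntVec y) :
    InLattice (x + y) := by
  have := hx.sub (Or.inl hy.neg)
  rwa [sub_neg_eq_add] at this

lemma Covered.of_sub {α δ : Fin 6 → ℝ} (hδ : IsIntVec δ) (hδ0 : ∑ r, δ r = 0)
    (h : Covered (α - δ)) : Covered α := by
  obtain ⟨t, ht, hs⟩ := h
  have hsum : ∀ β : Fin 6 → ℝ, ∑ r, (β + δ) r = ∑ r, β r := fun β => by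
    simp [Finset.sum_add_distrib, hδ0]
  have hloc : ∀ (β : Fin 6 → ℝ), α - δ - β = α - (β + δ) := fun β => by abel
  cases t with
  | one β =>
    refine ⟨.one (β + δ), ⟨ht.1.add_isIntVec hδ, by rw [hsum]; exact ht.2⟩, ?_⟩
    simpa only [Tile.Shape, Tile.localize, Tile.sign, Tile.origin, hloc] using hs
  | oneHat β =>
    refine ⟨.oneHat (β + δ), ⟨ht.1.add_isIntVec hδ, by rw [hsum]; exact ht.2⟩, ?_⟩
    simpa only [Tile.Shape, Tile.localize, Tile.sign, Tile.origin, hloc] using hs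
  | two β a =>
    refine ⟨.two (β + δ) a, ⟨ht.1.add_isIntVec hδ, by rw [hsum]; exact ht.2⟩, ?_⟩
    simpa only [Tile.Shape, Tile.localize, Tile.sign, Tile.origin, hloc] using hs
  | three β T =>
    refine ⟨.three (β + δ) T, ⟨ht.1.add hδ, by rw [hsum]; exact ht.2.1, ht.2.2⟩, ?_⟩
    simpa only [Tile.Shape, Tile.localize, Tile.sign, Tile.origin, hloc] using hs
  | threeHat β T =>
    refine ⟨.threeHat (β + δ) T, ⟨ht.1.add hδ, by rw [hsum]; exact ht.2.1, ht.2.2⟩, ?_⟩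
    simpa only [Tile.Shape, Tile.localize, Tile.sign, Tile.origin, hloc] using hs

/-- The vector with the given coordinates. -/
def vec (a b c d e f : ℝ) : Fin 6 → ℝ := ![a, b, c, d, e, f]

lemma forall_fin_six {P : Fin 6 → Prop} :
    (∀ r, P r) ↔ P 0 ∧ P 1 ∧ P 2 ∧ P 3 ∧ P 4 ∧ P 5 := by
  constructor
  · intro h; exact ⟨h 0, h 1, h 2, h 3, h 4, h 5⟩
  · rintro ⟨h0, h1, h2, h3, h4, h5⟩ r
    fin_cases r <;> assumption

lemma isIntVec_vec (a b c d e f : ℤ) : IsIntVec (vec a b c d e f) :=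
  ⟨![a, b, c, d, e, f], by rw [forall_fin_six]; simp [vec]⟩

lemma inLattice_vec_int (a b c d e f : ℤ) : InLattice (vec a b c d e f) :=
  Or.inl (isIntVec_vec a b c d e f)

lemma inLattice_vec_half (a b c d e f : ℤ) : InLattice
    (vec (a + 1 / 2) (b + 1 / 2) (c + 1 / 2) (d + 1 / 2) (e + 1 / 2) (f + 1 / 2)) :=
  Or.inr ⟨![a, b, c, d, e, f], by rw [forall_fin_six]; simp [vec, rho]⟩

lemma sum_vec (a b c d e f : ℝ) : ∑ r, vec a b c d e f r = a + b + c + d + e + f := by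
  rw [Fin.sum_univ_six]; rfl

lemma smul_vec_sub_vec (s a b c d e f a' b' c' d' e' f' : ℝ) :
    s • (vec a b c d e f - vec a' b' c' d' e' f') =
      vec (s * (a - a')) (s * (b - b')) (s * (c - c')) (s * (d - d')) (s * (e - e'))
        (s * (f - f')) := by
  funext r; fin_cases r <;> simp [vec]

lemma shapeOne_vec {a b c d e f : ℝ} (h : a + b + c + d + e + f = 1) (ha : 0 ≤ a) (hb : 0 ≤ b)
    (hc : 0 ≤ c) (hd : 0 ≤ d) (he : 0 ≤ e) (hf : 0 ≤ f) : ShapeOne (vec a b c d e f) := by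
  refine ⟨by rw [sum_vec]; exact h, ?_⟩
  rw [forall_fin_six]
  exact ⟨ha, hb, hc, hd, he, hf⟩

lemma covered_one_int {a b c d e f : ℝ} (k₀ k₁ k₂ k₃ k₄ k₅ : ℤ) (h : a + b + c + d + e + f = 1)
    (hk : k₀ + k₁ + k₂ + k₃ + k₄ + k₅ = 0) (ha : k₀ ≤ a) (hb : k₁ ≤ b) (hc : k₂ ≤ c) (hd : k₃ ≤ d)
    (he : k₄ ≤ e) (hf : k₅ ≤ f) : Covered (vec a b c d e f) := by
  have hk' : (k₀ + k₁ + k₂ + k₃ + k₄ + k₅ : ℝ) = 0 := by exact_mod_cast hk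
  refine ⟨.one _, ⟨inLattice_vec_int k₀ k₁ k₂ k₃ k₄ k₅, by rw [sum_vec]; linarith⟩, ?_⟩
  simp only [Tile.Shape, Tile.localize, Tile.sign, Tile.origin, smul_vec_sub_vec]
  apply shapeOne_vec <;> linarith

lemma covered_one_half {a b c d e f : ℝ} (k₀ k₁ k₂ k₃ k₄ k₅ : ℤ) (h : a + b + c + d + e + f = 1)
    (hk : k₀ + k₁ + k₂ + k₃ + k₄ + k₅ = -3) (ha : k₀ + 1 / 2 ≤ a) (hb : k₁ + 1 / 2 ≤ b)
    (hc : k₂ + 1 / 2 ≤ c) (hd : k₃ + 1 / 2 ≤ d) (he : k₄ + 1 / 2 ≤ e) (hf : k₅ + 1 / 2 ≤ f) :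
    Covered (vec a b c d e f) := by
  have hk' : (k₀ + k₁ + k₂ + k₃ + k₄ + k₅ : ℝ) = -3 := by exact_mod_cast hk
  refine ⟨.one _, ⟨inLattice_vec_half k₀ k₁ k₂ k₃ k₄ k₅, by rw [sum_vec]; linarith⟩, ?_⟩
  simp only [Tile.Shape, Tile.localize, Tile.sign, Tile.origin, smul_vec_sub_vec]
  apply shapeOne_vec <;> linarith

lemma covered_oneHat_int {a b c d e f : ℝ} (k₀ k₁ k₂ k₃ k₄ k₅ : ℤ) (h : a + b + c + d + e + f = 1)
    (hk : k₀ + k₁ + k₂ + k₃ + k₄ + k₅ = 2) (ha : a ≤ k₀) (hb : b ≤ k₁) (hc : c ≤ k₂) (hd : d ≤ k₃)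
    (he : e ≤ k₄) (hf : f ≤ k₅) : Covered (vec a b c d e f) := by
  have hk' : (k₀ + k₁ + k₂ + k₃ + k₄ + k₅ : ℝ) = 2 := by exact_mod_cast hk
  refine ⟨.oneHat _, ⟨inLattice_vec_int k₀ k₁ k₂ k₃ k₄ k₅, by rw [sum_vec]; linarith⟩, ?_⟩
  simp only [Tile.Shape, Tile.localize, Tile.sign, Tile.origin, smul_vec_sub_vec]
  apply shapeOne_vec <;> linarith

lemma covered_oneHat_half {a b c d e f : ℝ} (k₀ k₁ k₂ k₃ k₄ k₅ : ℤ)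
    (h : a + b + c + d + e + f = 1)
    (hk : k₀ + k₁ + k₂ + k₃ + k₄ + k₅ = -1) (ha : a ≤ k₀ + 1 / 2) (hb : b ≤ k₁ + 1 / 2)
    (hc : c ≤ k₂ + 1 / 2) (hd : d ≤ k₃ + 1 / 2) (he : e ≤ k₄ + 1 / 2) (hf : f ≤ k₅ + 1 / 2) :
    Covered (vec a b c d e f) := by
  have hk' : (k₀ + k₁ + k₂ + k₃ + k₄ + k₅ : ℝ) = -1 := by exact_mod_cast hk
  refine ⟨.oneHat _, ⟨inLattice_vec_half k₀ k₁ k₂ k₃ k₄ k₅, by rw [sum_vec]; linarith⟩, ?_⟩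
  simp only [Tile.Shape, Tile.localize, Tile.sign, Tile.origin, smul_vec_sub_vec]
  apply shapeOne_vec <;> linarith

lemma sum_erase_six (a : Fin 6) (f : Fin 6 → ℝ) : ∑ r ∈ Finset.univ.erase a, f r =
    f 0 + f 1 + f 2 + f 3 + f 4 + f 5 - f a := by
  rw [Finset.sum_erase_eq_sub (Finset.mem_univ a), Fin.sum_univ_six]

lemma abs_add_five_le {a b c d e B : ℝ} (h : ∀ s₁ s₂ s₃ s₄ s₅ : ℝ, (s₁ = 1 ∨ s₁ = -1) →
    (s₂ = 1 ∨ s₂ = -1) → (s₃ = 1 ∨ s₃ = -1) → (s₄ = 1 ∨ s₄ = -1) → (s₅ = 1 ∨ s₅ = -1) →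
    s₁ * a + s₂ * b + s₃ * c + s₄ * d + s₅ * e ≤ B) :
    |a| + |b| + |c| + |d| + |e| ≤ B := by
  have hs : ∀ x : ℝ, ∃ s : ℝ, (s = 1 ∨ s = -1) ∧ |x| = s * x := fun x => by
    rcases abs_cases x with ⟨h, _⟩ | ⟨h, _⟩
    · exact ⟨1, Or.inl rfl, by rw [h, one_mul]⟩
    · exact ⟨-1, Or.inr rfl, by rw [h, neg_one_mul]⟩
  obtain ⟨s₁, h₁, e₁⟩ := hs a
  obtain ⟨s₂, h₂, e₂⟩ := hs b
  obtain ⟨s₃, h₃, e₃⟩ := hs c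
  obtain ⟨s₄, h₄, e₄⟩ := hs d
  obtain ⟨s₅, h₅, e₅⟩ := hs e
  rw [e₁, e₂, e₃, e₄, e₅]
  exact h _ _ _ _ _ h₁ h₂ h₃ h₄ h₅

lemma shapeTwo_vec {a b c d e f : ℝ} (h : a + b + c + d + e + f = 1) (r : Fin 6)
    (hr : |a + vec a b c d e f r| + |b + vec a b c d e f r| + |c + vec a b c d e f r| +
      |d + vec a b c d e f r| + |e + vec a b c d e f r| + |f + vec a b c d e f r| -
      |vec a b c d e f r + vec a b c d e f r| ≤ 1) : ShapeTwo r (vec a b c d e f) := by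
  refine ⟨by rw [sum_vec]; exact h, ?_⟩
  rw [sum_erase_six]
  exact hr

lemma shapeThree_vec {T : Finset (Fin 6)} {a b c d e f : ℝ} (h : a + b + c + d + e + f = 1)
    (hr : ∀ r, 0 ≤ if r ∈ T then vec a b c d e f r - (∑ s ∈ T, vec a b c d e f s - 1)
      else vec a b c d e f r + (∑ s ∈ T, vec a b c d e f s - 1)) :
    ShapeThree T (vec a b c d e f) := by
  refine ⟨by rw [sum_vec]; exact h, fun r hrT => ?_, fun r hrT => ?_⟩
  · have := hr r; rwa [if_pos hrT] at this
  · have := hr r; rwa [if_neg hrT] at this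

/-- The integer k is one of 0, …, 5, and subtracting k - 1 from the largest coordinate restores the
sum 1. By the ordering, few comparisons of coordinates with 1/2 and of pair sums with 1 decide which
polytope contains the point; the remaining inequalities follow linearly. -/
theorem covered_sorted {a b c d e f : ℝ} {k : ℤ} (h0 : 0 ≤ a) (hab : a ≤ b) (hbc : b ≤ c)
    (hcd : c ≤ d) (hde : d ≤ e) (hef : e ≤ f) (hf : f < 1) (hk : a + b + c + d + e + f = k) :
    Covered (vec a b c d e (f - (k - 1))) := by
  have hk0 : 0 ≤ k := by
    have : (0 : ℝ) ≤ k := by linarith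
    exact_mod_cast this
  have hk6 : k < 6 := by
    have : (k : ℝ) < (6 : ℤ) := by push_cast; linarith
    exact_mod_cast this
  interval_cases k <;> norm_num at hk ⊢
  · exact covered_one_int 0 0 0 0 0 0 (by linarith) (by norm_num) (by push_cast; linarith)
      (by push_cast; linarith) (by push_cast; linarith) (by push_cast; linarith)
      (by push_cast; linarith) (by push_cast; linarith)
  · exact covered_one_int 0 0 0 0 0 0 (by linarith) (by norm_num) (by push_cast; linarith)
      (by push_cast; linarith) (by push_cast; linarith) (by push_cast; linarith)
      (by push_cast; linarith) (by push_cast; linarith)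
  · rcases le_or_gt f (1 / 2) with h1 | h1
    · exact covered_oneHat_half 0 0 0 0 0 (-1) (by linarith) (by norm_num) (by push_cast; linarith)
        (by push_cast; linarith) (by push_cast; linarith) (by push_cast; linarith)
        (by push_cast; linarith) (by push_cast; linarith)
    rcases le_or_gt 1 (d + e) with h2 | h2
    · refine ⟨.threeHat (vec (0 : ℤ) (0 : ℤ) (0 : ℤ) (1 : ℤ) (1 : ℤ) (0 : ℤ)) {3, 4, 5},
        ⟨isIntVec_vec _ _ _ _ _ _, by rw [sum_vec]; norm_num, rfl⟩, ?_⟩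
      simp only [Tile.Shape, Tile.localize, Tile.sign, Tile.origin, smul_vec_sub_vec]
      refine shapeThree_vec (by push_cast; linarith) ?_
      rw [forall_fin_six]
      simp [vec]
      refine ⟨?_, ?_, ?_, ?_, ?_, ?_⟩ <;> linarith
    · refine ⟨.two (vec (0 : ℤ) (0 : ℤ) (0 : ℤ) (0 : ℤ) (0 : ℤ) (0 : ℤ)) 5,
        ⟨inLattice_vec_int _ _ _ _ _ _, by rw [sum_vec]; norm_num⟩, ?_⟩
      simp only [Tile.Shape, Tile.localize, Tile.sign, Tile.origin, smul_vec_sub_vec]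
      refine shapeTwo_vec (by push_cast; linarith) 5 ?_
      -- The ℓ¹ inequality is replaced by its 32 linear consequences, one for each choice of signs.
      have := abs_add_five_le (a := a + (f - 1)) (b := b + (f - 1)) (c := c + (f - 1))
        (d := d + (f - 1)) (e := e + (f - 1)) (B := 1) (by
          rintro _ _ _ _ _ (rfl | rfl) (rfl | rfl) (rfl | rfl) (rfl | rfl) (rfl | rfl) <;> linarith)
      simp [vec]
      ring_nf at this ⊢
      linarith
  · rcases le_total (f + a) 1 with h1 | h1 <;> rcases le_total (d + c) 1 with h2 | h2
    · refine ⟨.three (vec (0 : ℤ) (0 : ℤ) (0 : ℤ) (0 : ℤ) (1 : ℤ) (-1 : ℤ)) {1, 2, 3},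
        ⟨isIntVec_vec _ _ _ _ _ _, by rw [sum_vec]; norm_num, rfl⟩, ?_⟩
      simp only [Tile.Shape, Tile.localize, Tile.sign, Tile.origin, smul_vec_sub_vec]
      refine shapeThree_vec (by push_cast; linarith) ?_
      rw [forall_fin_six]
      simp [vec]
      refine ⟨?_, ?_, ?_, ?_, ?_, ?_⟩ <;> linarith
    · rcases le_or_gt (1 / 2) b with h3 | h3
      · exact covered_one_half (-1) 0 0 0 0 (-2) (by linarith) (by norm_num)
          (by push_cast; linarith)
          (by push_cast; linarith) (by push_cast; linarith) (by push_cast; linarith)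
          (by push_cast; linarith) (by push_cast; linarith)
      refine ⟨.two _ 1, ⟨inLattice_vec_half (-1) 0 0 0 0 (-2), by rw [sum_vec]; norm_num⟩, ?_⟩
      simp only [Tile.Shape, Tile.localize, Tile.sign, Tile.origin, smul_vec_sub_vec]
      refine shapeTwo_vec (by push_cast; linarith) 1 ?_
      have := abs_add_five_le (a := a + b) (b := c + b - 1) (c := d + b - 1)
        (d := e + b - 1) (e := f + b - 1) (B := 1) (by
          rintro _ _ _ _ _ (rfl | rfl) (rfl | rfl) (rfl | rfl) (rfl | rfl) (rfl | rfl) <;> linarith)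
      simp [vec]
      ring_nf at this ⊢
      linarith
    · rcases le_or_gt e (1 / 2) with h3 | h3
      · exact covered_oneHat_half 0 0 0 0 0 (-1) (by linarith) (by norm_num)
          (by push_cast; linarith)
          (by push_cast; linarith) (by push_cast; linarith) (by push_cast; linarith)
          (by push_cast; linarith) (by push_cast; linarith)
      refine ⟨.two (vec (0 : ℤ) (0 : ℤ) (0 : ℤ) (0 : ℤ) (1 : ℤ) (-1 : ℤ)) 4,
        ⟨inLattice_vec_int _ _ _ _ _ _, by rw [sum_vec]; norm_num⟩, ?_⟩
      simp only [Tile.Shape, Tile.localize, Tile.sign, Tile.origin, smul_vec_sub_vec]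
      refine shapeTwo_vec (by push_cast; linarith) 4 ?_
      have := abs_add_five_le (a := a + e - 1) (b := b + e - 1) (c := c + e - 1)
        (d := d + e - 1) (e := f + e - 2) (B := 1) (by
          rintro _ _ _ _ _ (rfl | rfl) (rfl | rfl) (rfl | rfl) (rfl | rfl) (rfl | rfl) <;> linarith)
      simp [vec]
      ring_nf at this ⊢
      linarith
    · refine ⟨.threeHat (vec (0 : ℤ) (0 : ℤ) (1 : ℤ) (1 : ℤ) (1 : ℤ) (-1 : ℤ)) {2, 3, 4},
        ⟨isIntVec_vec _ _ _ _ _ _, by rw [sum_vec]; norm_num, rfl⟩, ?_⟩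
      simp only [Tile.Shape, Tile.localize, Tile.sign, Tile.origin, smul_vec_sub_vec]
      refine shapeThree_vec (by push_cast; linarith) ?_
      rw [forall_fin_six]
      simp [vec]
      refine ⟨?_, ?_, ?_, ?_, ?_, ?_⟩ <;> linarith
  · rcases le_or_gt (1 / 2) a with h1 | h1
    · exact covered_one_half 0 0 0 0 0 (-3) (by linarith) (by norm_num) (by push_cast; linarith)
        (by push_cast; linarith) (by push_cast; linarith) (by push_cast; linarith)
        (by push_cast; linarith) (by push_cast; linarith)
    rcases le_or_gt (b + c) 1 with h2 | h2
    · refine ⟨.three (vec (0 : ℤ) (0 : ℤ) (0 : ℤ) (1 : ℤ) (1 : ℤ) (-2 : ℤ)) {0, 1, 2},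
        ⟨isIntVec_vec _ _ _ _ _ _, by rw [sum_vec]; norm_num, rfl⟩, ?_⟩
      simp only [Tile.Shape, Tile.localize, Tile.sign, Tile.origin, smul_vec_sub_vec]
      refine shapeThree_vec (by push_cast; linarith) ?_
      rw [forall_fin_six]
      simp [vec]
      refine ⟨?_, ?_, ?_, ?_, ?_, ?_⟩ <;> linarith
    · refine ⟨.two _ 0, ⟨inLattice_vec_half 0 0 0 0 0 (-3), by rw [sum_vec]; norm_num⟩, ?_⟩
      simp only [Tile.Shape, Tile.localize, Tile.sign, Tile.origin, smul_vec_sub_vec]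
      refine shapeTwo_vec (by push_cast; linarith) 0 ?_
      have := abs_add_five_le (a := b + a - 1) (b := c + a - 1) (c := d + a - 1)
        (d := e + a - 1) (e := f + a - 1) (B := 1) (by
          rintro _ _ _ _ _ (rfl | rfl) (rfl | rfl) (rfl | rfl) (rfl | rfl) (rfl | rfl) <;> linarith)
      simp [vec]
      ring_nf at this ⊢
      linarith
  · exact covered_oneHat_int 1 1 1 1 1 (-3) (by linarith) (by norm_num) (by push_cast; linarith)
      (by push_cast; linarith) (by push_cast; linarith) (by push_cast; linarith)
      (by push_cast; linarith) (by push_cast; linarith)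

/-- The set of polytopes is stable under permutations of coordinates and under integral translations
of sum zero, which allows sorted fractional parts. -/
theorem covered_of_sum_eq_one {α : Fin 6 → ℝ} (hα : ∑ r, α r = 1) : Covered α := by
  set σ := Tuple.sort fun r => Int.fract (α r)
  have hmono : Monotone ((fun r => Int.fract (α r)) ∘ σ) := Tuple.monotone_sort _
  refine Covered.of_comp σ ?_
  have hsum : ∑ r, (α ∘ σ) r = 1 := by rw [← hα]; exact Equiv.sum_comp σ α
  generalize hα' : α ∘ σ = α' at *
  set x : Fin 6 → ℝ := fun r => Int.fract (α' r) with hx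
  have hmx : Monotone x := by rw [hx, ← hα']; exact hmono
  set k : ℤ := 1 - ∑ r, ⌊α' r⌋ with hk
  have hxk : x 0 + x 1 + x 2 + x 3 + x 4 + x 5 = k := by
    have : ∑ r, x r = k := by
      simp only [hx, ← Int.self_sub_floor, Finset.sum_sub_distrib, hsum, hk]; push_cast; ring
    rwa [Fin.sum_univ_six] at this
  have hc := covered_sorted (Int.fract_nonneg (α' 0)) (hmx (by decide : (0 : Fin 6) ≤ 1))
    (hmx (by decide : (1 : Fin 6) ≤ 2)) (hmx (by decide : (2 : Fin 6) ≤ 3))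
    (hmx (by decide : (3 : Fin 6) ≤ 4)) (hmx (by decide : (4 : Fin 6) ≤ 5))
    (Int.fract_lt_one (α' 5)) hxk
  -- The summand k - 1 in the last coordinate gives the translation sum zero, since the floors add
  -- up to 1 - k.
  refine Covered.of_sub (δ := vec ⌊α' 0⌋ ⌊α' 1⌋ ⌊α' 2⌋ ⌊α' 3⌋ ⌊α' 4⌋ ((⌊α' 5⌋ + (k - 1) : ℤ) : ℝ))
    (isIntVec_vec _ _ _ _ _ _) ?_ ?_
  · rw [sum_vec, hk, Fin.sum_univ_six]; push_cast; ring
  · convert hc using 1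
    funext r
    have hfl : ∀ r, α' r - ⌊α' r⌋ = x r := fun r => Int.self_sub_floor _
    fin_cases r
    · exact hfl 0
    · exact hfl 1
    · exact hfl 2
    · exact hfl 3
    · exact hfl 4
    · have := hfl 5
      simp only [vec, hx] at this ⊢
      simp
      linarith

theorem iUnion_body : (⋃ t ∈ {t : Tile | t.Admissible}, t.body) =
    {α : Fin 6 → ℝ | ∑ r, α r = 1} := by
  ext α
  simp only [mem_iUnion, mem_ofPred_eq, exists_prop]
  constructor
  · rintro ⟨t, ht, hα⟩
    rw [Tile.mem_body_iff ht] at hα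
    have h1 : ∑ r, t.localize α r = 1 := by
      cases t <;> exact hα.1
    have h2 : ∑ r, α r = ∑ r, t.origin r + t.sign * ∑ r, t.localize α r := by
      rw [Finset.mul_sum, ← Finset.sum_add_distrib]
      exact Finset.sum_congr rfl fun r _ =>
        (congrFun (Tile.origin_add_sign_smul_localize t α) r).symm
    rw [h2, h1]
    cases t with
    | one β => simp only [Tile.sign, Tile.origin, ht.2]; norm_num
    | oneHat γ => simp only [Tile.sign, Tile.origin, ht.2]; norm_num
    | two β a => simp only [Tile.sign, Tile.origin, ht.2]; norm_num
    | three β T => simp only [Tile.sign, Tile.origin, ht.2.1]; norm_num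
    | threeHat γ T => simp only [Tile.sign, Tile.origin, ht.2.1]; norm_num
  · intro h
    obtain ⟨t, ht, hs⟩ := covered_of_sum_eq_one h
    exact ⟨t, ht, (Tile.mem_body_iff ht α).2 hs⟩

/-! ### Symmetries of the order behavior -/

lemma fract_eq_of_sub_int {x y : ℝ} (n : ℤ) (h : x = y + n) : Int.fract x = Int.fract y := by
  rw [h, Int.fract_add_intCast]

/-- Pair sums change by integers because 2s is an integer. The shift s in α_r - ζ is absorbed into
ζ, and in α_r + ζ it is absorbed up to the integer 2s. -/
lemma firstOrder_add {h : Fin 6 → ℝ} {s : ℝ} (k : Fin 6 → ℤ) (n : ℤ) (hh : ∀ r, h r = k r + s)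
    (hs : 2 * s = n) (α : Fin 6 → ℝ) (ζ : ℝ) :
    firstOrder (α + h) ζ = firstOrder α (ζ - s) := by
  simp only [firstOrder, Pi.add_apply, hh]
  congr 1
  · refine Finset.sum_congr rfl fun rs _ => ?_
    rw [fract_eq_of_sub_int (k rs.1 + k rs.2 + n)]
    push_cast; linarith
  · refine Finset.sum_congr rfl fun r _ => ?_
    rw [fract_eq_of_sub_int (y := α r - (ζ - s)) (k r),
      fract_eq_of_sub_int (x := α r + (k r + s) + ζ) (y := α r + (ζ - s)) (k r + n)]
    · push_cast; linarith
    · ring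

lemma secondOrder_add {h : Fin 6 → ℝ} {s : ℝ} (k : Fin 6 → ℤ) (n : ℤ) (hh : ∀ r, h r = k r + s)
    (hs : 2 * s = n) (ℓ : ℝ) (α : Fin 6 → ℝ) (ζ : ℝ) (lam : Fin 6 → ℝ) (mu : ℝ) :
    secondOrder ℓ (α + h) ζ lam mu = secondOrder ℓ α (ζ - s) lam mu := by
  simp only [secondOrder, Pi.add_apply, hh]
  rw [fract_eq_of_sub_int (x := 2 * ζ) (y := 2 * (ζ - s)) n (by linarith)]
  congr 3
  · refine Finset.sum_congr rfl fun rs _ => ?_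
    rw [fract_eq_of_sub_int (k rs.1 + k rs.2 + n)]
    push_cast; linarith
  · refine Finset.sum_congr rfl fun r _ => ?_
    rw [fract_eq_of_sub_int (y := α r - (ζ - s)) (k r),
      fract_eq_of_sub_int (x := α r + (k r + s) + ζ) (y := α r + (ζ - s)) (k r + n)]
    · push_cast; linarith
    · ring

lemma firstOrder_add_intCast (α : Fin 6 → ℝ) (ζ : ℝ) (n : ℤ) :
    firstOrder α (ζ + n) = firstOrder α ζ := by
  have := firstOrder_add (h := 0) (s := n) (fun _ => -n) (2 * n) (fun r => by simp)
    (by push_cast; ring) α (ζ + n)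
  rwa [add_zero, add_sub_cancel_right] at this

lemma secondOrder_add_intCast (ℓ : ℝ) (α : Fin 6 → ℝ) (ζ : ℝ) (n : ℤ) (lam : Fin 6 → ℝ) (mu : ℝ) :
    secondOrder ℓ α (ζ + n) lam mu = secondOrder ℓ α ζ lam mu := by
  have := secondOrder_add (h := 0) (s := n) (fun _ => -n) (2 * n) (fun r => by simp)
    (by push_cast; ring) ℓ α (ζ + n) lam mu
  rwa [add_zero, add_sub_cancel_right] at this

lemma firstOrder_neg_right (α : Fin 6 → ℝ) (ζ : ℝ) : firstOrder α (-ζ) = firstOrder α ζ := by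
  simp only [firstOrder, sub_neg_eq_add, ← sub_eq_add_neg]
  congr 1
  exact Finset.sum_congr rfl fun r _ => add_comm _ _

lemma secondOrder_neg_right (ℓ : ℝ) (α : Fin 6 → ℝ) (ζ : ℝ) (lam : Fin 6 → ℝ) (mu : ℝ) :
    secondOrder ℓ α (-ζ) lam mu = secondOrder ℓ α ζ lam (-mu) := by
  simp only [secondOrder, sub_neg_eq_add, ← sub_eq_add_neg, mul_neg, quadC_fract_neg]
  congr 3
  exact Finset.sum_congr rfl fun r _ => add_comm _ _

/-- B of the fractional part is an odd function. The formula makes sense off the balancing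
hyperplane, and combined with lattice translations this reflection reduces the hatted polytopes to
the unhatted ones with maxima and minima exchanged. -/
lemma firstOrder_neg_left (α : Fin 6 → ℝ) (ζ : ℝ) : firstOrder (-α) ζ = -firstOrder α ζ := by
  have h1 : ∀ x y : ℝ, -x + -y = -(x + y) := fun x y => by ring
  have h2 : ∀ x y : ℝ, -x - y = -(x + y) := fun x y => by ring
  have h3 : ∀ x y : ℝ, -x + y = -(x - y) := fun x y => by ring
  simp only [firstOrder, Pi.neg_apply, h1, h2, h3, cubicB_fract_neg, Finset.sum_neg_distrib]
  simp only [Finset.sum_add_distrib]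
  ring

lemma secondOrder_neg_left (ℓ : ℝ) (α : Fin 6 → ℝ) (ζ : ℝ) (lam : Fin 6 → ℝ) (mu : ℝ) :
    secondOrder ℓ (-α) ζ lam mu = secondOrder ℓ α (-ζ) lam mu := by
  have h1 : ∀ x y : ℝ, -x + -y = -(x + y) := fun x y => by ring
  have h2 : ∀ x y : ℝ, -x - y = -(x - -y) := fun x y => by ring
  have h3 : ∀ x y : ℝ, -x + y = -(x + -y) := fun x y => by ring
  simp only [secondOrder, Pi.neg_apply, h1, h2, h3, quadC_fract_neg, mul_neg]

/-- The second order behavior is trivial. -/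
def SecondOrderVanishes (ℓ : ℝ) (α : Fin 6 → ℝ) (ζ : ℝ) : Prop :=
  ∀ (lam : Fin 6 → ℝ) (mu : ℝ), ∑ r, lam r = ℓ → secondOrder ℓ α ζ lam mu = 0

lemma secondOrderVanishes_add_intCast (ℓ : ℝ) (α : Fin 6 → ℝ) (ζ : ℝ) (n : ℤ) :
    SecondOrderVanishes ℓ α (ζ + n) ↔ SecondOrderVanishes ℓ α ζ := by
  simp only [SecondOrderVanishes, secondOrder_add_intCast]

lemma secondOrderVanishes_neg_right (ℓ : ℝ) (α : Fin 6 → ℝ) (ζ : ℝ) :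
    SecondOrderVanishes ℓ α (-ζ) ↔ SecondOrderVanishes ℓ α ζ := by
  simp only [SecondOrderVanishes, secondOrder_neg_right]
  exact ⟨fun h lam mu hl => by simpa using h lam (-mu) hl, fun h lam mu hl => h lam (-mu) hl⟩

lemma secondOrderVanishes_neg_left (ℓ : ℝ) (α : Fin 6 → ℝ) (ζ : ℝ) :
    SecondOrderVanishes ℓ (-α) ζ ↔ SecondOrderVanishes ℓ α ζ := by
  rw [← secondOrderVanishes_neg_right ℓ α ζ]
  simp only [SecondOrderVanishes, secondOrder_neg_left]

/-! ### The interval [0, 1/2] as a fundamental domain for ζ -/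

lemma Equivalent.firstOrder_eq {ζ c : ℝ} (h : Equivalent ζ c) (α : Fin 6 → ℝ) :
    firstOrder α ζ = firstOrder α c := by
  obtain ⟨n, rfl | rfl⟩ := h
  · rw [add_comm, firstOrder_add_intCast]
  · rw [sub_eq_add_neg, add_comm, firstOrder_add_intCast, firstOrder_neg_right]

lemma Equivalent.secondOrderVanishes {ζ c : ℝ} (h : Equivalent ζ c) (ℓ : ℝ) (α : Fin 6 → ℝ) :
    SecondOrderVanishes ℓ α ζ ↔ SecondOrderVanishes ℓ α c := by
  obtain ⟨n, rfl | rfl⟩ := h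
  · rw [add_comm, secondOrderVanishes_add_intCast]
  · rw [sub_eq_add_neg, add_comm, secondOrderVanishes_add_intCast, secondOrderVanishes_neg_right]

lemma Equivalent.symm {x y : ℝ} (h : Equivalent x y) : Equivalent y x := by
  obtain ⟨n, h | h⟩ := h
  · exact ⟨-n, Or.inl (by rw [h]; push_cast; ring)⟩
  · exact ⟨n, Or.inr (by rw [h]; ring)⟩

lemma Equivalent.trans {x y z : ℝ} (h : Equivalent x y) (h' : Equivalent y z) :
    Equivalent x z := by
  obtain ⟨n, h | h⟩ := h <;> obtain ⟨m, h' | h'⟩ := h'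
  · exact ⟨n + m, Or.inl (by rw [h, h']; push_cast; ring)⟩
  · exact ⟨n + m, Or.inr (by rw [h, h']; push_cast; ring)⟩
  · exact ⟨n - m, Or.inr (by rw [h, h']; push_cast; ring)⟩
  · exact ⟨n - m, Or.inl (by rw [h, h']; push_cast; ring)⟩

lemma Equivalent.refl (x : ℝ) : Equivalent x x := ⟨0, Or.inl (by simp)⟩

lemma exists_equivalent (ζ : ℝ) : ∃ ζ' ∈ Icc (0 : ℝ) (1 / 2), Equivalent ζ ζ' := by
  have h := Int.floor_add_fract ζ
  rcases le_total (Int.fract ζ) (1 / 2) with h1 | h1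
  · exact ⟨Int.fract ζ, ⟨Int.fract_nonneg ζ, h1⟩, ⌊ζ⌋, Or.inl h.symm⟩
  · refine ⟨1 - Int.fract ζ, ⟨by linarith [Int.fract_lt_one ζ], by linarith⟩, ⌊ζ⌋ + 1, Or.inr ?_⟩
    push_cast; linarith

lemma Equivalent.eq_of_mem {x y : ℝ} (hx : x ∈ Icc (0 : ℝ) (1 / 2)) (hy : y ∈ Icc (0 : ℝ) (1 / 2))
    (h : Equivalent x y) : x = y := by
  obtain ⟨n, h | h⟩ := h
  · have h1 : (n : ℝ) < (1 : ℤ) := by push_cast; linarith [hx.2, hy.1]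
    have h2 : ((-1 : ℤ) : ℝ) < n := by push_cast; linarith [hx.1, hy.2]
    have h3 : n = 0 := by have := Int.cast_lt.1 h1; have := Int.cast_lt.1 h2; omega
    rw [h, h3]; simp
  · have h1 : (n : ℝ) < (2 : ℤ) := by push_cast; linarith [hx.2, hy.2]
    have h2 : ((-1 : ℤ) : ℝ) < n := by push_cast; linarith [hx.1, hy.1]
    have h3 : n = 0 ∨ n = 1 := by have := Int.cast_lt.1 h1; have := Int.cast_lt.1 h2; omega
    rcases h3 with rfl | rfl
    · push_cast at h; linarith [hx.1, hy.1]
    · push_cast at h; linarith [hx.2, hy.2]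

/-! ### Passage to the local coordinates of a tile -/

lemma swapHalf_mem {β : Fin 6 → ℝ} {ζ : ℝ} (h : ζ ∈ Icc (0 : ℝ) (1 / 2)) :
    swapHalf β ζ ∈ Icc (0 : ℝ) (1 / 2) := by
  unfold swapHalf
  split_ifs
  · exact h
  · exact ⟨by linarith [h.2], by linarith [h.1]⟩

lemma swapHalf_swapHalf (β : Fin 6 → ℝ) (ζ : ℝ) : swapHalf β (swapHalf β ζ) = ζ := by
  unfold swapHalf
  split_ifs <;> ring

/-- A vector of the lattice shifts `ζ` by a half-integer, up to a reflection. -/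
lemma InLattice.exists_shift {β : Fin 6 → ℝ} (h : InLattice β) :
    ∃ (k : Fin 6 → ℤ) (n : ℤ) (s : ℝ), (∀ r, β r = k r + s) ∧ 2 * s = n ∧
      ∀ ζ, Equivalent (ζ - s) (swapHalf β ζ) := by
  by_cases hβ : IsIntVec β
  · obtain ⟨k, hk⟩ := hβ
    refine ⟨k, 0, 0, fun r => by simp [hk], by simp, fun ζ => ⟨0, Or.inl ?_⟩⟩
    simp [swapHalf, show IsIntVec β from ⟨k, hk⟩]
  · obtain ⟨k, hk⟩ := h.resolve_left hβ
    refine ⟨k, 1, 1 / 2, fun r => ?_, by norm_num, fun ζ => ⟨0, Or.inr ?_⟩⟩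
    · have := hk r
      simp only [Pi.sub_apply, rho] at this
      linarith
    · simp [swapHalf, hβ]

namespace Tile

lemma sign_eq (t : Tile) : t.sign = 1 ∨ t.sign = -1 := by
  cases t <;> simp [sign]

lemma firstOrder_localize {t : Tile} (ht : t.Admissible) (α : Fin 6 → ℝ) (ζ : ℝ) :
    firstOrder α ζ = t.sign * firstOrder (t.localize α) (swapHalf t.origin ζ) := by
  obtain ⟨k, n, s, hk, hs, he⟩ := ht.origin_mem.exists_shift
  have h := origin_add_sign_smul_localize t α
  conv_lhs => rw [← h]
  rw [add_comm, firstOrder_add k n hk hs, ← (he ζ).firstOrder_eq]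
  rcases t.sign_eq with h1 | h1 <;> rw [h1]
  · simp
  · simp [firstOrder_neg_left]

lemma secondOrderVanishes_localize {t : Tile} (ht : t.Admissible) (ℓ : ℝ) (α : Fin 6 → ℝ) (ζ : ℝ) :
    SecondOrderVanishes ℓ α ζ ↔
      SecondOrderVanishes ℓ (t.localize α) (swapHalf t.origin ζ) := by
  obtain ⟨k, n, s, hk, hs, he⟩ := ht.origin_mem.exists_shift
  have h := origin_add_sign_smul_localize t α
  rw [← (he ζ).secondOrderVanishes]
  conv_lhs => rw [← h]
  have h2 : SecondOrderVanishes ℓ (t.origin + t.sign • t.localize α) ζ ↔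
      SecondOrderVanishes ℓ (t.sign • t.localize α) (ζ - s) := by
    simp only [SecondOrderVanishes, add_comm t.origin, secondOrder_add k n hk hs]
  rw [h2]
  rcases t.sign_eq with h1 | h1 <;> rw [h1]
  · simp
  · simp [secondOrderVanishes_neg_left]

end Tile

/-! ### The order behavior near a tile -/

/-- On this range the floor is one of -1, 0, 1, or 2 at the right endpoint. It contains all
arguments b_r ± ζ that occur on the model shapes with ζ in [0, 1/2]. -/
lemma gammaFst_eq {a : ℝ} (h0 : -1 ≤ a) (h1 : a ≤ 2) :
    gammaFst a = max 0 (a - 1) ^ 2 - max 0 (-a) ^ 2 := by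
  rcases lt_or_ge a 0 with h | h
  · rw [max_eq_left (by linarith), max_eq_right (by linarith), gammaFst,
      fract_eq_of_sub_int (x := a) (y := a + 1) (-1) (by push_cast; ring),
      Int.fract_eq_self.2 ⟨by linarith, by linarith⟩]
    simp only [cubicB]; ring
  rcases lt_or_ge a 1 with h' | h'
  · rw [max_eq_left (by linarith), max_eq_left (by linarith), gammaFst,
      Int.fract_eq_self.2 ⟨h, h'⟩]
    ring
  rw [max_eq_right (by linarith), max_eq_left (by linarith), gammaFst]
  rcases eq_or_lt_of_le h1 with rfl | h2
  · rw [fract_eq_of_sub_int (x := 2) (y := 0) 2 (by push_cast; ring), Int.fract_zero]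
    simp only [cubicB]; norm_num
  · rw [fract_eq_of_sub_int (x := a) (y := a - 1) 1 (by push_cast; ring),
      Int.fract_eq_self.2 ⟨by linarith, by linarith⟩]
    simp only [cubicB]; ring

lemma gammaSnd_eq {a : ℝ} (h0 : -1 ≤ a) (h1 : a ≤ 2) :
    gammaSnd a = max 0 (a - 1) + max 0 (-a) := by
  rcases lt_or_ge a 0 with h | h
  · rw [max_eq_left (by linarith), max_eq_right (by linarith), gammaSnd,
      fract_eq_of_sub_int (x := a) (y := a + 1) (-1) (by push_cast; ring),
      Int.fract_eq_self.2 ⟨by linarith, by linarith⟩]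
    simp only [quadC]; ring
  rcases lt_or_ge a 1 with h' | h'
  · rw [max_eq_left (by linarith), max_eq_left (by linarith), gammaSnd,
      Int.fract_eq_self.2 ⟨h, h'⟩]
    ring
  rw [max_eq_right (by linarith), max_eq_left (by linarith), gammaSnd]
  rcases eq_or_lt_of_le h1 with rfl | h2
  · rw [fract_eq_of_sub_int (x := 2) (y := 0) 2 (by push_cast; ring), Int.fract_zero]
    simp only [quadC]; norm_num
  · rw [fract_eq_of_sub_int (x := a) (y := a - 1) 1 (by push_cast; ring),
      Int.fract_eq_self.2 ⟨by linarith, by linarith⟩]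
    simp only [quadC]; ring

lemma gamma_eq_zero {a : ℝ} (h0 : 0 ≤ a) (h1 : a ≤ 1) : gammaFst a = 0 ∧ gammaSnd a = 0 := by
  rw [gammaFst_eq (by linarith) (by linarith), gammaSnd_eq (by linarith) (by linarith),
    max_eq_left (by linarith), max_eq_left (by linarith)]
  norm_num

lemma gamma_of_le_one {a : ℝ} (h0 : -1 ≤ a) (h1 : a ≤ 1) :
    gammaFst a = -max 0 (-a) ^ 2 ∧ gammaSnd a = max 0 (-a) := by
  rw [gammaFst_eq h0 (by linarith), gammaSnd_eq h0 (by linarith), max_eq_left (b := a - 1)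
    (by linarith)]
  norm_num

/-- The first order behavior as a piecewise quadratic function of `ζ ∈ [0, 1/2]`. -/
noncomputable def localFirst (b : Fin 6 → ℝ) (ζ : ℝ) : ℝ :=
  4 * ζ ^ 2 + ∑ r, (-max 0 (ζ - b r) ^ 2 + max 0 (b r + ζ - 1) ^ 2 - max 0 (-b r - ζ) ^ 2) -
    ∑ rs ∈ pairs, gammaFst (b rs.1 + b rs.2)

/-- Half of the derivative of `localFirst`. -/
noncomputable def slope (b : Fin 6 → ℝ) (ζ : ℝ) : ℝ :=
  4 * ζ + ∑ r, (-max 0 (ζ - b r) + max 0 (b r + ζ - 1) + max 0 (-b r - ζ))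

/-- The factor Γ(z²) contributes 4ζ² and Γ(z⁻²) nothing in this range. The right side is defined and
differentiable for all real ζ, so calculus can be applied to it without one-sided derivatives at the
ends. -/
lemma firstOrder_eq_localFirst {b : Fin 6 → ℝ} (h : ∑ r, b r = 1)
    (hb : ∀ r, -(1 / 2) ≤ b r ∧ b r ≤ 1) {ζ : ℝ} (hζ : ζ ∈ Icc (0 : ℝ) (1 / 2)) :
    firstOrder b ζ = localFirst b ζ := by
  obtain ⟨h0, h1⟩ := hζ
  rw [firstOrder_eq h, localFirst, (gamma_eq_zero (a := 2 * ζ) (by linarith) (by linarith)).1,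
    (gamma_of_le_one (a := -(2 * ζ)) (by linarith) (by linarith)).1, neg_neg,
    max_eq_right (by linarith)]
  have : ∀ r, gammaFst (b r - ζ) + gammaFst (b r + ζ) =
      -max 0 (ζ - b r) ^ 2 + max 0 (b r + ζ - 1) ^ 2 - max 0 (-b r - ζ) ^ 2 := fun r => by
    have := hb r
    rw [(gamma_of_le_one (a := b r - ζ) (by linarith) (by linarith)).1,
      gammaFst_eq (a := b r + ζ) (by linarith) (by linarith), neg_sub, neg_add']
    ring
  simp only [this]
  ring

lemma secondOrder_eq_local {ℓ : ℝ} {b lam : Fin 6 → ℝ} (h : ∑ r, b r = 1)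
    (hb : ∀ r, -(1 / 2) ≤ b r ∧ b r ≤ 1) (hl : ∑ r, lam r = ℓ) {ζ : ℝ}
    (hζ : ζ ∈ Icc (0 : ℝ) (1 / 2)) (mu : ℝ) :
    secondOrder ℓ b ζ lam mu =
      ∑ r, ((lam r + mu - ℓ / 2) * max 0 (ζ - b r) +
        (lam r - mu - ℓ / 2) * (max 0 (b r + ζ - 1) + max 0 (-b r - ζ))) -
      (2 * mu - ℓ / 2) * (2 * ζ) -
      ∑ rs ∈ pairs, (lam rs.1 + lam rs.2 - ℓ / 2) * gammaSnd (b rs.1 + b rs.2) := by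
  obtain ⟨h0, h1⟩ := hζ
  rw [secondOrder_eq h hl, (gamma_eq_zero (a := 2 * ζ) (by linarith) (by linarith)).2,
    (gamma_of_le_one (a := -(2 * ζ)) (by linarith) (by linarith)).2, neg_neg,
    max_eq_right (by linarith), mul_zero, sub_zero]
  have : ∀ r, (lam r + mu - ℓ / 2) * gammaSnd (b r - ζ) +
      (lam r - mu - ℓ / 2) * gammaSnd (b r + ζ) =
      (lam r + mu - ℓ / 2) * max 0 (ζ - b r) +
        (lam r - mu - ℓ / 2) * (max 0 (b r + ζ - 1) + max 0 (-b r - ζ)) := fun r => by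
    have := hb r
    rw [(gamma_of_le_one (a := b r - ζ) (by linarith) (by linarith)).2,
      gammaSnd_eq (a := b r + ζ) (by linarith) (by linarith), neg_sub, neg_add']
  simp only [this]

/-! ### Calculus of the piecewise quadratic function -/

lemma hasDerivAt_max_zero_sq (x : ℝ) : HasDerivAt (fun y : ℝ => max 0 y ^ 2) (2 * max 0 x) x := by
  rcases lt_trichotomy x 0 with h | rfl | h
  · rw [max_eq_left h.le, mul_zero]
    refine (hasDerivAt_const x (0 : ℝ)).congr_of_eventuallyEq ?_
    filter_upwards [gt_mem_nhds h] with y hy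
    rw [max_eq_left hy.le]; norm_num
  · rw [max_self, mul_zero, hasDerivAt_iff_isLittleO]
    have h : (fun y : ℝ => y ^ 2) =o[nhds 0] fun y => y := by
      simpa using Asymptotics.isLittleO_pow_id (one_lt_two)
    simp only [sub_zero, smul_zero, max_self]
    refine Asymptotics.IsBigO.trans_isLittleO (Asymptotics.IsBigO.of_bound 1 ?_) h
    refine Filter.Eventually.of_forall fun y => ?_
    rw [one_mul, Real.norm_eq_abs, Real.norm_eq_abs]
    rcases le_total y 0 with h | h
    · rw [max_eq_left h]; norm_num; positivity
    · rw [max_eq_right h]; norm_num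
  · rw [max_eq_right h.le]
    have := hasDerivAt_pow 2 x
    simp only [Nat.cast_ofNat, Nat.add_one_sub_one, pow_one] at this
    refine this.congr_of_eventuallyEq ?_
    filter_upwards [lt_mem_nhds h] with y hy
    rw [max_eq_right hy.le]

lemma hasDerivAt_localFirst (b : Fin 6 → ℝ) (ζ : ℝ) :
    HasDerivAt (localFirst b) (2 * slope b ζ) ζ := by
  have h1 : HasDerivAt (fun ζ : ℝ => 4 * ζ ^ 2) (8 * ζ) ζ := by
    exact ((hasDerivAt_pow 2 ζ).const_mul (4 : ℝ)).congr_deriv (by norm_num; ring)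
  have h2 : ∀ r, HasDerivAt (fun ζ => -max 0 (ζ - b r) ^ 2 + max 0 (b r + ζ - 1) ^ 2 -
      max 0 (-b r - ζ) ^ 2) (2 * (-max 0 (ζ - b r) + max 0 (b r + ζ - 1) + max 0 (-b r - ζ))) ζ := by
    intro r
    have e1 : HasDerivAt (fun ζ => ζ - b r) 1 ζ := (hasDerivAt_id ζ).sub_const _
    have e2 : HasDerivAt (fun ζ => b r + ζ - 1) 1 ζ := ((hasDerivAt_id ζ).const_add _).sub_const _
    have e3 : HasDerivAt (fun ζ => -b r - ζ) (-1) ζ := (hasDerivAt_id ζ).const_sub _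
    have := (((hasDerivAt_max_zero_sq _).comp ζ e1).neg.add
      ((hasDerivAt_max_zero_sq _).comp ζ e2)).sub ((hasDerivAt_max_zero_sq _).comp ζ e3)
    exact this.congr_deriv (by ring)
  have := (h1.add (HasDerivAt.fun_sum fun r (_ : r ∈ Finset.univ) => h2 r)).sub_const
    (∑ rs ∈ pairs, gammaFst (b rs.1 + b rs.2))
  refine this.congr_deriv ?_
  rw [slope, mul_add, Finset.mul_sum]
  ring

/-- A function that increases from `0` to `c` and is constant exactly up to `m`. -/
lemma climb {f d : ℝ → ℝ} {m c : ℝ} (hm : 0 ≤ m) (hmc : m < c)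
    (hf : ∀ x, HasDerivAt f (2 * d x) x) (h0 : ∀ x, 0 < x → x < m → d x = 0)
    (h1 : ∀ x, m < x → x < c → 0 < d x) {x : ℝ} (hx : x ∈ Icc 0 c) :
    (f x = f 0 ↔ x ≤ m) ∧ (f x = f c ↔ x = c) := by
  have hc : Continuous f := continuous_iff_continuousAt.2 fun x => (hf x).continuousAt
  have e0 : ∀ x ∈ Icc 0 m, f x = f 0 := by
    have h2 : MonotoneOn f (Icc 0 m) := by
      refine monotoneOn_of_deriv_nonneg (convex_Icc 0 m) hc.continuousOn
        (fun x _ => (hf x).differentiableAt.differentiableWithinAt) fun x hx => ?_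
      rw [interior_Icc] at hx
      rw [(hf x).deriv, h0 x hx.1 hx.2, mul_zero]
    have h3 : AntitoneOn f (Icc 0 m) := by
      refine antitoneOn_of_deriv_nonpos (convex_Icc 0 m) hc.continuousOn
        (fun x _ => (hf x).differentiableAt.differentiableWithinAt) fun x hx => ?_
      rw [interior_Icc] at hx
      rw [(hf x).deriv, h0 x hx.1 hx.2, mul_zero]
    exact fun x hx => le_antisymm (h3 ⟨le_rfl, hm⟩ hx hx.1) (h2 ⟨le_rfl, hm⟩ hx hx.1)
  have e1 : StrictMonoOn f (Icc m c) := by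
    refine strictMonoOn_of_deriv_pos (convex_Icc m c) hc.continuousOn fun x hx => ?_
    rw [interior_Icc] at hx
    rw [(hf x).deriv]
    have := h1 x hx.1 hx.2
    linarith
  have e2 := e0 m ⟨hm, le_rfl⟩
  refine ⟨⟨fun h => ?_, fun h => e0 x ⟨hx.1, h⟩⟩, fun h => ?_, fun h => by rw [h]⟩
  · by_contra! hlt
    have := e1 ⟨le_rfl, hmc.le⟩ ⟨hlt.le, hx.2⟩ hlt
    linarith
  · by_contra hne
    have hlt := lt_of_le_of_ne hx.2 hne
    rcases le_or_gt m x with h2 | h2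
    · have := e1 ⟨h2, hx.2⟩ ⟨hmc.le, le_rfl⟩ hlt
      linarith
    · have := e1 ⟨le_rfl, hmc.le⟩ ⟨hmc.le, le_rfl⟩ hmc
      have := e0 x ⟨hx.1, h2.le⟩
      linarith

lemma monotoneOn_of_slope {f d : ℝ → ℝ} {c : ℝ} (hf : ∀ x, HasDerivAt f (2 * d x) x)
    (h0 : ∀ x, 0 < x → x < c → 0 ≤ d x) : MonotoneOn f (Icc 0 c) := by
  have hc : Continuous f := continuous_iff_continuousAt.2 fun x => (hf x).continuousAt
  refine monotoneOn_of_deriv_nonneg (convex_Icc 0 c) hc.continuousOn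
    (fun x _ => (hf x).differentiableAt.differentiableWithinAt) fun x hx => ?_
  rw [interior_Icc] at hx
  rw [(hf x).deriv]
  have := h0 x hx.1 hx.2
  linarith

/-- Here m is the maximum of 0 and the x_r, with m = 0 if the index set is empty; it is the
threshold needed for `climb`. -/
lemma exists_lowEnd_iff (s : Set (Fin 6)) (x : Fin 6 → ℝ) {c : ℝ} (hc : 0 < c)
    (hx : ∀ r ∈ s, x r < c) :
    ∃ m, 0 ≤ m ∧ m < c ∧ ∀ ζ, 0 ≤ ζ → (LowEnd s x ζ ↔ ζ ≤ m) := by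
  classical
  rcases s.eq_empty_or_nonempty with rfl | hs
  · exact ⟨0, le_rfl, hc, fun ζ h => by simp [LowEnd, le_antisymm_iff, h]⟩
  · obtain ⟨r, hr, hmax⟩ := s.toFinite.exists_maximalFor x s hs
    refine ⟨max 0 (x r), le_max_left _ _, max_lt hc (hx r hr), fun ζ h => ?_⟩
    rw [le_max_iff]
    constructor
    · rintro (rfl | ⟨k, hk, hle⟩)
      · exact Or.inl le_rfl
      · rcases le_total (x r) (x k) with h2 | h2
        · exact Or.inr (hle.trans (hmax hk h2))
        · exact Or.inr (hle.trans h2)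
    · rintro (h2 | h2)
      · exact Or.inl (le_antisymm h2 h)
      · exact Or.inr ⟨r, hr, h2⟩

/-! ### Sums over pairs -/

lemma two_mul_sum_pairs {g : Fin 6 → Fin 6 → ℝ} (hg : ∀ r s, g r s = g s r) :
    2 * ∑ rs ∈ pairs, g rs.1 rs.2 = ∑ r, ∑ s ∈ Finset.univ.erase r, g r s := by
  have h : ∀ r, ∑ s ∈ Finset.univ.erase r, g r s = ∑ s, g r s - g r r := fun r => by
    rw [← Finset.add_sum_erase _ _ (Finset.mem_univ r)]; ring
  simp only [h, sum_pairs, Fin.sum_univ_six]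
  rw [hg 1 0, hg 2 0, hg 3 0, hg 4 0, hg 5 0, hg 2 1, hg 3 1, hg 4 1, hg 5 1, hg 3 2, hg 4 2,
    hg 5 2, hg 4 3, hg 5 3, hg 5 4]
  ring

lemma sum_pairs_eq_zero {g : Fin 6 → Fin 6 → ℝ} (h : ∀ r s, r ≠ s → g r s = 0) :
    ∑ rs ∈ pairs, g rs.1 rs.2 = 0 := by
  refine Finset.sum_eq_zero fun rs hrs => h _ _ ?_
  exact ((Finset.mem_filter.1 hrs).2).ne

/-- Used on the cross polytope, where only pair sums involving a can leave [0, 1]. -/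
lemma sum_pairs_of_star {g : Fin 6 → Fin 6 → ℝ} (hg : ∀ r s, g r s = g s r) {a : Fin 6}
    (h : ∀ r s, r ≠ s → r ≠ a → s ≠ a → g r s = 0) :
    ∑ rs ∈ pairs, g rs.1 rs.2 = ∑ r ∈ Finset.univ.erase a, g a r := by
  have h1 := two_mul_sum_pairs hg
  rw [← Finset.add_sum_erase _ _ (Finset.mem_univ a)] at h1
  have h2 : ∑ r ∈ Finset.univ.erase a, ∑ s ∈ Finset.univ.erase r, g r s =
      ∑ r ∈ Finset.univ.erase a, g a r := by
    refine Finset.sum_congr rfl fun r hr => ?_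
    have hra := (Finset.mem_erase.1 hr).1
    rw [hg a r]
    refine Finset.sum_eq_single_of_mem a (by simp [hra.symm]) fun s hs hsa => ?_
    exact h r s (Finset.mem_erase.1 hs).1.symm hra hsa
  rw [h2] at h1
  linarith

/-- Used on the third simplex, where only the three pair sums outside T can leave [0, 1]. -/
lemma sum_pairs_of_triple {g : Fin 6 → Fin 6 → ℝ} (hg : ∀ r s, g r s = g s r) {i j k : Fin 6}
    (hij : i ≠ j) (hik : i ≠ k) (hjk : j ≠ k)
    (h : ∀ r s, r ≠ s → (r ≠ i ∧ r ≠ j ∧ r ≠ k) → g r s = 0) :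
    ∑ rs ∈ pairs, g rs.1 rs.2 = g i j + g i k + g j k := by
  have h1 := two_mul_sum_pairs hg
  have h2 : ∀ r, r ∉ ({i, j, k} : Finset (Fin 6)) →
      ∑ s ∈ Finset.univ.erase r, g r s = 0 := fun r hr =>
    Finset.sum_eq_zero fun s hs => h r s (Finset.mem_erase.1 hs).1.symm (by simpa using hr)
  rw [← Finset.sum_subset (Finset.subset_univ {i, j, k}) fun r _ hr => h2 r hr] at h1
  have h3 : ∀ r ∈ ({i, j, k} : Finset (Fin 6)), ∑ s ∈ Finset.univ.erase r, g r s =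
      ∑ s ∈ ({i, j, k} : Finset (Fin 6)).erase r, g r s := fun r _ => by
    refine (Finset.sum_subset (Finset.erase_subset_erase _ (Finset.subset_univ _)) ?_).symm
    intro s hs hs'
    have hsr := (Finset.mem_erase.1 hs).1
    rw [hg]
    exact h s r hsr (by simpa [hsr] using hs')
  rw [Finset.sum_congr rfl h3, Finset.sum_insert (by simp [hij, hik]),
    Finset.sum_pair hjk] at h1
  have e1 : ({i, j, k} : Finset (Fin 6)).erase i = {j, k} := by
    rw [Finset.erase_insert]; simp [hij, hik]
  have e2 : ({i, j, k} : Finset (Fin 6)).erase j = {i, k} := by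
    ext x; simp only [Finset.mem_erase, Finset.mem_insert, Finset.mem_singleton]; grind
  have e3 : ({i, j, k} : Finset (Fin 6)).erase k = {i, j} := by
    ext x; simp only [Finset.mem_erase, Finset.mem_insert, Finset.mem_singleton]; grind
  rw [e1, e2, e3, Finset.sum_pair hjk, Finset.sum_pair hik, Finset.sum_pair hij, hg j i, hg k i,
    hg k j] at h1
  linarith

/-! ### The first kind of simplices -/

lemma sum_erase_eq {b : Fin 6 → ℝ} (h : ∑ r, b r = 1) (r : Fin 6) :
    ∑ s ∈ Finset.univ.erase r, b s = 1 - b r := by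
  rw [← h, ← Finset.add_sum_erase _ _ (Finset.mem_univ r)]; ring

lemma card_erase (r : Fin 6) : ((Finset.univ.erase r).card : ℝ) = 5 := by
  rw [Finset.card_erase_of_mem (Finset.mem_univ r)]; simp

namespace ShapeOne

variable {b : Fin 6 → ℝ}

lemma add_le (h : ShapeOne b) {r s : Fin 6} (hrs : r ≠ s) : b r + b s ≤ 1 := by
  rw [← h.1, ← Finset.add_sum_erase _ _ (Finset.mem_univ r)]
  gcongr
  exact Finset.single_le_sum (f := b) (fun i _ => h.2 i) (by simp [hrs.symm])

lemma le_one (h : ShapeOne b) (r : Fin 6) : b r ≤ 1 := by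
  rw [← h.1]
  exact Finset.single_le_sum (f := b) (fun i _ => h.2 i) (Finset.mem_univ r)

lemma bounds (h : ShapeOne b) (r : Fin 6) : -(1 / 2) ≤ b r ∧ b r ≤ 1 :=
  ⟨by linarith [h.2 r], h.le_one r⟩

/-- A coordinate that large keeps all others at most ζ. The slope is then 4ζ + (1 - b_r - 5ζ) + (b_r
+ ζ - 1) = 0. -/
lemma slope_eq_zero (h : ShapeOne b) {ζ : ℝ} (h0 : 0 < ζ) (h1 : ζ < 1 / 2) {r : Fin 6}
    (hr : 1 - b r ≤ ζ) : slope b ζ = 0 := by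
  rw [slope, ← Finset.add_sum_erase _ _ (Finset.mem_univ r)]
  have h2 : ∀ s ∈ Finset.univ.erase r, -max 0 (ζ - b s) + max 0 (b s + ζ - 1) +
      max 0 (-b s - ζ) = b s - ζ := fun s hs => by
    have := h.add_le (Finset.mem_erase.1 hs).1
    have := h.2 s
    rw [max_eq_right (by linarith), max_eq_left (by linarith), max_eq_left (by linarith)]; ring
  rw [Finset.sum_congr rfl h2, Finset.sum_sub_distrib, sum_erase_eq h.1, Finset.sum_const,
    nsmul_eq_mul, card_erase, max_eq_left (by linarith), max_eq_right (by linarith),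
    max_eq_left (by linarith)]
  ring

/-- If at least two coordinates exceed ζ, at most four terms remain, each at least -ζ and strictly
more when the coordinates are positive. With exactly one such coordinate the slope is 1 - b_r - ζ,
with none it is 1 - 2ζ. -/
lemma slope_nonneg (h : ShapeOne b) {ζ : ℝ} (h0 : 0 < ζ) (h1 : ζ < 1 / 2)
    (hr : ∀ r, ζ < 1 - b r) : 0 ≤ slope b ζ ∧ ((∀ r, 0 < b r) → 0 < slope b ζ) := by
  have h2 : slope b ζ = 4 * ζ + ∑ s, -max 0 (ζ - b s) := by
    rw [slope]
    congr 1
    refine Finset.sum_congr rfl fun s _ => ?_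
    rw [max_eq_left (b := b s + ζ - 1) (by linarith [hr s]),
      max_eq_left (b := -b s - ζ) (by linarith [h.2 s])]
    ring
  rw [h2]
  by_cases hA : ∃ r, ζ < b r
  · obtain ⟨r, hr1⟩ := hA
    rw [← Finset.add_sum_erase _ _ (Finset.mem_univ r), max_eq_left (by linarith)]
    by_cases hB : ∃ s, s ≠ r ∧ ζ < b s
    · obtain ⟨s, hs, hs1⟩ := hB
      have hmem : s ∈ Finset.univ.erase r := by simp [hs]
      rw [← Finset.add_sum_erase _ _ hmem, max_eq_left (by linarith)]
      have hcard : (((Finset.univ.erase r).erase s).card : ℝ) = 4 := by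
        rw [Finset.card_erase_of_mem hmem, Finset.card_erase_of_mem (Finset.mem_univ r)]; simp
      have hsum : ∑ i ∈ (Finset.univ.erase r).erase s, -ζ = -(4 * ζ) := by
        rw [Finset.sum_const, nsmul_eq_mul, hcard]; ring
      constructor
      · have : ∑ i ∈ (Finset.univ.erase r).erase s, -ζ ≤
            ∑ i ∈ (Finset.univ.erase r).erase s, -max 0 (ζ - b i) :=
          Finset.sum_le_sum fun i _ => neg_le_neg (max_le h0.le (by linarith [h.2 i]))
        linarith
      · intro hpos
        have : ∑ i ∈ (Finset.univ.erase r).erase s, -ζ <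
            ∑ i ∈ (Finset.univ.erase r).erase s, -max 0 (ζ - b i) :=
          Finset.sum_lt_sum_of_nonempty
            (Finset.card_pos.1 (by have : (0 : ℝ) < _ := hcard ▸ four_pos; exact_mod_cast this))
            fun i _ => neg_lt_neg (max_lt h0 (by linarith [hpos i]))
        linarith
    · push Not at hB
      have : ∑ s ∈ Finset.univ.erase r, -max 0 (ζ - b s) =
          ∑ s ∈ Finset.univ.erase r, (b s - ζ) := Finset.sum_congr rfl fun s hs => by
        rw [max_eq_right (by linarith [hB s (Finset.mem_erase.1 hs).1])]; ring
      rw [this, Finset.sum_sub_distrib, sum_erase_eq h.1, Finset.sum_const, nsmul_eq_mul,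
        card_erase]
      have := hr r
      exact ⟨by linarith, fun _ => by linarith⟩
  · push Not at hA
    have : ∑ s, -max 0 (ζ - b s) = ∑ s, (b s - ζ) := Finset.sum_congr rfl fun s _ => by
      rw [max_eq_right (by linarith [hA s])]; ring
    rw [this, Finset.sum_sub_distrib, h.1, Finset.sum_const, nsmul_eq_mul]
    simp only [Finset.card_univ, Fintype.card_fin]
    norm_num
    exact ⟨by linarith, fun _ => by linarith⟩

lemma gamma_pairs (h : ShapeOne b) {r s : Fin 6} (hrs : r ≠ s) :
    gammaFst (b r + b s) = 0 ∧ gammaSnd (b r + b s) = 0 :=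
  gamma_eq_zero (add_nonneg (h.2 r) (h.2 s)) (h.add_le hrs)

lemma firstOrder_zero (h : ShapeOne b) : firstOrder b 0 = 0 := by
  rw [firstOrder_eq_localFirst h.1 h.bounds ⟨le_rfl, by norm_num⟩, localFirst,
    sum_pairs_eq_zero (g := fun r s => gammaFst (b r + b s)) fun r s hrs => (h.gamma_pairs hrs).1,
    Finset.sum_eq_zero]
  · norm_num
  · intro r _
    have := h.bounds r
    have := h.2 r
    rw [max_eq_left (by linarith), max_eq_left (by linarith), max_eq_left (by linarith)]
    norm_num

theorem monotoneOn (h : ShapeOne b) : MonotoneOn (firstOrder b) (Icc 0 (1 / 2)) := by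
  refine (monotoneOn_of_slope (hasDerivAt_localFirst b) fun x h0 h1 => ?_).congr
    fun x hx => (firstOrder_eq_localFirst h.1 h.bounds hx).symm
  by_cases hr : ∃ r, 1 - b r ≤ x
  · obtain ⟨r, hr⟩ := hr
    exact (h.slope_eq_zero h0 h1 hr).ge
  · push Not at hr
    exact (h.slope_nonneg h0 h1 hr).1

theorem levels (h : ShapeOne b) (hpos : ∀ r, 0 < b r) {ζ : ℝ} (hζ : ζ ∈ Icc (0 : ℝ) (1 / 2)) :
    (firstOrder b ζ = 0 ↔ ζ = 0) ∧
      (firstOrder b ζ = firstOrder b (1 / 2) ↔ HighEnd univ b ζ) := by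
  have hlt : ∀ r, b r < 1 := fun r => by
    have h1 := sum_erase_eq h.1 r
    have : 0 < ∑ s ∈ Finset.univ.erase r, b s :=
      Finset.sum_pos (fun s _ => hpos s) (Finset.card_pos.1 (by
        rw [Finset.card_erase_of_mem (Finset.mem_univ r)]; simp))
    linarith
  obtain ⟨m, hm0, hm1, hm⟩ := exists_lowEnd_iff univ (fun r => b r - 1 / 2) (c := 1 / 2)
    (by norm_num) fun r _ => by linarith [hlt r]
  have hd : ∀ x, HasDerivAt (fun x => -localFirst b (1 / 2 - x)) (2 * slope b (1 / 2 - x)) x := by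
    intro x
    have := ((hasDerivAt_localFirst b (1 / 2 - x)).comp x
      ((hasDerivAt_id x).const_sub (1 / 2))).neg
    exact this.congr_deriv (by ring)
  -- The constant stretch lies at the right end, so the function is reversed by ζ = 1/2 - x and
  -- negated, which puts the stretch next to 0.
  have key := climb (f := fun x => -localFirst b (1 / 2 - x)) (d := fun x => slope b (1 / 2 - x))
    (c := 1 / 2) hm0 hm1 hd (fun x h0 h1 => by
      rcases (hm x h0.le).2 h1.le with rfl | ⟨r, -, hr⟩
      · exact absurd h0 (lt_irrefl 0)
      · exact h.slope_eq_zero (r := r) (by linarith) (by linarith) (by linarith)) (fun x h0 h1 => by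
      refine (h.slope_nonneg (by linarith) (by linarith) fun r => ?_).2 hpos
      by_contra! hr
      have := (hm x (by linarith)).1 (Or.inr ⟨r, mem_univ r, by linarith⟩)
      linarith) (x := 1 / 2 - ζ) ⟨by linarith [hζ.2], by linarith [hζ.1]⟩
  simp only [sub_sub_cancel, sub_zero, neg_inj, sub_self] at key
  have h00 : firstOrder b ζ = 0 ↔ firstOrder b ζ = firstOrder b 0 := by rw [h.firstOrder_zero]
  rw [h00, firstOrder_eq_localFirst h.1 h.bounds hζ, firstOrder_eq_localFirst h.1 h.bounds
    ⟨by norm_num, le_rfl⟩, firstOrder_eq_localFirst h.1 h.bounds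
    ⟨le_rfl, by norm_num⟩, key.1, key.2, ← hm _ (by linarith [hζ.2])]
  constructor
  · constructor <;> intro h <;> linarith
  · unfold LowEnd HighEnd
    refine or_congr ⟨fun h => by linarith, fun h => by linarith⟩ (exists_congr fun r =>
      and_congr_right fun _ => ⟨fun h => by linarith, fun h => by linarith⟩)

theorem secondOrderVanishes (h : ShapeOne b) (ℓ : ℝ) : SecondOrderVanishes ℓ b 0 := by
  intro lam mu hl
  rw [secondOrder_eq_local h.1 h.bounds hl ⟨le_rfl, by norm_num⟩,
    sum_pairs_eq_zero (g := fun r s => (lam r + lam s - ℓ / 2) * gammaSnd (b r + b s))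
      fun r s hrs => by rw [(h.gamma_pairs hrs).2, mul_zero],
    Finset.sum_eq_zero]
  · ring
  · intro r _
    have := h.le_one r
    have := h.2 r
    rw [max_eq_left (by linarith), max_eq_left (by linarith), max_eq_left (by linarith)]
    ring

/-- Take all log|u_r| equal. Let Y and Z be the sums of the positive parts of ζ - b_r and of b_r + ζ
- 1. The test mu = 0 gives Y + Z = 3ζ and the coefficient of mu gives Y - Z = 4ζ. Since Z ≥ 0, this
forces ζ ≤ 0. -/
theorem eq_zero_of_secondOrderVanishes (h : ShapeOne b) {ℓ ζ : ℝ} (hℓ : ℓ ≠ 0)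
    (hζ : ζ ∈ Icc (0 : ℝ) (1 / 2)) (hv : SecondOrderVanishes ℓ b ζ) : ζ = 0 := by
  have key : ∀ lam : ℝ, ∀ mu : ℝ, 6 * lam = ℓ → (lam - ℓ / 2) * ∑ r, (max 0 (ζ - b r) +
      max 0 (b r + ζ - 1)) + mu * ∑ r, (max 0 (ζ - b r) - max 0 (b r + ζ - 1)) -
      (2 * mu - ℓ / 2) * (2 * ζ) = 0 := by
    intro lam mu hl
    have hl' : ∑ _r : Fin 6, lam = ℓ := by simp [hl]
    refine Eq.trans ?_ (hv (fun _ => lam) mu hl')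
    rw [secondOrder_eq_local h.1 h.bounds hl' hζ,
      sum_pairs_eq_zero (g := fun r s => (lam + lam - ℓ / 2) * gammaSnd (b r + b s))
      fun r s hrs => by rw [(h.gamma_pairs hrs).2, mul_zero], sub_zero, Finset.mul_sum,
      Finset.mul_sum, ← Finset.sum_add_distrib]
    congr 1
    refine Finset.sum_congr rfl fun r _ => ?_
    rw [max_eq_left (b := -b r - ζ) (by linarith [h.2 r, hζ.1])]
    ring
  have k0 := key (ℓ / 6) 0 (by ring)
  have k1 := key (ℓ / 6) 1 (by ring)
  have h1 : ∑ r, (max 0 (ζ - b r) + max 0 (b r + ζ - 1)) = 3 * ζ := by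
    have : ℓ * (∑ r, (max 0 (ζ - b r) + max 0 (b r + ζ - 1)) - 3 * ζ) = 0 := by linarith
    have := (mul_eq_zero.1 this).resolve_left hℓ
    linarith
  have h2 : ∑ r, (max 0 (ζ - b r) - max 0 (b r + ζ - 1)) ≤
      ∑ r, (max 0 (ζ - b r) + max 0 (b r + ζ - 1)) :=
    Finset.sum_le_sum fun r _ => by linarith [le_max_left 0 (b r + ζ - 1)]
  linarith [hζ.1]

end ShapeOne

/-! ### The cross polytopes -/

/-- The sum of the negative parts of the numbers `b_r + b_a`. -/
noncomputable def negMass (a : Fin 6) (b : Fin 6 → ℝ) : ℝ :=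
  ∑ r ∈ Finset.univ.erase a, max 0 (-(b r + b a))

lemma sum_erase_add {b : Fin 6 → ℝ} (h : ∑ r, b r = 1) (a : Fin 6) :
    ∑ r ∈ Finset.univ.erase a, (b r + b a) = 1 + 4 * b a := by
  rw [Finset.sum_add_distrib, sum_erase_eq h, Finset.sum_const, nsmul_eq_mul, card_erase]; ring

lemma sum_abs_eq {b : Fin 6 → ℝ} (h : ∑ r, b r = 1) (a : Fin 6) :
    ∑ r ∈ Finset.univ.erase a, |b r + b a| = 1 + 4 * b a + 2 * negMass a b := by
  rw [negMass, Finset.mul_sum, ← sum_erase_add h, ← Finset.sum_add_distrib]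
  refine Finset.sum_congr rfl fun r _ => ?_
  rcases le_total 0 (b r + b a) with h | h
  · rw [abs_of_nonneg h, max_eq_left (by linarith)]; ring
  · rw [abs_of_nonpos h, max_eq_right (by linarith)]; ring

/-- The reflection of the cross polytope that exchanges the two ends of the `ζ`-interval. -/
noncomputable def reflectTwo (a : Fin 6) (b : Fin 6 → ℝ) : Fin 6 → ℝ := -b + (rho - e a)

/-- The central symmetry b → ρ - e_a - b is a lattice translation of the negation: the translation
turns ζ into ζ - 1/2 and the negation gives the sign. Each statement on [0, -b_a] thus yields one on
[-b_a, 1/2]. -/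
lemma firstOrder_reflectTwo (a : Fin 6) (b : Fin 6 → ℝ) (ζ : ℝ) :
    firstOrder (reflectTwo a b) ζ = -firstOrder b (1 / 2 - ζ) := by
  rw [reflectTwo, firstOrder_add (s := 1 / 2) (fun r => if r = a then -1 else 0) 1 (fun r => ?_)
    (by norm_num), firstOrder_neg_left, ← firstOrder_neg_right, neg_sub]
  simp only [Pi.sub_apply, rho, e_apply]
  split_ifs <;> norm_num

lemma secondOrderVanishes_reflectTwo (a : Fin 6) (b : Fin 6 → ℝ) (ℓ ζ : ℝ) :
    SecondOrderVanishes ℓ (reflectTwo a b) ζ ↔ SecondOrderVanishes ℓ b (1 / 2 - ζ) := by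
  rw [← secondOrderVanishes_neg_right ℓ b, neg_sub, ← secondOrderVanishes_neg_left ℓ b]
  have : ∀ r, (rho - e a) r = ((if r = a then -1 else 0 : ℤ) : ℝ) + 1 / 2 := fun r => by
    simp only [Pi.sub_apply, rho, e_apply]
    split_ifs <;> norm_num
  simp only [SecondOrderVanishes, reflectTwo,
    secondOrder_add (s := 1 / 2) (fun r => if r = a then -1 else 0) 1 this (by norm_num)]

namespace ShapeTwo

variable {a : Fin 6} {b : Fin 6 → ℝ}

/-- On the hyperplane the ℓ¹ inequality is equivalent to this one. It controls the estimates on the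
left part of the ζ-interval. -/
lemma negMass_le (h : ShapeTwo a b) : negMass a b ≤ 2 * -b a := by
  have := h.2
  rw [sum_abs_eq h.1] at this
  linarith

lemma le_negMass {r : Fin 6} (hr : r ≠ a) : -(b r + b a) ≤ negMass a b :=
  (le_max_right 0 _).trans (Finset.single_le_sum (f := fun r => max 0 (-(b r + b a)))
    (fun _ _ => le_max_left _ _) (by simp [hr]))

lemma add_le_negMass {r s : Fin 6} (hr : r ≠ a) (hs : s ≠ a) (hrs : r ≠ s) :
    max 0 (-(b r + b a)) + max 0 (-(b s + b a)) ≤ negMass a b := by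
  have hmem : r ∈ Finset.univ.erase a := by simp [hr]
  rw [negMass, ← Finset.add_sum_erase _ _ hmem]
  gcongr
  exact Finset.single_le_sum (f := fun r => max 0 (-(b r + b a))) (fun _ _ => le_max_left _ _)
    (by simp [hs, hrs.symm])

lemma negMass_nonneg : 0 ≤ negMass a b := Finset.sum_nonneg fun _ _ => le_max_left _ _

lemma reflect (h : ShapeTwo a b) : ShapeTwo a (reflectTwo a b) := by
  have h1 : ∀ r, reflectTwo a b r = -b r + (1 / 2 - if r = a then 1 else 0) := fun r => by
    simp [reflectTwo, rho, e_apply]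
  refine ⟨?_, le_trans (Finset.sum_le_sum fun r hr => ?_) h.2⟩
  · simp only [h1, Finset.sum_add_distrib, Finset.sum_sub_distrib, Finset.sum_neg_distrib, h.1]
    simp
    norm_num
  · rw [h1, h1, if_neg (Finset.mem_erase.1 hr).1, if_pos rfl, ← abs_neg]
    exact le_of_eq (congrArg _ (by ring))

lemma reflect_apply_self : reflectTwo a b a = -b a - 1 / 2 := by
  simp [reflectTwo, rho, e_apply]; ring

lemma reflect_apply {r : Fin 6} (hr : r ≠ a) : reflectTwo a b r = 1 / 2 - b r := by
  simp [reflectTwo, rho, e_apply, hr]; ring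

lemma mem (h : ShapeTwo a b) : -b a ∈ Icc (0 : ℝ) (1 / 2) := by
  have h1 := h.negMass_le
  have h2 := h.reflect.negMass_le
  rw [reflect_apply_self] at h2
  have h3 := negMass_nonneg (a := a) (b := b)
  have h4 := negMass_nonneg (a := a) (b := reflectTwo a b)
  exact ⟨by linarith, by linarith⟩

lemma neg_le (h : ShapeTwo a b) {r : Fin 6} (hr : r ≠ a) : b a ≤ b r := by
  linarith [h.negMass_le, le_negMass (b := b) hr]

lemma le_add_one (h : ShapeTwo a b) {r : Fin 6} (hr : r ≠ a) : b r ≤ 1 + b a := by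
  have := h.reflect.neg_le hr
  rw [reflect_apply_self, reflect_apply hr] at this
  linarith

lemma bounds (h : ShapeTwo a b) (r : Fin 6) : -(1 / 2) ≤ b r ∧ b r ≤ 1 := by
  have := h.mem.1
  have := h.mem.2
  rcases eq_or_ne r a with rfl | hr
  · constructor <;> linarith
  · have := h.neg_le hr
    have := h.le_add_one hr
    constructor <;> linarith

lemma add_nonneg (h : ShapeTwo a b) {r s : Fin 6} (hr : r ≠ a) (hs : s ≠ a) (hrs : r ≠ s) :
    0 ≤ b r + b s := by
  linarith [h.negMass_le, add_le_negMass (b := b) hr hs hrs, le_max_right 0 (-(b r + b a)),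
    le_max_right 0 (-(b s + b a))]

lemma gamma_pairs (h : ShapeTwo a b) {r s : Fin 6} (hrs : r ≠ s) (hr : r ≠ a) (hs : s ≠ a) :
    gammaFst (b r + b s) = 0 ∧ gammaSnd (b r + b s) = 0 := by
  have := h.reflect.add_nonneg hr hs hrs
  rw [reflect_apply hr, reflect_apply hs] at this
  exact gamma_eq_zero (h.add_nonneg hr hs hrs) (by linarith)

lemma gamma_star (h : ShapeTwo a b) {r : Fin 6} (hr : r ≠ a) :
    gammaFst (b a + b r) = -max 0 (-(b r + b a)) ^ 2 ∧
      gammaSnd (b a + b r) = max 0 (-(b r + b a)) := by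
  have := h.neg_le hr
  have := h.le_add_one hr
  have := h.mem.1
  have := h.mem.2
  rw [add_comm]
  exact gamma_of_le_one (by linarith) (by linarith)

lemma slope_eq_sum (h : ShapeTwo a b) {ζ : ℝ} (h0 : 0 < ζ) (h1 : ζ < -b a) :
    slope b ζ = 2 * ζ + ∑ r ∈ Finset.univ.erase a, (-max 0 (ζ - b r) + max 0 (-b r - ζ)) := by
  have := h.mem.2
  rw [slope, ← Finset.add_sum_erase _ _ (Finset.mem_univ a), max_eq_right (by linarith),
    max_eq_left (by linarith), max_eq_right (by linarith)]
  have : ∀ r ∈ Finset.univ.erase a, -max 0 (ζ - b r) + max 0 (b r + ζ - 1) + max 0 (-b r - ζ) =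
      -max 0 (ζ - b r) + max 0 (-b r - ζ) := fun r hr => by
    rw [max_eq_left (b := b r + ζ - 1) (by linarith [h.le_add_one (Finset.mem_erase.1 hr).1]),
      add_zero]
  rw [Finset.sum_congr rfl this]
  ring

/-- The r-th term equals -2ζ and cancels the leading 2ζ. For the other s the bound on the negative
mass gives b_s ≥ -b_r ≥ ζ, so their terms vanish. -/
lemma slope_eq_zero (h : ShapeTwo a b) {ζ : ℝ} (h0 : 0 < ζ) (h1 : ζ < -b a) {r : Fin 6}
    (hr : r ≠ a) (hζ : ζ ≤ -b r) : slope b ζ = 0 := by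
  rw [h.slope_eq_sum h0 h1, Finset.sum_eq_single_of_mem r (by simp [hr]), max_eq_right (by linarith),
    max_eq_right (by linarith)]
  · ring
  · intro s hs hsr
    have := add_le_negMass (b := b) hr (Finset.mem_erase.1 hs).1 hsr.symm
    have := h.negMass_le
    have := le_max_right 0 (-(b r + b a))
    have := le_max_right 0 (-(b s + b a))
    rw [max_eq_left (by linarith), max_eq_left (by linarith)]
    ring

/-- Only coordinates below ζ count. If there are none or one, the slope is 2ζ or ζ + b_r. If there
are two or more, the slope is at least the slack -2b_a - `negMass a b`. -/
lemma slope_nonneg (h : ShapeTwo a b) {ζ : ℝ} (h0 : 0 < ζ) (h1 : ζ < -b a)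
    (hζ : ∀ r, r ≠ a → -b r < ζ) :
    0 ≤ slope b ζ ∧ (negMass a b < 2 * -b a → 0 < slope b ζ) := by
  have h2 : slope b ζ = 2 * ζ - ∑ r ∈ Finset.univ.erase a, max 0 (ζ - b r) := by
    rw [h.slope_eq_sum h0 h1, sub_eq_add_neg, ← Finset.sum_neg_distrib]
    congr 1
    refine Finset.sum_congr rfl fun r hr => ?_
    rw [max_eq_left (b := -b r - ζ) (by linarith [hζ r (Finset.mem_erase.1 hr).1]), add_zero]
  rw [h2]
  by_cases hA : ∃ r, r ≠ a ∧ b r < ζ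
  · obtain ⟨r, hr, hr1⟩ := hA
    have hmem : r ∈ Finset.univ.erase a := by simp [hr]
    rw [← Finset.add_sum_erase _ _ hmem, max_eq_right (by linarith)]
    by_cases hB : ∃ s, s ≠ a ∧ s ≠ r ∧ b s < ζ
    · obtain ⟨s, hs, hsr, hs1⟩ := hB
      have hmem' : s ∈ (Finset.univ.erase a).erase r := by simp [hs, hsr]
      -- Two of the terms are kept exactly, as their 2ζ cancels the leading term; in the others ζ is
      -- replaced by its upper bound -b_a.
      have h3 : ∑ i ∈ ((Finset.univ.erase a).erase r).erase s, max 0 (ζ - b i) ≤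
          ∑ i ∈ ((Finset.univ.erase a).erase r).erase s, max 0 (-(b i + b a)) :=
        Finset.sum_le_sum fun i _ => max_le_max le_rfl (by linarith)
      rw [← Finset.add_sum_erase _ _ hmem', max_eq_right (by linarith)]
      have := h.negMass_le
      have := le_max_right 0 (-(b r + b a))
      have := le_max_right 0 (-(b s + b a))
      have : negMass a b = max 0 (-(b r + b a)) + (max 0 (-(b s + b a)) +
        ∑ i ∈ ((Finset.univ.erase a).erase r).erase s, max 0 (-(b i + b a))) := by
        rw [negMass, ← Finset.add_sum_erase _ _ hmem, ← Finset.add_sum_erase _ _ hmem']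
      exact ⟨by linarith, fun _ => by linarith⟩
    · push Not at hB
      rw [Finset.sum_eq_zero fun s hs => ?_]
      · have := hζ r hr
        exact ⟨by linarith, fun _ => by linarith⟩
      · simp only [Finset.mem_erase] at hs
        rw [max_eq_left (by linarith [hB s hs.2.1 hs.1])]
  · push Not at hA
    rw [Finset.sum_eq_zero fun s hs => ?_]
    · exact ⟨by linarith, fun _ => by linarith⟩
    · rw [max_eq_left (by linarith [hA s (Finset.mem_erase.1 hs).1])]

/-- At ζ = -b_a the term of index a cancels 4ζ², and the term of each other r cancels the pair (a,
r). -/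
lemma firstOrder_eq_zero (h : ShapeTwo a b) : firstOrder b (-b a) = 0 := by
  have h0 := h.mem.1
  have h1 := h.mem.2
  rw [firstOrder_eq_localFirst h.1 h.bounds h.mem, localFirst,
    sum_pairs_of_star (g := fun r s => gammaFst (b r + b s)) (fun r s => by rw [add_comm])
      fun r s hrs hr hs => (h.gamma_pairs hrs hr hs).1,
    ← Finset.add_sum_erase _ _ (Finset.mem_univ a), max_eq_right (by linarith),
    max_eq_left (by linarith), max_eq_left (by linarith)]
  have : ∀ r ∈ Finset.univ.erase a, -max 0 (-b a - b r) ^ 2 + max 0 (b r + -b a - 1) ^ 2 -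
      max 0 (-b r - -b a) ^ 2 = gammaFst (b a + b r) := fun r hr => by
    have hr := (Finset.mem_erase.1 hr).1
    rw [(h.gamma_star hr).1, max_eq_left (b := b r + -b a - 1) (by linarith [h.le_add_one hr]),
      max_eq_left (b := -b r - -b a) (by linarith [h.neg_le hr]), neg_add']
    ring_nf
  rw [Finset.sum_congr rfl this]
  ring

lemma monotoneOn_left (h : ShapeTwo a b) : MonotoneOn (firstOrder b) (Icc 0 (-b a)) := by
  refine (monotoneOn_of_slope (hasDerivAt_localFirst b) fun x h0 h1 => ?_).congr
    fun x hx => (firstOrder_eq_localFirst h.1 h.bounds ⟨hx.1, hx.2.trans h.mem.2⟩).symm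
  by_cases hr : ∃ r, r ≠ a ∧ x ≤ -b r
  · obtain ⟨r, hr, hr1⟩ := hr
    exact (h.slope_eq_zero h0 h1 hr hr1).ge
  · push Not at hr
    exact (h.slope_nonneg h0 h1 hr).1

theorem monotoneOn (h : ShapeTwo a b) : MonotoneOn (firstOrder b) (Icc 0 (1 / 2)) := by
  have h2 : MonotoneOn (firstOrder b) (Icc (-b a) (1 / 2)) := by
    intro x hx y hy hxy
    have hm : ∀ t ∈ Icc (-b a) (1 / 2), 1 / 2 - t ∈ Icc 0 (-reflectTwo a b a) := fun t ht =>
      ⟨by linarith [ht.2], by rw [reflect_apply_self]; linarith [ht.1]⟩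
    have := h.reflect.monotoneOn_left (hm y hy) (hm x hx) (by linarith)
    simp only [firstOrder_reflectTwo, sub_sub_cancel] at this
    linarith
  rw [← Icc_union_Icc_eq_Icc h.mem.1 h.mem.2]
  exact h.monotoneOn_left.union_right h2 (isGreatest_Icc h.mem.1) (isLeast_Icc h.mem.2)

lemma levels_left (h : ShapeTwo a b) (hs : negMass a b < 2 * -b a) :
    0 < -b a ∧ (∀ r, r ≠ a → -b r < -b a) ∧ ∀ ζ ∈ Icc 0 (-b a),
    (firstOrder b ζ = 0 ↔ ζ = -b a) ∧
      (firstOrder b ζ = firstOrder b 0 ↔ LowEnd {r | r ≠ a} (-b) ζ) := by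
  have hc : 0 < -b a := by linarith [negMass_nonneg (a := a) (b := b)]
  have hlt : ∀ r, r ≠ a → -b r < -b a := fun r hr => by linarith [le_negMass (b := b) hr]
  refine ⟨hc, hlt, fun ζ hζ => ?_⟩
  obtain ⟨m, hm0, hm1, hm⟩ := exists_lowEnd_iff {r | r ≠ a} (-b) hc fun r hr => hlt r hr
  have key := climb hm0 hm1 (hasDerivAt_localFirst b) (fun x h0 h1 => by
      rcases (hm x h0.le).2 h1.le with rfl | ⟨r, hr, hle⟩
      · exact absurd h0 (lt_irrefl 0)
      · exact h.slope_eq_zero h0 (h1.trans hm1) hr hle) (fun x h0 h1 => by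
      refine (h.slope_nonneg (by linarith) h1 fun r hr => ?_).2 hs
      by_contra! hle
      have := (hm x (by linarith)).1 (Or.inr ⟨r, hr, hle⟩)
      linarith) hζ
  have h00 : firstOrder b ζ = 0 ↔ firstOrder b ζ = firstOrder b (-b a) := by
    rw [h.firstOrder_eq_zero]
  rw [h00, firstOrder_eq_localFirst h.1 h.bounds ⟨hζ.1, hζ.2.trans h.mem.2⟩,
    firstOrder_eq_localFirst h.1 h.bounds h.mem, firstOrder_eq_localFirst h.1 h.bounds
    ⟨le_rfl, by norm_num⟩, key.1, key.2, hm _ hζ.1]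
  exact ⟨Iff.rfl, Iff.rfl⟩

lemma negMass_reflect (h : ShapeTwo a b) (hs : negMass a b < 2 * -b a) :
    negMass a (reflectTwo a b) < 2 * -reflectTwo a b a := by
  have h1 := sum_abs_eq h.reflect.1 a
  have h2 := sum_abs_eq h.1 a
  have h3 : ∑ r ∈ Finset.univ.erase a, |reflectTwo a b r + reflectTwo a b a| =
      ∑ r ∈ Finset.univ.erase a, |b r + b a| := Finset.sum_congr rfl fun r hr => by
    rw [reflect_apply (Finset.mem_erase.1 hr).1, reflect_apply_self, ← abs_neg]
    exact congrArg _ (by ring)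
  linarith

theorem levels (h : ShapeTwo a b) (hs : negMass a b < 2 * -b a) {ζ : ℝ}
    (hζ : ζ ∈ Icc (0 : ℝ) (1 / 2)) :
    (firstOrder b ζ = 0 ↔ ζ = -b a) ∧
      (firstOrder b ζ = firstOrder b 0 ↔ LowEnd {r | r ≠ a} (-b) ζ) ∧
      (firstOrder b ζ = firstOrder b (1 / 2) ↔ HighEnd univ b ζ) := by
  obtain ⟨c0, l0, k0⟩ := h.levels_left hs
  obtain ⟨c1, l1, k1⟩ := h.reflect.levels_left (h.negMass_reflect hs)
  rw [reflect_apply_self] at c1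
  simp only [reflect_apply_self, firstOrder_reflectTwo, neg_inj, neg_eq_zero, sub_zero] at k1
  have e0 : firstOrder b 0 < 0 := by
    refine lt_of_le_of_ne ?_ fun h0 => ?_
    · have := h.monotoneOn ⟨le_rfl, by norm_num⟩ h.mem c0.le
      rwa [h.firstOrder_eq_zero] at this
    · have := (k0 0 ⟨le_rfl, c0.le⟩).1.1 h0
      linarith
  have e1 : 0 < firstOrder b (1 / 2) := by
    refine lt_of_le_of_ne ?_ fun h0 => ?_
    · rw [← h.firstOrder_eq_zero]
      exact h.monotoneOn h.mem ⟨by norm_num, le_rfl⟩ h.mem.2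
    · have := (k1 0 ⟨le_rfl, by linarith⟩).1.1 (by rw [sub_zero, ← h0])
      linarith
  have low : LowEnd {r | r ≠ a} (-b) ζ → ζ < -b a := by
    rintro (rfl | ⟨r, hr, hle⟩)
    · exact c0
    · exact lt_of_le_of_lt hle (l0 r hr)
  have high : HighEnd univ b ζ ↔ LowEnd {r | r ≠ a} (-reflectTwo a b) (1 / 2 - ζ) := by
    refine or_congr ⟨fun h => by linarith, fun h => by linarith⟩ ⟨?_, ?_⟩
    · rintro ⟨r, -, hr⟩
      rcases eq_or_ne r a with rfl | hra
      · exact absurd hζ.2 (by linarith)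
      · refine ⟨r, hra, ?_⟩
        rw [Pi.neg_apply, reflect_apply hra]; linarith
    · rintro ⟨r, hra, hr⟩
      rw [Pi.neg_apply, reflect_apply hra] at hr
      exact ⟨r, mem_univ r, by linarith⟩
  have high' : HighEnd univ b ζ → -b a < ζ := by
    rw [high]
    rintro (h0 | ⟨r, hr, hle⟩)
    · linarith
    · have := lt_of_le_of_lt hle (l1 r hr)
      rw [reflect_apply_self] at this
      linarith
  rcases le_total ζ (-b a) with h1 | h1
  · have hF : firstOrder b ζ ≤ 0 := by
      rw [← h.firstOrder_eq_zero]; exact h.monotoneOn hζ h.mem h1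
    refine ⟨(k0 ζ ⟨hζ.1, h1⟩).1, (k0 ζ ⟨hζ.1, h1⟩).2, fun h2 => ?_, fun h2 => ?_⟩
    · linarith
    · linarith [high' h2]
  · have hF : 0 ≤ firstOrder b ζ := by
      rw [← h.firstOrder_eq_zero]; exact h.monotoneOn h.mem hζ h1
    have := k1 (1 / 2 - ζ) ⟨by linarith [hζ.2], by linarith⟩
    rw [sub_sub_cancel] at this
    refine ⟨?_, ⟨fun h2 => by linarith, fun h2 => by linarith [low h2]⟩, ?_⟩
    · rw [this.1]
      constructor <;> intro h <;> linarith
    · rw [high]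
      exact this.2

lemma secondOrder_formula (h : ShapeTwo a b) {ℓ : ℝ} {lam : Fin 6 → ℝ} (hl : ∑ r, lam r = ℓ)
    {ζ : ℝ} (hζ : ζ ∈ Icc 0 (-b a)) (mu : ℝ) : secondOrder ℓ b ζ lam mu =
      (lam a + mu - ℓ / 2) * (ζ - b a) + (lam a - mu - ℓ / 2) * (-b a - ζ) +
      ∑ r ∈ Finset.univ.erase a, ((lam r + mu - ℓ / 2) * max 0 (ζ - b r) +
        (lam r - mu - ℓ / 2) * max 0 (-b r - ζ)) - (2 * mu - ℓ / 2) * (2 * ζ) -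
      ∑ r ∈ Finset.univ.erase a, (lam a + lam r - ℓ / 2) * max 0 (-(b r + b a)) := by
  have h0 := h.mem.1
  have h1 := h.mem.2
  obtain ⟨h2, h3⟩ := hζ
  rw [secondOrder_eq_local h.1 h.bounds hl ⟨h2, h3.trans h1⟩,
    sum_pairs_of_star (g := fun r s => (lam r + lam s - ℓ / 2) * gammaSnd (b r + b s))
      (fun r s => by rw [add_comm (lam r), add_comm (b r)])
      (fun r s hrs hr hs => by rw [(h.gamma_pairs hrs hr hs).2, mul_zero]),
    ← Finset.add_sum_erase _ _ (Finset.mem_univ a), max_eq_right (by linarith),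
    max_eq_left (by linarith), max_eq_right (by linarith), zero_add]
  congr 1
  · congr 2
    refine Finset.sum_congr rfl fun r hr => ?_
    rw [max_eq_left (b := b r + ζ - 1) (by linarith [h.le_add_one (Finset.mem_erase.1 hr).1]),
      zero_add]
  · refine Finset.sum_congr rfl fun r hr => ?_
    rw [(h.gamma_star (Finset.mem_erase.1 hr).1).2]

/-- At ζ = -b_a the integrand terms and the pairs with a have the same positive parts -(b_r + b_a)
and differ only by the factor mu - lam_a, so all other log|u_r| drop out. -/
theorem secondOrder_neg_apply (h : ShapeTwo a b) {ℓ : ℝ} {lam : Fin 6 → ℝ}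
    (hl : ∑ r, lam r = ℓ) (mu : ℝ) :
    secondOrder ℓ b (-b a) lam mu = (2 * -b a - negMass a b) * (lam a - mu) := by
  rw [h.secondOrder_formula hl ⟨h.mem.1, le_rfl⟩]
  have : ∑ r ∈ Finset.univ.erase a, ((lam r + mu - ℓ / 2) * max 0 (-b a - b r) +
      (lam r - mu - ℓ / 2) * max 0 (-b r - -b a)) =
      ∑ r ∈ Finset.univ.erase a, (lam a + lam r - ℓ / 2) * max 0 (-(b r + b a)) +
      (mu - lam a) * negMass a b := by
    rw [negMass, Finset.mul_sum, ← Finset.sum_add_distrib]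
    refine Finset.sum_congr rfl fun r hr => ?_
    rw [max_eq_left (b := -b r - -b a) (by linarith [h.neg_le (Finset.mem_erase.1 hr).1]),
      show -b a - b r = -(b r + b a) by ring]
    ring
  rw [this]
  ring

/-- Put the whole ℓ at index a, then spread it equally over the other five indices, with mu = 0 in
both tests. Eliminating the common sum gives 16(-b_a) = 4ζ + 6 `negMass a b`, and the bound on the
negative mass turns this into ζ ≥ -b_a. -/
lemma not_secondOrderVanishes (h : ShapeTwo a b) {ℓ ζ : ℝ} (hℓ : ℓ ≠ 0) (h0 : 0 ≤ ζ)
    (h1 : ζ < -b a) : ¬SecondOrderVanishes ℓ b ζ := by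
  intro hv
  have key : ∀ x y : ℝ, x + 5 * y = ℓ → (x - ℓ / 2) * (2 * -b a) +
      (y - ℓ / 2) * ∑ r ∈ Finset.univ.erase a, (max 0 (ζ - b r) + max 0 (-b r - ζ)) + ℓ * ζ -
      (x + y - ℓ / 2) * negMass a b = 0 := by
    intro x y hxy
    have hl : ∑ r, (if r = a then x else y) = ℓ := by
      rw [← Finset.add_sum_erase _ _ (Finset.mem_univ a), if_pos rfl, Finset.sum_congr rfl
        fun r hr => if_neg (Finset.mem_erase.1 hr).1, Finset.sum_const, nsmul_eq_mul, card_erase,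
        hxy]
    refine Eq.trans ?_ (hv _ 0 hl)
    have e0 : ∑ r ∈ Finset.univ.erase a, (((if r = a then x else y) + 0 - ℓ / 2) * max 0 (ζ - b r) +
        ((if r = a then x else y) - 0 - ℓ / 2) * max 0 (-b r - ζ)) = (y - ℓ / 2) *
          ∑ r ∈ Finset.univ.erase a, (max 0 (ζ - b r) + max 0 (-b r - ζ)) := by
      rw [Finset.mul_sum]
      refine Finset.sum_congr rfl fun r hr => ?_
      rw [if_neg (Finset.mem_erase.1 hr).1]; ring
    have e1 : ∑ r ∈ Finset.univ.erase a, (x + (if r = a then x else y) - ℓ / 2) *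
        max 0 (-(b r + b a)) = (x + y - ℓ / 2) * negMass a b := by
      rw [negMass, Finset.mul_sum]
      refine Finset.sum_congr rfl fun r hr => ?_
      rw [if_neg (Finset.mem_erase.1 hr).1]
    rw [h.secondOrder_formula hl ⟨h0, h1.le⟩, e0, if_pos rfl, e1]
    ring
  have k0 := key ℓ 0 (by ring)
  have k1 := key 0 (ℓ / 5) (by ring)
  generalize ∑ r ∈ Finset.univ.erase a, (max 0 (ζ - b r) + max 0 (-b r - ζ)) = X at k0 k1
  have e0 : X = 2 * -b a + 2 * ζ - negMass a b := by
    have : ℓ * (X - (2 * -b a + 2 * ζ - negMass a b)) = 0 := by linarith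
    linarith [(mul_eq_zero.1 this).resolve_left hℓ]
  have e1 : 3 * X = -10 * -b a + 10 * ζ + 3 * negMass a b := by
    have : ℓ * (3 * X - (-10 * -b a + 10 * ζ + 3 * negMass a b)) = 0 := by linarith
    linarith [(mul_eq_zero.1 this).resolve_left hℓ]
  linarith [h.negMass_le]

theorem eq_of_secondOrderVanishes (h : ShapeTwo a b) {ℓ ζ : ℝ} (hℓ : ℓ ≠ 0)
    (hζ : ζ ∈ Icc (0 : ℝ) (1 / 2)) (hv : SecondOrderVanishes ℓ b ζ) : ζ = -b a := by
  rcases lt_trichotomy ζ (-b a) with h1 | h1 | h1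
  · exact absurd hv (h.not_secondOrderVanishes hℓ hζ.1 h1)
  · exact h1
  · refine absurd ?_ (h.reflect.not_secondOrderVanishes (ζ := 1 / 2 - ζ) hℓ (by linarith [hζ.2])
      (by rw [reflect_apply_self]; linarith))
    rwa [secondOrderVanishes_reflectTwo, sub_sub_cancel]

theorem secondOrderVanishes_iff (h : ShapeTwo a b) (ℓ : ℝ) :
    SecondOrderVanishes ℓ b (-b a) ↔ 2 * -b a - negMass a b = 0 := by
  constructor
  · intro hv
    have hl : ∑ _r : Fin 6, ℓ / 6 = ℓ := by simp; ring
    -- This choice makes lam_a - mu equal to 1.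
    have h1 := hv (fun _ => ℓ / 6) (ℓ / 6 - 1) hl
    rw [h.secondOrder_neg_apply hl] at h1
    linarith
  · intro h0 lam mu hl
    rw [h.secondOrder_neg_apply hl, h0, zero_mul]

end ShapeTwo

/-! ### The third kind of simplices -/

/-- The correct value of `ζ` on the third kind of simplices. -/
noncomputable def offset (T : Finset (Fin 6)) (b : Fin 6 → ℝ) : ℝ := ∑ r ∈ T, b r - 1

/-- The translation that exchanges the roles of `T` and its complement. -/
noncomputable def shiftThree (T : Finset (Fin 6)) (b : Fin 6 → ℝ) : Fin 6 → ℝ :=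
  b + fun r => if r ∈ T then -(1 / 2) else 1 / 2

lemma exists_int_shiftThree (T : Finset (Fin 6)) (r : Fin 6) :
    (if r ∈ T then -(1 / 2) else 1 / 2 : ℝ) = ((if r ∈ T then -1 else 0 : ℤ) : ℝ) + 1 / 2 := by
  split_ifs <;> norm_num

/-- Translation by ρ minus the indicator of T turns the simplex of T into that of the complement and
ζ into 1/2 - ζ. Unlike on the cross polytope the sign is kept, so F has a minimum in between rather
than being monotone. -/
lemma firstOrder_shiftThree (T : Finset (Fin 6)) (b : Fin 6 → ℝ) (ζ : ℝ) :
    firstOrder (shiftThree T b) ζ = firstOrder b (1 / 2 - ζ) := by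
  rw [shiftThree, firstOrder_add _ 1 (exists_int_shiftThree T) (by norm_num),
    ← firstOrder_neg_right, neg_sub]

lemma secondOrderVanishes_shiftThree (T : Finset (Fin 6)) (b : Fin 6 → ℝ) (ℓ ζ : ℝ) :
    SecondOrderVanishes ℓ (shiftThree T b) ζ ↔ SecondOrderVanishes ℓ b (1 / 2 - ζ) := by
  rw [← secondOrderVanishes_neg_right ℓ b, neg_sub]
  simp only [SecondOrderVanishes, shiftThree,
    secondOrder_add _ 1 (exists_int_shiftThree T) (by norm_num)]

lemma exists_triple {T : Finset (Fin 6)} (hT : T.card = 3) {r : Fin 6} (hr : r ∉ T) :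
    ∃ s t, s ∉ T ∧ t ∉ T ∧ r ≠ s ∧ r ≠ t ∧ s ≠ t ∧ Tᶜ = {r, s, t} ∧
      ∀ f : Fin 6 → ℝ, ∑ x ∈ Tᶜ, f x = f r + f s + f t := by
  obtain ⟨s, t, hs, ht, hst, hsr, htr, h⟩ := compl_eq_of_card hT hr
  have e : Tᶜ = {r, s, t} := by
    ext x
    simp only [Finset.mem_compl, Finset.mem_insert, Finset.mem_singleton]
    exact ⟨h x, by rintro (rfl | rfl | rfl) <;> assumption⟩
  refine ⟨s, t, hs, ht, hsr.symm, htr.symm, hst, e, fun f => ?_⟩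
  rw [e, Finset.sum_insert (by simp [hsr.symm, htr.symm]), Finset.sum_pair hst, add_assoc]

namespace ShapeThree

variable {T : Finset (Fin 6)} {b : Fin 6 → ℝ}

lemma card_compl (hT : T.card = 3) : Tᶜ.card = 3 := by
  rw [Finset.card_compl, hT]; rfl

lemma exists_notMem (hT : T.card = 3) : ∃ r, r ∉ T := by
  obtain ⟨r, hr⟩ := Finset.card_pos.1 (by rw [card_compl hT]; norm_num : 0 < Tᶜ.card)
  exact ⟨r, Finset.mem_compl.1 hr⟩

lemma sum_compl (h : ShapeThree T b) : ∑ r ∈ Tᶜ, b r = -offset T b := by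
  have := Finset.sum_add_sum_compl T b
  rw [h.1] at this
  rw [offset]; linarith

lemma le_of_mem (h : ShapeThree T b) {r : Fin 6} (hr : r ∈ T) : offset T b ≤ b r := by
  have := h.2.1 r hr
  rw [offset]; linarith

lemma neg_le_of_notMem (h : ShapeThree T b) {r : Fin 6} (hr : r ∉ T) : -offset T b ≤ b r := by
  have := h.2.2 r hr
  rw [offset]; linarith

lemma offset_shiftThree (h : ShapeThree T b) (hT : T.card = 3) :
    offset Tᶜ (shiftThree T b) = 1 / 2 - offset T b := by
  have : ∑ r ∈ Tᶜ, shiftThree T b r = ∑ r ∈ Tᶜ, (b r + 1 / 2) :=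
    Finset.sum_congr rfl fun r hr => by simp [shiftThree, Finset.mem_compl.1 hr]
  rw [offset, this, Finset.sum_add_distrib, h.sum_compl, Finset.sum_const, card_compl hT]
  norm_num
  ring

lemma shift (h : ShapeThree T b) (hT : T.card = 3) : ShapeThree Tᶜ (shiftThree T b) := by
  have hc := h.offset_shiftThree hT
  rw [offset] at hc
  refine ⟨?_, fun r hr => ?_, fun r hr => ?_⟩
  · rw [← Finset.sum_add_sum_compl T]
    have e1 : ∑ r ∈ T, shiftThree T b r = ∑ r ∈ T, (b r - 1 / 2) :=
      Finset.sum_congr rfl fun r hr => by simp [shiftThree, hr]; ring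
    rw [e1, Finset.sum_sub_distrib, Finset.sum_const, hT, nsmul_eq_mul]
    have : offset T b = ∑ r ∈ T, b r - 1 := rfl
    push_cast
    linarith
  · rw [hc]
    have := h.neg_le_of_notMem (Finset.mem_compl.1 hr)
    simp only [shiftThree, Pi.add_apply, if_neg (Finset.mem_compl.1 hr)]
    linarith
  · rw [hc]
    have hr' : r ∈ T := by simpa using hr
    have := h.le_of_mem hr'
    simp only [shiftThree, Pi.add_apply, if_pos hr']
    linarith

lemma offset_nonneg (h : ShapeThree T b) (hT : T.card = 3) : 0 ≤ offset T b := by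
  obtain ⟨i, hi⟩ := exists_notMem hT
  obtain ⟨j, k, hj, hk, -, -, -, -, hf⟩ := exists_triple hT hi
  have := h.sum_compl
  rw [hf] at this
  linarith [h.neg_le_of_notMem hi, h.neg_le_of_notMem hj, h.neg_le_of_notMem hk]

lemma mem (h : ShapeThree T b) (hT : T.card = 3) : offset T b ∈ Icc (0 : ℝ) (1 / 2) := by
  have := (h.shift hT).offset_nonneg (card_compl hT)
  rw [h.offset_shiftThree hT] at this
  exact ⟨h.offset_nonneg hT, by linarith⟩

/-- The three coordinates outside T add up to -`offset T b`, and the third one is at least that. -/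
lemma add_le_zero (h : ShapeThree T b) (hT : T.card = 3) {r s : Fin 6} (hr : r ∉ T) (hs : s ∉ T)
    (hrs : r ≠ s) : b r + b s ≤ 0 := by
  obtain ⟨j, k, hj, hk, hrj, hrk, hjk, he, hf⟩ := exists_triple hT hr
  have h1 := h.sum_compl
  rw [hf] at h1
  have h2 : s ∈ Tᶜ := Finset.mem_compl.2 hs
  rw [he] at h2
  simp only [Finset.mem_insert, Finset.mem_singleton] at h2
  rcases h2 with rfl | rfl | rfl
  · exact absurd rfl hrs
  · linarith [h.neg_le_of_notMem hk]
  · linarith [h.neg_le_of_notMem hj]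

lemma le_of_notMem (h : ShapeThree T b) (hT : T.card = 3) {r : Fin 6} (hr : r ∉ T) :
    b r ≤ offset T b := by
  obtain ⟨j, k, hj, hk, -, -, -, -, hf⟩ := exists_triple hT hr
  have := h.sum_compl
  rw [hf] at this
  linarith [h.neg_le_of_notMem hj, h.neg_le_of_notMem hk]

lemma shift_of_mem {r : Fin 6} (hr : r ∈ T) : shiftThree T b r = b r - 1 / 2 := by
  simp [shiftThree, hr]; ring

lemma le_of_mem' (h : ShapeThree T b) (hT : T.card = 3) {r : Fin 6} (hr : r ∈ T) :
    b r ≤ 1 - offset T b := by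
  have := (h.shift hT).le_of_notMem (card_compl hT) (r := r) (by simpa using hr)
  rw [h.offset_shiftThree hT, shift_of_mem hr] at this
  linarith

lemma bounds (h : ShapeThree T b) (hT : T.card = 3) (r : Fin 6) : -(1 / 2) ≤ b r ∧ b r ≤ 1 := by
  have := (h.mem hT).1
  have := (h.mem hT).2
  by_cases hr : r ∈ T
  · have := h.le_of_mem hr
    have := h.le_of_mem' hT hr
    constructor <;> linarith
  · have := h.neg_le_of_notMem hr
    have := h.le_of_notMem hT hr
    constructor <;> linarith

lemma gamma_pairs (h : ShapeThree T b) (hT : T.card = 3) {r s : Fin 6} (hrs : r ≠ s)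
    (hr : r ∈ T) : gammaFst (b r + b s) = 0 ∧ gammaSnd (b r + b s) = 0 := by
  have h1 := (h.mem hT).1
  have h2 := h.le_of_mem hr
  have h3 := h.le_of_mem' hT hr
  by_cases hs : s ∈ T
  · have := (h.shift hT).add_le_zero (card_compl hT) (r := r) (s := s) (by simpa using hr)
      (by simpa using hs) hrs
    rw [shift_of_mem hr, shift_of_mem hs] at this
    have := h.le_of_mem hs
    exact gamma_eq_zero (by linarith) (by linarith)
  · have := h.le_of_notMem hT hs
    have := h.neg_le_of_notMem hs
    exact gamma_eq_zero (by linarith) (by linarith)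

lemma gamma_compl (h : ShapeThree T b) (hT : T.card = 3) {i j k : Fin 6} (hi : i ∉ T) (hj : j ∉ T)
    (hij : i ≠ j) (hsum : b i + b j + b k = -offset T b) :
    gammaFst (b i + b j) = -(offset T b + b k) ^ 2 ∧
      gammaSnd (b i + b j) = offset T b + b k := by
  have h1 := h.add_le_zero hT hi hj hij
  have h2 := (h.mem hT).2
  have := h.neg_le_of_notMem hi
  have := h.neg_le_of_notMem hj
  have e : offset T b + b k = -(b i + b j) := by linarith
  rw [(gamma_of_le_one (a := b i + b j) (by linarith) (by linarith)).1,
    (gamma_of_le_one (a := b i + b j) (by linarith) (by linarith)).2, max_eq_right (by linarith), e]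
  exact ⟨rfl, rfl⟩

lemma slope_eq_sum (h : ShapeThree T b) (hT : T.card = 3) {ζ : ℝ} (h0 : 0 < ζ)
    (h1 : ζ < offset T b) :
    slope b ζ = 4 * ζ + ∑ r ∈ Tᶜ, (-max 0 (ζ - b r) + max 0 (-b r - ζ)) := by
  have h2 := (h.mem hT).2
  rw [slope, ← Finset.sum_add_sum_compl T, Finset.sum_eq_zero fun r hr => ?_, zero_add]
  · congr 1
    refine Finset.sum_congr rfl fun r hr => ?_
    have := h.le_of_notMem hT (Finset.mem_compl.1 hr)
    rw [max_eq_left (b := b r + ζ - 1) (by linarith), add_zero]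
  · have := h.le_of_mem hr
    have := h.le_of_mem' hT hr
    rw [max_eq_left (by linarith), max_eq_left (by linarith), max_eq_left (by linarith)]
    ring

/-- The pair sums outside T are nonpositive, so the other two coordinates outside T are at most -ζ.
Each contributes -2ζ, cancelling 4ζ. -/
lemma slope_eq_zero (h : ShapeThree T b) (hT : T.card = 3) {ζ : ℝ} (h0 : 0 < ζ)
    (h1 : ζ < offset T b) {r : Fin 6} (hr : r ∉ T) (hζ : ζ ≤ b r) : slope b ζ = 0 := by
  obtain ⟨j, k, hj, hk, hrj, hrk, -, -, hf⟩ := exists_triple hT hr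
  have := h.add_le_zero hT hr hj hrj
  have := h.add_le_zero hT hr hk hrk
  rw [h.slope_eq_sum hT h0 h1, hf, max_eq_left (by linarith), max_eq_left (by linarith),
    max_eq_right (by linarith), max_eq_right (by linarith), max_eq_right (by linarith),
    max_eq_right (by linarith)]
  ring

/-- Let c be the offset. The slope is ζ - c plus the positive parts of -b_r - ζ outside T. According
to whether none, one, two or three of these are active it equals ζ - c, -c - b_i, b_k - ζ (with k
the inactive index), or -2ζ. Only the second can vanish, and not in the interior. -/
lemma slope_nonpos (h : ShapeThree T b) (hT : T.card = 3) {ζ : ℝ} (h0 : 0 < ζ)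
    (h1 : ζ < offset T b) (hζ : ∀ r, r ∉ T → b r < ζ) :
    slope b ζ ≤ 0 ∧ ((∀ r, r ∉ T → -offset T b < b r) → slope b ζ < 0) := by
  obtain ⟨i, hi⟩ := exists_notMem hT
  obtain ⟨j, k, hj, hk, -, -, -, -, hf⟩ := exists_triple hT hi
  have hsum := h.sum_compl
  rw [hf] at hsum
  have hi1 := hζ i hi
  have hj1 := hζ j hj
  have hk1 := hζ k hk
  have hi2 := h.neg_le_of_notMem hi
  have hj2 := h.neg_le_of_notMem hj
  have hk2 := h.neg_le_of_notMem hk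
  rw [h.slope_eq_sum hT h0 h1, hf, max_eq_right (b := ζ - b i) (by linarith),
    max_eq_right (b := ζ - b j) (by linarith), max_eq_right (b := ζ - b k) (by linarith)]
  constructor
  · rcases max_cases 0 (-b i - ζ) with ⟨e1, _⟩ | ⟨e1, _⟩ <;>
    rcases max_cases 0 (-b j - ζ) with ⟨e2, _⟩ | ⟨e2, _⟩ <;>
    rcases max_cases 0 (-b k - ζ) with ⟨e3, _⟩ | ⟨e3, _⟩ <;> rw [e1, e2, e3] <;> linarith
  · intro hs
    have hi3 := hs i hi
    have hj3 := hs j hj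
    have hk3 := hs k hk
    rcases max_cases 0 (-b i - ζ) with ⟨e1, _⟩ | ⟨e1, _⟩ <;>
    rcases max_cases 0 (-b j - ζ) with ⟨e2, _⟩ | ⟨e2, _⟩ <;>
    rcases max_cases 0 (-b k - ζ) with ⟨e3, _⟩ | ⟨e3, _⟩ <;> rw [e1, e2, e3] <;> linarith

lemma firstOrder_eq_zero (h : ShapeThree T b) (hT : T.card = 3) :
    firstOrder b (offset T b) = 0 := by
  have hc := h.mem hT
  obtain ⟨i, hi⟩ := exists_notMem hT
  obtain ⟨j, k, hj, hk, hij, hik, hjk, he, hf⟩ := exists_triple hT hi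
  have hsum := h.sum_compl
  rw [hf] at hsum
  have hmem : ∀ r, (r ≠ i ∧ r ≠ j ∧ r ≠ k) → r ∈ T := fun r hr => by
    by_contra hrT
    have : r ∈ Tᶜ := Finset.mem_compl.2 hrT
    rw [he] at this
    simp only [Finset.mem_insert, Finset.mem_singleton] at this
    grind
  rw [firstOrder_eq_localFirst h.1 (h.bounds hT) hc, localFirst,
    sum_pairs_of_triple (g := fun r s => gammaFst (b r + b s)) (fun r s => by rw [add_comm])
      hij hik hjk fun r s hrs hr => (h.gamma_pairs hT hrs (hmem r hr)).1,
    (h.gamma_compl hT hi hj hij hsum).1, (h.gamma_compl hT hi hk hik (k := j) (by linarith)).1,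
    (h.gamma_compl hT hj hk hjk (k := i) (by linarith)).1,
    ← Finset.sum_add_sum_compl T, Finset.sum_eq_zero fun r hr => ?_,
    Finset.sum_congr (g := fun r => -(offset T b - b r) ^ 2) rfl fun r hr => ?_, hf]
  -- With c the offset, 4c² plus the sum of (c + b_r)² - (c - b_r)² over r ∉ T is 4c² + 4c times the
  -- sum of the b_r, hence 0.
  · linear_combination (4 * offset T b) * hsum
  · have hr := Finset.mem_compl.1 hr
    have := h.neg_le_of_notMem hr
    have := h.le_of_notMem hT hr
    rw [max_eq_right (by linarith), max_eq_left (by linarith [hc.2]), max_eq_left (by linarith)]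
    ring
  · have := h.le_of_mem hr
    have := h.le_of_mem' hT hr
    have := hc.1
    rw [max_eq_left (by linarith), max_eq_left (by linarith), max_eq_left (by linarith)]
    norm_num

lemma hasDerivAt_neg_localFirst (b : Fin 6 → ℝ) (x : ℝ) :
    HasDerivAt (fun x => -localFirst b x) (2 * -slope b x) x :=
  (hasDerivAt_localFirst b x).neg.congr_deriv (by ring)

lemma antitoneOn (h : ShapeThree T b) (hT : T.card = 3) :
    AntitoneOn (firstOrder b) (Icc 0 (offset T b)) := by
  have h1 := monotoneOn_of_slope (c := offset T b) (hasDerivAt_neg_localFirst b) fun x h0 h1 => by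
    by_cases hr : ∃ r, r ∉ T ∧ x ≤ b r
    · obtain ⟨r, hr, hr1⟩ := hr
      rw [h.slope_eq_zero hT h0 h1 hr hr1, neg_zero]
    · push Not at hr
      exact neg_nonneg.2 (h.slope_nonpos hT h0 h1 hr).1
  intro x hx y hy hxy
  have := h1 hx hy hxy
  rw [firstOrder_eq_localFirst h.1 (h.bounds hT) ⟨hx.1, hx.2.trans (h.mem hT).2⟩,
    firstOrder_eq_localFirst h.1 (h.bounds hT) ⟨hy.1, hy.2.trans (h.mem hT).2⟩]
  linarith

lemma monotoneOn (h : ShapeThree T b) (hT : T.card = 3) :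
    MonotoneOn (firstOrder b) (Icc (offset T b) (1 / 2)) := by
  intro x hx y hy hxy
  have hm : ∀ t ∈ Icc (offset T b) (1 / 2), 1 / 2 - t ∈ Icc 0 (offset Tᶜ (shiftThree T b)) :=
    fun t ht => ⟨by linarith [ht.2], by rw [h.offset_shiftThree hT]; linarith [ht.1]⟩
  have := (h.shift hT).antitoneOn (card_compl hT) (hm y hy) (hm x hx) (by linarith)
  simpa only [firstOrder_shiftThree, sub_sub_cancel] using this

theorem firstOrder_nonneg (h : ShapeThree T b) (hT : T.card = 3) {ζ : ℝ}
    (hζ : ζ ∈ Icc (0 : ℝ) (1 / 2)) : 0 ≤ firstOrder b ζ := by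
  rw [← h.firstOrder_eq_zero hT]
  rcases le_total ζ (offset T b) with h1 | h1
  · exact h.antitoneOn hT ⟨hζ.1, h1⟩ ⟨(h.mem hT).1, le_rfl⟩ h1
  · exact h.monotoneOn hT ⟨le_rfl, (h.mem hT).2⟩ ⟨h1, hζ.2⟩ h1

theorem firstOrder_le (h : ShapeThree T b) (hT : T.card = 3) {ζ : ℝ}
    (hζ : ζ ∈ Icc (0 : ℝ) (1 / 2)) :
    firstOrder b ζ ≤ firstOrder b 0 ∧ ζ ≤ offset T b ∨
      firstOrder b ζ ≤ firstOrder b (1 / 2) ∧ offset T b ≤ ζ := by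
  rcases le_total ζ (offset T b) with h1 | h1
  · exact Or.inl ⟨h.antitoneOn hT ⟨le_rfl, (h.mem hT).1⟩ ⟨hζ.1, h1⟩ hζ.1, h1⟩
  · exact Or.inr ⟨h.monotoneOn hT ⟨h1, hζ.2⟩ ⟨(h.mem hT).2, le_rfl⟩ hζ.2, h1⟩

lemma levels_left (h : ShapeThree T b) (hT : T.card = 3)
    (hs : ∀ r, r ∉ T → -offset T b < b r) :
    0 < offset T b ∧ (∀ r, r ∉ T → b r < offset T b) ∧ ∀ ζ ∈ Icc 0 (offset T b),
      (firstOrder b ζ = 0 ↔ ζ = offset T b) ∧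
      (firstOrder b ζ = firstOrder b 0 ↔ LowEnd {r | r ∉ T} b ζ) := by
  have hlt : ∀ r, r ∉ T → b r < offset T b := fun r hr => by
    obtain ⟨j, k, hj, hk, -, -, -, -, hf⟩ := exists_triple hT hr
    have := h.sum_compl
    rw [hf] at this
    linarith [hs j hj, hs k hk]
  have hc : 0 < offset T b := by
    obtain ⟨i, hi⟩ := exists_notMem hT
    linarith [hs i hi, hlt i hi]
  refine ⟨hc, hlt, fun ζ hζ => ?_⟩
  obtain ⟨m, hm0, hm1, hm⟩ := exists_lowEnd_iff {r | r ∉ T} b hc fun r hr => hlt r hr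
  have key := climb hm0 hm1 (hasDerivAt_neg_localFirst b) (fun x h0 h1 => by
      rcases (hm x h0.le).2 h1.le with rfl | ⟨r, hr, hle⟩
      · exact absurd h0 (lt_irrefl 0)
      · rw [h.slope_eq_zero hT h0 (h1.trans hm1) hr hle, neg_zero]) (fun x h0 h1 => by
      refine neg_pos.2 ((h.slope_nonpos hT (by linarith) h1 fun r hr => ?_).2 hs)
      by_contra! hle
      have := (hm x (by linarith)).1 (Or.inr ⟨r, hr, hle⟩)
      linarith) hζ
  have h00 : firstOrder b ζ = 0 ↔ firstOrder b ζ = firstOrder b (offset T b) := by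
    rw [h.firstOrder_eq_zero hT]
  simp only [neg_inj] at key
  rw [h00, firstOrder_eq_localFirst h.1 (h.bounds hT) ⟨hζ.1, hζ.2.trans (h.mem hT).2⟩,
    firstOrder_eq_localFirst h.1 (h.bounds hT) (h.mem hT), firstOrder_eq_localFirst h.1
    (h.bounds hT) ⟨le_rfl, by norm_num⟩, key.1, key.2, hm _ hζ.1]
  exact ⟨Iff.rfl, Iff.rfl⟩

theorem levels (h : ShapeThree T b) (hT : T.card = 3) (hs : ∀ r, r ∉ T → -offset T b < b r)
    (hs' : ∀ r, r ∈ T → offset T b < b r) {ζ : ℝ} (hζ : ζ ∈ Icc (0 : ℝ) (1 / 2)) :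
    (firstOrder b ζ = 0 ↔ ζ = offset T b) ∧
      ((LowEnd {r | r ∉ T} b ζ ∧ ζ ≤ offset T b) ↔
        firstOrder b ζ = firstOrder b 0 ∧ ζ ≤ offset T b) ∧
      ((HighEnd {r | r ∈ T} b ζ ∧ offset T b ≤ ζ) ↔
        firstOrder b ζ = firstOrder b (1 / 2) ∧ offset T b ≤ ζ) ∧
      (LowEnd {r | r ∉ T} b ζ → ζ ≤ offset T b) ∧
      (HighEnd {r | r ∈ T} b ζ → offset T b ≤ ζ) := by
  obtain ⟨c0, l0, k0⟩ := h.levels_left hT hs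
  have hsh := h.offset_shiftThree hT
  obtain ⟨c1, l1, k1⟩ := (h.shift hT).levels_left (card_compl hT) (fun r hr => by
    have hr : r ∈ T := by simpa using hr
    rw [hsh, shift_of_mem hr]
    linarith [hs' r hr])
  rw [hsh] at c1
  simp only [firstOrder_shiftThree, sub_zero, hsh] at k1 l1
  have high : HighEnd {r | r ∈ T} b ζ ↔ LowEnd {r | r ∉ Tᶜ} (shiftThree T b) (1 / 2 - ζ) := by
    refine or_congr ⟨fun h => by linarith, fun h => by linarith⟩ (exists_congr fun r => ?_)
    simp only [mem_ofPred_eq, Finset.mem_compl, not_not]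
    refine and_congr_right fun hr => ?_
    rw [shift_of_mem hr]
    exact ⟨fun h => by linarith, fun h => by linarith⟩
  have hk1 : offset T b ≤ ζ → (firstOrder b ζ = 0 ↔ ζ = offset T b) ∧
      (firstOrder b ζ = firstOrder b (1 / 2) ↔ HighEnd {r | r ∈ T} b ζ) := fun h1 => by
    have := k1 (1 / 2 - ζ) ⟨by linarith [hζ.2], by linarith⟩
    rw [sub_sub_cancel] at this
    rw [high, this.1]
    exact ⟨⟨fun h => by linarith, fun h => by linarith⟩, this.2⟩
  refine ⟨?_, ⟨fun h2 => ⟨(k0 ζ ⟨hζ.1, h2.2⟩).2.2 h2.1, h2.2⟩,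
    fun h2 => ⟨(k0 ζ ⟨hζ.1, h2.2⟩).2.1 h2.1, h2.2⟩⟩, ⟨fun h2 => ⟨(hk1 h2.2).2.2 h2.1, h2.2⟩,
    fun h2 => ⟨(hk1 h2.2).2.1 h2.1, h2.2⟩⟩, ?_, ?_⟩
  · rcases le_total ζ (offset T b) with h1 | h1
    · exact (k0 ζ ⟨hζ.1, h1⟩).1
    · exact (hk1 h1).1
  · rintro (rfl | ⟨r, hr, hle⟩)
    · exact c0.le
    · exact hle.trans (l0 r hr).le
  · rw [high]
    rintro (h0 | ⟨r, hr, hle⟩)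
    · linarith
    · linarith [l1 r hr]

lemma secondOrder_formula (h : ShapeThree T b) (hT : T.card = 3) {i j k : Fin 6} (hi : i ∉ T)
    (hj : j ∉ T) (hk : k ∉ T) (hij : i ≠ j) (hik : i ≠ k) (hjk : j ≠ k) (he : Tᶜ = {i, j, k})
    {ℓ : ℝ} {lam : Fin 6 → ℝ} (hl : ∑ r, lam r = ℓ) {ζ : ℝ} (hζ : ζ ∈ Icc 0 (offset T b))
    (mu : ℝ) : secondOrder ℓ b ζ lam mu =
      ∑ r ∈ Tᶜ, ((lam r + mu - ℓ / 2) * max 0 (ζ - b r) +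
        (lam r - mu - ℓ / 2) * max 0 (-b r - ζ)) - (2 * mu - ℓ / 2) * (2 * ζ) -
      ((lam i + lam j - ℓ / 2) * (offset T b + b k) + (lam i + lam k - ℓ / 2) * (offset T b + b j) +
        (lam j + lam k - ℓ / 2) * (offset T b + b i)) := by
  have hc := h.mem hT
  obtain ⟨h2, h3⟩ := hζ
  have hsum := h.sum_compl
  rw [he, Finset.sum_insert (by simp [hij, hik]), Finset.sum_pair hjk] at hsum
  have hmem : ∀ r, (r ≠ i ∧ r ≠ j ∧ r ≠ k) → r ∈ T := fun r hr => by
    by_contra hrT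
    have : r ∈ Tᶜ := Finset.mem_compl.2 hrT
    rw [he] at this
    simp only [Finset.mem_insert, Finset.mem_singleton] at this
    grind
  rw [secondOrder_eq_local h.1 (h.bounds hT) hl ⟨h2, h3.trans hc.2⟩,
    sum_pairs_of_triple (g := fun r s => (lam r + lam s - ℓ / 2) * gammaSnd (b r + b s))
      (fun r s => by rw [add_comm (lam r), add_comm (b r)]) hij hik hjk
      fun r s hrs hr => by rw [(h.gamma_pairs hT hrs (hmem r hr)).2, mul_zero],
    (h.gamma_compl hT hi hj hij (k := k) (by linarith)).2,
    (h.gamma_compl hT hi hk hik (k := j) (by linarith)).2,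
    (h.gamma_compl hT hj hk hjk (k := i) (by linarith)).2,
    ← Finset.sum_add_sum_compl T, Finset.sum_eq_zero fun r hr => ?_, zero_add]
  · congr 2
    refine Finset.sum_congr rfl fun r hr => ?_
    have := h.le_of_notMem hT (Finset.mem_compl.1 hr)
    rw [max_eq_left (b := b r + ζ - 1) (by linarith [hc.2]), zero_add]
  · have := h.le_of_mem hr
    have := h.le_of_mem' hT hr
    rw [max_eq_left (by linarith), max_eq_left (by linarith), max_eq_left (by linarith)]
    ring

theorem secondOrderVanishes (h : ShapeThree T b) (hT : T.card = 3) (ℓ : ℝ) :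
    SecondOrderVanishes ℓ b (offset T b) := by
  intro lam mu hl
  obtain ⟨i, hi⟩ := exists_notMem hT
  obtain ⟨j, k, hj, hk, hij, hik, hjk, he, hf⟩ := exists_triple hT hi
  have hsum := h.sum_compl
  rw [hf] at hsum
  rw [h.secondOrder_formula hT hi hj hk hij hik hjk he hl ⟨(h.mem hT).1, le_rfl⟩,
    Finset.sum_congr (g := fun r => (lam r + mu - ℓ / 2) * (offset T b - b r)) rfl fun r hr => ?_,
    hf]
  · linear_combination (-(lam i) - lam j - lam k - mu + ℓ) * hsum
  · have hr := Finset.mem_compl.1 hr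
    have := h.neg_le_of_notMem hr
    have := h.le_of_notMem hT hr
    rw [max_eq_right (by linarith), max_eq_left (by linarith)]
    ring

/-- Spread ℓ equally over T, then over its complement, with mu = 0. The common sum X satisfies X =
2ζ + 2c and X = 6ζ - 2c, where c is the offset; hence ζ = c. -/
lemma not_secondOrderVanishes (h : ShapeThree T b) (hT : T.card = 3) {ℓ ζ : ℝ} (hℓ : ℓ ≠ 0)
    (h0 : 0 ≤ ζ) (h1 : ζ < offset T b) : ¬SecondOrderVanishes ℓ b ζ := by
  intro hv
  obtain ⟨i, hi⟩ := exists_notMem hT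
  obtain ⟨j, k, hj, hk, hij, hik, hjk, he, hf⟩ := exists_triple hT hi
  have hsum := h.sum_compl
  rw [hf] at hsum
  have key : ∀ x y : ℝ, 3 * x + 3 * y = ℓ →
      (y - ℓ / 2) * ∑ r ∈ Tᶜ, (max 0 (ζ - b r) + max 0 (-b r - ζ)) + ℓ * ζ -
      (2 * y - ℓ / 2) * (2 * offset T b) = 0 := by
    intro x y hxy
    have hl : ∑ r, (if r ∈ T then x else y) = ℓ := by
      rw [← Finset.sum_add_sum_compl T, Finset.sum_congr rfl fun r hr => if_pos hr,
        Finset.sum_congr (s₁ := Tᶜ) rfl fun r hr => if_neg (Finset.mem_compl.1 hr),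
        Finset.sum_const, Finset.sum_const, hT, card_compl hT, ← hxy]
      simp
    refine Eq.trans ?_ (hv _ 0 hl)
    have e0 : ∑ r ∈ Tᶜ, (((if r ∈ T then x else y) + 0 - ℓ / 2) * max 0 (ζ - b r) +
        ((if r ∈ T then x else y) - 0 - ℓ / 2) * max 0 (-b r - ζ)) = (y - ℓ / 2) *
          ∑ r ∈ Tᶜ, (max 0 (ζ - b r) + max 0 (-b r - ζ)) := by
      rw [Finset.mul_sum]
      refine Finset.sum_congr rfl fun r hr => ?_
      rw [if_neg (Finset.mem_compl.1 hr)]; ring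
    rw [h.secondOrder_formula hT hi hj hk hij hik hjk he hl ⟨h0, h1.le⟩, e0, if_neg hi, if_neg hj,
      if_neg hk]
    linear_combination (2 * y - ℓ / 2) * hsum
  have k0 := key (ℓ / 3) 0 (by ring)
  have k1 := key 0 (ℓ / 3) (by ring)
  have e : ℓ * (ζ - offset T b) = 0 := by linarith
  linarith [(mul_eq_zero.1 e).resolve_left hℓ]

theorem eq_of_secondOrderVanishes (h : ShapeThree T b) (hT : T.card = 3) {ℓ ζ : ℝ} (hℓ : ℓ ≠ 0)
    (hζ : ζ ∈ Icc (0 : ℝ) (1 / 2)) (hv : SecondOrderVanishes ℓ b ζ) : ζ = offset T b := by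
  rcases lt_trichotomy ζ (offset T b) with h1 | h1 | h1
  · exact absurd hv (h.not_secondOrderVanishes hT hℓ hζ.1 h1)
  · exact h1
  · refine absurd ?_ ((h.shift hT).not_secondOrderVanishes (card_compl hT) (ζ := 1 / 2 - ζ) hℓ
      (by linarith [hζ.2]) (by rw [h.offset_shiftThree hT]; linarith))
    rwa [secondOrderVanishes_shiftThree, sub_sub_cancel]

end ShapeThree

/-! ### Extrema over a half period -/

lemma equivalent_swapHalf (β : Fin 6 → ℝ) {x y : ℝ} (h : Equivalent x y) :
    Equivalent (swapHalf β x) (swapHalf β y) := by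
  unfold swapHalf
  split_ifs
  · exact h
  · obtain ⟨n, rfl | rfl⟩ := h
    · exact ⟨-n, Or.inl (by push_cast; ring)⟩
    · exact ⟨1 - n, Or.inr (by push_cast; ring)⟩

lemma equivalent_swapHalf_iff (β : Fin 6 → ℝ) {x y : ℝ} :
    Equivalent (swapHalf β x) (swapHalf β y) ↔ Equivalent x y :=
  ⟨fun h => by simpa only [swapHalf_swapHalf] using equivalent_swapHalf β h, equivalent_swapHalf β⟩

/-- `y` is a maximum of `g` over half a period. -/
def HalfMax (g : ℝ → ℝ) (y : ℝ) : Prop := ∀ x ∈ Icc (0 : ℝ) (1 / 2), g x ≤ g y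

/-- `y` is a minimum of `g` over half a period. -/
def HalfMin (g : ℝ → ℝ) (y : ℝ) : Prop := ∀ x ∈ Icc (0 : ℝ) (1 / 2), g y ≤ g x

lemma isMaxOn_firstOrder (α : Fin 6 → ℝ) (ζ : ℝ) :
    IsMaxOn (firstOrder α) univ ζ ↔ HalfMax (firstOrder α) ζ := by
  refine ⟨fun h x _ => h (mem_univ x), fun h x _ => ?_⟩
  obtain ⟨y, hy, he⟩ := exists_equivalent x
  show firstOrder α x ≤ firstOrder α ζ
  rw [he.firstOrder_eq]
  exact h y hy

lemma isMinOn_firstOrder (α : Fin 6 → ℝ) (ζ : ℝ) :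
    IsMinOn (firstOrder α) univ ζ ↔ HalfMin (firstOrder α) ζ := by
  refine ⟨fun h x _ => h (mem_univ x), fun h x _ => ?_⟩
  obtain ⟨y, hy, he⟩ := exists_equivalent x
  show firstOrder α ζ ≤ firstOrder α x
  rw [he.firstOrder_eq]
  exact h y hy

lemma forall_swapHalf (β : Fin 6 → ℝ) {P : ℝ → Prop} :
    (∀ x ∈ Icc (0 : ℝ) (1 / 2), P (swapHalf β x)) ↔ ∀ x ∈ Icc (0 : ℝ) (1 / 2), P x :=
  ⟨fun h x hx => by simpa only [swapHalf_swapHalf] using h _ (swapHalf_mem (β := β) hx),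
    fun h x hx => h _ (swapHalf_mem hx)⟩

namespace Tile

lemma isMaxOn_of_sign_eq_one {t : Tile} (ht : t.Admissible) (hs : t.sign = 1) (α : Fin 6 → ℝ)
    (ζ : ℝ) : (IsMaxOn (firstOrder α) univ ζ ↔
      HalfMax (firstOrder (t.localize α)) (swapHalf t.origin ζ)) ∧
    (IsMinOn (firstOrder α) univ ζ ↔
      HalfMin (firstOrder (t.localize α)) (swapHalf t.origin ζ)) := by
  rw [isMaxOn_firstOrder, isMinOn_firstOrder]
  simp only [HalfMax, HalfMin, firstOrder_localize ht α, hs, one_mul]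
  exact ⟨forall_swapHalf t.origin (P := fun x => firstOrder (t.localize α) x ≤ _),
    forall_swapHalf t.origin (P := fun x => _ ≤ firstOrder (t.localize α) x)⟩

/-- On the hatted polytopes F is minus the model function, so its maxima are the minima of the
model. -/
lemma isMaxOn_of_sign_eq_neg_one {t : Tile} (ht : t.Admissible) (hs : t.sign = -1)
    (α : Fin 6 → ℝ) (ζ : ℝ) : (IsMaxOn (firstOrder α) univ ζ ↔
      HalfMin (firstOrder (t.localize α)) (swapHalf t.origin ζ)) ∧
    (IsMinOn (firstOrder α) univ ζ ↔
      HalfMax (firstOrder (t.localize α)) (swapHalf t.origin ζ)) := by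
  rw [isMaxOn_firstOrder, isMinOn_firstOrder]
  simp only [HalfMax, HalfMin, firstOrder_localize ht α, hs, neg_one_mul, neg_le_neg_iff]
  exact ⟨forall_swapHalf t.origin (P := fun x => _ ≤ firstOrder (t.localize α) x),
    forall_swapHalf t.origin (P := fun x => firstOrder (t.localize α) x ≤ _)⟩

end Tile

lemma left_mem : (0 : ℝ) ∈ Icc (0 : ℝ) (1 / 2) := ⟨le_rfl, by norm_num⟩

lemma right_mem : (1 / 2 : ℝ) ∈ Icc (0 : ℝ) (1 / 2) := ⟨by norm_num, le_rfl⟩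

lemma halfMax_of_monotoneOn {g : ℝ → ℝ} (h : MonotoneOn g (Icc 0 (1 / 2))) :
    HalfMax g (1 / 2) := fun _ hx => h hx right_mem hx.2

lemma halfMin_of_monotoneOn {g : ℝ → ℝ} (h : MonotoneOn g (Icc 0 (1 / 2))) :
    HalfMin g 0 := fun _ hx => h left_mem hx hx.1

lemma halfMax_iff {g : ℝ → ℝ} {y z : ℝ} (hz : z ∈ Icc (0 : ℝ) (1 / 2)) (h : HalfMax g z)
    (hy : y ∈ Icc (0 : ℝ) (1 / 2)) : HalfMax g y ↔ g y = g z :=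
  ⟨fun h' => le_antisymm (h y hy) (h' z hz), fun h' x hx => h' ▸ h x hx⟩

lemma halfMin_iff {g : ℝ → ℝ} {y z : ℝ} (hz : z ∈ Icc (0 : ℝ) (1 / 2)) (h : HalfMin g z)
    (hy : y ∈ Icc (0 : ℝ) (1 / 2)) : HalfMin g y ↔ g y = g z :=
  ⟨fun h' => le_antisymm (h' z hz) (h y hy), fun h' x hx => h' ▸ h x hx⟩

/-! ### Extrema on the model shapes -/

namespace ShapeOne

variable {b : Fin 6 → ℝ}

lemma halfMax_iff (h : ShapeOne b) (hpos : ∀ r, 0 < b r) {y : ℝ} (hy : y ∈ Icc (0 : ℝ) (1 / 2)) :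
    HalfMax (firstOrder b) y ↔ HighEnd univ b y := by
  rw [BetaTiling.halfMax_iff right_mem (halfMax_of_monotoneOn h.monotoneOn) hy, (h.levels hpos hy).2]

lemma halfMin_iff (h : ShapeOne b) (hpos : ∀ r, 0 < b r) {y : ℝ} (hy : y ∈ Icc (0 : ℝ) (1 / 2)) :
    HalfMin (firstOrder b) y ↔ y = 0 := by
  rw [BetaTiling.halfMin_iff left_mem (halfMin_of_monotoneOn h.monotoneOn) hy, h.firstOrder_zero,
    (h.levels hpos hy).1]

end ShapeOne

namespace ShapeTwo

variable {a : Fin 6} {b : Fin 6 → ℝ}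

lemma halfMax_iff (h : ShapeTwo a b) (hs : negMass a b < 2 * -b a) {y : ℝ}
    (hy : y ∈ Icc (0 : ℝ) (1 / 2)) : HalfMax (firstOrder b) y ↔ HighEnd univ b y := by
  rw [BetaTiling.halfMax_iff right_mem (halfMax_of_monotoneOn h.monotoneOn) hy,
    (h.levels hs hy).2.2]

lemma halfMin_iff (h : ShapeTwo a b) (hs : negMass a b < 2 * -b a) {y : ℝ}
    (hy : y ∈ Icc (0 : ℝ) (1 / 2)) :
    HalfMin (firstOrder b) y ↔ LowEnd {r | r ≠ a} (-b) y := by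
  rw [BetaTiling.halfMin_iff left_mem (halfMin_of_monotoneOn h.monotoneOn) hy,
    (h.levels hs hy).2.1]

end ShapeTwo

namespace ShapeThree

variable {T : Finset (Fin 6)} {b : Fin 6 → ℝ}

lemma halfMin (h : ShapeThree T b) (hT : T.card = 3) : HalfMin (firstOrder b) (offset T b) :=
  fun x hx => by rw [h.firstOrder_eq_zero hT]; exact h.firstOrder_nonneg hT hx

lemma halfMax_zero (h : ShapeThree T b) (hT : T.card = 3)
    (hle : firstOrder b (1 / 2) ≤ firstOrder b 0) : HalfMax (firstOrder b) 0 := fun x hx => by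
  rcases h.firstOrder_le hT hx with h1 | h1
  · exact h1.1
  · exact h1.1.trans hle

lemma halfMax_half (h : ShapeThree T b) (hT : T.card = 3)
    (hle : firstOrder b 0 ≤ firstOrder b (1 / 2)) : HalfMax (firstOrder b) (1 / 2) := fun x hx => by
  rcases h.firstOrder_le hT hx with h1 | h1
  · exact h1.1.trans hle
  · exact h1.1

lemma exists_halfMax (h : ShapeThree T b) (hT : T.card = 3) :
    HalfMax (firstOrder b) 0 ∨ HalfMax (firstOrder b) (1 / 2) :=
  (le_total (firstOrder b (1 / 2)) (firstOrder b 0)).imp (h.halfMax_zero hT) (h.halfMax_half hT)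

lemma halfMin_iff (h : ShapeThree T b) (hT : T.card = 3) {y : ℝ}
    (hy : y ∈ Icc (0 : ℝ) (1 / 2)) : HalfMin (firstOrder b) y ↔ firstOrder b y = 0 := by
  rw [BetaTiling.halfMin_iff (h.mem hT) (h.halfMin hT) hy, h.firstOrder_eq_zero hT]

lemma halfMax_iff (h : ShapeThree T b) (hT : T.card = 3) (hs : ∀ r, r ∉ T → -offset T b < b r)
    (hs' : ∀ r, r ∈ T → offset T b < b r) {y : ℝ} (hy : y ∈ Icc (0 : ℝ) (1 / 2)) :
    HalfMax (firstOrder b) y ↔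
      firstOrder b (1 / 2) ≤ firstOrder b 0 ∧ LowEnd {r | r ∉ T} b y ∨
      firstOrder b 0 ≤ firstOrder b (1 / 2) ∧ HighEnd {r | r ∈ T} b y := by
  obtain ⟨-, hlow, hhigh, hl, hh⟩ := h.levels hT hs hs' hy
  constructor
  · intro hm
    have m0 := hm 0 left_mem
    have m1 := hm _ right_mem
    rcases h.firstOrder_le hT hy with ⟨h1, h2⟩ | ⟨h1, h2⟩
    · exact Or.inl ⟨m1.trans h1, (hlow.2 ⟨le_antisymm h1 m0, h2⟩).1⟩
    · exact Or.inr ⟨m0.trans h1, (hhigh.2 ⟨le_antisymm h1 m1, h2⟩).1⟩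
  · rintro (⟨h1, h2⟩ | ⟨h1, h2⟩)
    · rw [BetaTiling.halfMax_iff left_mem (h.halfMax_zero hT h1) hy]
      exact (hlow.1 ⟨h2, hl h2⟩).1
    · rw [BetaTiling.halfMax_iff right_mem (h.halfMax_half hT h1) hy]
      exact (hhigh.1 ⟨h2, hh h2⟩).1

end ShapeThree

namespace Tile

/-! ### Interior points -/

lemma pos_of_mem_inner {t : Tile} (ht : t.Admissible) {α : Fin 6 → ℝ} (hα : α ∈ t.inner)
    (h : t.Shape = ShapeOne) (r : Fin 6) : 0 < t.localize α r := by
  -- The barycenter, where all coordinates are positive; pushing α away from it keeps the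
  -- coordinates nonnegative.
  have hy : t.Shape fun _ => 1 / 6 := by
    rw [h]
    exact ⟨by simp, fun _ => by norm_num⟩
  obtain ⟨δ, hδ, hb⟩ := exists_extend_shape ht hα hy
  rw [h] at hb
  have := hb.2 r
  simp only [Pi.add_apply, Pi.smul_apply, Pi.sub_apply, smul_eq_mul] at this
  by_contra! hle
  nlinarith

lemma negMass_lt_of_mem_inner {t : Tile} (ht : t.Admissible) {α : Fin 6 → ℝ} (hα : α ∈ t.inner)
    {a : Fin 6} (h : t.Shape = ShapeTwo a) (hs : t.Shape (t.localize α)) :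
    negMass a (t.localize α) < 2 * -t.localize α a := by
  -- The center of the cross polytope, where all b_r + b_a vanish; moving away from it scales these
  -- numbers by 1 + δ.
  have hy : t.Shape fun r => if r = a then -(1 / 4) else 1 / 4 := by
    rw [h]
    refine ⟨?_, ?_⟩
    · rw [← Finset.add_sum_erase _ _ (Finset.mem_univ a), if_pos rfl, Finset.sum_congr rfl
        fun r hr => if_neg (Finset.mem_erase.1 hr).1, Finset.sum_const, nsmul_eq_mul, card_erase]
      norm_num
    · rw [Finset.sum_eq_zero fun r hr => ?_]
      · norm_num
      · beta_reduce
        rw [if_neg (Finset.mem_erase.1 hr).1, if_pos rfl]; norm_num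
  obtain ⟨δ, hδ, hb⟩ := exists_extend_shape ht hα hy
  rw [h] at hb hs
  have h1 := hb.2
  have h2 : ∑ r ∈ Finset.univ.erase a, |t.localize α r + t.localize α a| < 1 := by
    rw [Finset.sum_congr (g := fun r => (1 + δ) * |t.localize α r + t.localize α a|) rfl
      fun r hr => ?_, ← Finset.mul_sum] at h1
    · have h0 : 0 ≤ ∑ r ∈ Finset.univ.erase a, |t.localize α r + t.localize α a| :=
        Finset.sum_nonneg fun _ _ => abs_nonneg _
      by_contra! hle
      nlinarith
    · simp only [Pi.add_apply, Pi.smul_apply, Pi.sub_apply, smul_eq_mul, if_pos,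
        if_neg (Finset.mem_erase.1 hr).1]
      rw [← abs_of_pos (show 0 < 1 + δ by linarith), ← abs_mul]
      exact congrArg _ (by ring)
  rw [sum_abs_eq hs.1] at h2
  linarith

lemma lt_of_mem_inner {t : Tile} (ht : t.Admissible) {α : Fin 6 → ℝ} (hα : α ∈ t.inner)
    {T : Finset (Fin 6)} (hT : T.card = 3) (h : t.Shape = ShapeThree T) :
    (∀ r, r ∉ T → -offset T (t.localize α) < t.localize α r) ∧
      ∀ r, r ∈ T → offset T (t.localize α) < t.localize α r := by
  have e : ∑ r ∈ T, (if r ∈ T then 5 / 12 else -(1 / 12) : ℝ) = 5 / 4 := by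
    rw [Finset.sum_congr rfl fun r hr => if_pos hr, Finset.sum_const, hT]; norm_num
  -- The barycenter of the simplex: its offset is 1/4 and all six barycentric coordinates are 1/6.
  have hy : t.Shape fun r => if r ∈ T then 5 / 12 else -(1 / 12) := by
    rw [h]
    refine ⟨?_, fun r hr => ?_, fun r hr => ?_⟩
    · rw [← Finset.sum_add_sum_compl T, e, Finset.sum_congr rfl fun r hr =>
        if_neg (Finset.mem_compl.1 hr), Finset.sum_const, ShapeThree.card_compl hT]
      norm_num
    · beta_reduce
      rw [e, if_pos hr]; norm_num
    · beta_reduce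
      rw [e, if_neg hr]; norm_num
  obtain ⟨δ, hδ, hb⟩ := exists_extend_shape ht hα hy
  rw [h] at hb
  have e2 : ∑ r ∈ T, (t.localize α + δ • (t.localize α - fun r =>
      if r ∈ T then 5 / 12 else -(1 / 12)) : Fin 6 → ℝ) r - 1 =
      (1 + δ) * offset T (t.localize α) - δ / 4 := by
    simp only [Pi.add_apply, Pi.smul_apply, Pi.sub_apply, smul_eq_mul, Finset.sum_add_distrib,
      ← Finset.mul_sum, Finset.sum_sub_distrib]
    rw [e, offset]
    ring
  constructor
  · intro r hr
    have := hb.2.2 r hr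
    rw [e2] at this
    simp only [Pi.add_apply, Pi.smul_apply, Pi.sub_apply, smul_eq_mul, if_neg hr] at this
    by_contra! hle
    nlinarith
  · intro r hr
    have := hb.2.1 r hr
    rw [e2] at this
    simp only [Pi.add_apply, Pi.smul_apply, Pi.sub_apply, smul_eq_mul, if_pos hr] at this
    by_contra! hle
    nlinarith

end Tile

/-! ### Correct values -/

lemma sum_log_norm {lq : ℂ} {u : Fin 6 → ℂ} (h : ∏ r, u r = Complex.exp lq)
    (hu : ∀ r, u r ≠ 0) : ∑ r, Real.log ‖u r‖ = lq.re := by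
  rw [← Real.log_prod fun r _ => norm_ne_zero_iff.2 (hu r), ← norm_prod, h, Complex.norm_exp,
    Real.log_exp]

open Classical in
/-- The second order behavior can be prescribed at one point, within its size. -/
lemma exists_isOrderBehavior {lq lx : ℂ} (hlq : lq.re < 0) (α₀ : Fin 6 → ℝ) (ζ₀ : ℝ)
    (s : (Fin 6 → ℂ) → ℂ → ℂ) (hs0 : ∀ u z, (∀ r, u r ≠ 0) → z ≠ 0 → s u z ≠ 0)
    (hs : ∀ u z, ∏ r, u r = Complex.exp lq → (∀ r, u r ≠ 0) → z ≠ 0 →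
      Real.log ‖s u z‖ = lx.re * firstOrder α₀ ζ₀ +
        secondOrder lq.re α₀ ζ₀ (fun r => Real.log ‖u r‖) (Real.log ‖z‖)) :
    ∃ sob, IsOrderBehavior lq lx firstOrder sob ∧ ∀ u z, sob α₀ ζ₀ u z = s u z := by
  refine ⟨fun α ζ u z => if α = α₀ ∧ ζ = ζ₀ then s u z else
    Complex.exp ((lx.re * firstOrder α ζ +
      secondOrder lq.re α ζ (fun r => Real.log ‖u r‖) (Real.log ‖z‖) : ℝ)), ?_,
    fun u z => if_pos ⟨rfl, rfl⟩⟩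
  refine isOrderBehavior_firstOrder hlq (fun α ζ u z hu hz => ?_) fun α ζ u z _ hu hu0 hz => ?_
  · split_ifs
    · exact hs0 u z hu hz
    · exact Complex.exp_ne_zero _
  · split_ifs with h
    · rw [h.1, h.2]
      exact hs u z hu hu0 hz
    · rw [Complex.norm_exp, Complex.ofReal_re, Real.log_exp]

lemma isCorrect_iff {lq lx : ℂ} (hlq : lq.re < 0) {α : Fin 6 → ℝ} (hα : ∑ r, α r = 1) (ζ : ℝ) :
    IsCorrect lq lx α ζ ↔ firstOrder α ζ = 0 ∧ SecondOrderVanishes lq.re α ζ := by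
  constructor
  · rintro ⟨fob, sob, h, h0, h1⟩
    exact ⟨h.eq_firstOrder hlq hα ζ ▸ h0, fun lam mu hl => h.secondOrder_eq_zero hlq hα h0 h1 hl mu⟩
  · rintro ⟨h0, h1⟩
    obtain ⟨sob, h, hs⟩ := exists_isOrderBehavior (lx := lx) hlq α ζ (fun _ _ => 1)
      (fun _ _ _ _ => one_ne_zero) fun u z hu hu0 hz => by
        rw [h0, h1 _ _ (sum_log_norm hu hu0)]
        simp
    exact ⟨_, sob, h, h0, fun u z _ _ => hs u z⟩

/-- The exponent α_a corresponds to b_a in local coordinates, whereas the model computation is at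
-b_a. The reflection of ζ changes the sign of mu, and so log|u_a z| appears. -/
lemma secondOrder_two {β : Fin 6 → ℝ} (hβ : InLattice β) {a : Fin 6} {b : Fin 6 → ℝ}
    (h : ShapeTwo a b) {ℓ : ℝ} {lam : Fin 6 → ℝ} (hl : ∑ r, lam r = ℓ) (mu : ℝ) :
    secondOrder ℓ (b + β) ((b + β) a) lam mu = (2 * -b a - negMass a b) * (lam a + mu) := by
  obtain ⟨k, n, s, hk, hs, -⟩ := hβ.exists_shift
  rw [secondOrder_add k n hk hs, Pi.add_apply, hk a, show b a + (k a + s) - s = - -b a + k a by ring,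
    secondOrder_add_intCast, secondOrder_neg_right, h.secondOrder_neg_apply hl, sub_neg_eq_add]

/-- On the hyperplane this is half the slack in the ℓ¹ inequality of the cross polytope. Hence the
excess is positive in the interior and zero exactly on the boundary. -/
lemma excess_eq (β : Fin 6 → ℝ) (a : Fin 6) (α : Fin 6 → ℝ) :
    excess β a α = 2 * -(α - β) a - negMass a (α - β) := by
  rw [excess, negMass, sub_eq_add_neg _ (∑ r ∈ _, _), ← Finset.sum_neg_distrib]
  congr 1
  · simp only [Pi.sub_apply]; ring
  · refine Finset.sum_congr rfl fun r _ => ?_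
    simp only [Pi.sub_apply]
    rw [← min_neg_neg, neg_zero, neg_neg]

theorem exists_isOrderBehavior_two {lq lx : ℂ} (hlq : lq.re < 0) {β : Fin 6 → ℝ} {a : Fin 6}
    (hβ : InLattice β) {α : Fin 6 → ℝ} (h : ShapeTwo a (α - β)) (h0 : firstOrder α (α a) = 0) :
    ∃ fob sob, IsOrderBehavior lq lx fob sob ∧ fob α (α a) = 0 ∧
      ∀ (u : Fin 6 → ℂ) (z : ℂ), (∀ r, u r ≠ 0) → z ≠ 0 →
        sob α (α a) u z = ((‖u a * z‖ ^ excess β a α : ℝ) : ℂ) := by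
  obtain ⟨sob, hsob, hs⟩ := exists_isOrderBehavior (lx := lx) hlq α (α a)
    (fun u z => ((‖u a * z‖ ^ excess β a α : ℝ) : ℂ)) (fun u z hu hz => by
      rw [Complex.ofReal_ne_zero]
      exact (Real.rpow_pos_of_pos (norm_pos_iff.2 (mul_ne_zero (hu a) hz)) _).ne')
    fun u z hu hu0 hz => by
      have hpos := norm_pos_iff.2 (mul_ne_zero (hu0 a) hz)
      have e : α = α - β + β := by simp
      have e2 := secondOrder_two hβ h (sum_log_norm hu hu0) (Real.log ‖z‖)
      rw [← e] at e2
      rw [e2, h0, Complex.norm_real, Real.norm_of_nonneg (Real.rpow_nonneg hpos.le _),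
        Real.log_rpow hpos, norm_mul, Real.log_mul (norm_ne_zero_iff.2 (hu0 a))
        (norm_ne_zero_iff.2 hz), excess_eq]
      ring
  exact ⟨_, sob, hsob, h0, fun u z _ _ => hs u z⟩

namespace Tile

/-- The correct value of `ζ` in local coordinates. -/
noncomputable def baseZeta : Tile → (Fin 6 → ℝ) → ℝ
  | one _, _ => 0
  | oneHat _, _ => 0
  | two _ a, b => -b a
  | three _ T, b => offset T b
  | threeHat _ T, b => offset T b

lemma localize_apply (t : Tile) (α : Fin 6 → ℝ) (r : Fin 6) :
    t.localize α r = t.sign * (α r - t.origin r) := rfl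

lemma swapHalf_of_isIntVec {β : Fin 6 → ℝ} (h : IsIntVec β) (ζ : ℝ) : swapHalf β ζ = ζ :=
  if_pos h

lemma equivalent_correctZeta {t : Tile} (ht : t.Admissible) (α : Fin 6 → ℝ) :
    Equivalent (swapHalf t.origin (t.correctZeta α)) (t.baseZeta (t.localize α)) := by
  cases t with
  | one β =>
    simp only [correctZeta, baseZeta, origin, swapHalf_swapHalf]
    exact Equivalent.refl 0
  | oneHat γ =>
    simp only [correctZeta, baseZeta, origin, swapHalf_swapHalf]
    exact Equivalent.refl 0
  | two β a =>
    obtain ⟨k, n, s, hk, hs, he⟩ := ht.1.exists_shift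
    refine (he (α a)).symm.trans ⟨k a, Or.inr ?_⟩
    simp only [baseZeta, localize_apply, sign, origin, hk a]
    ring
  | three β T =>
    obtain ⟨k, hk⟩ := ht.1
    refine ⟨∑ r ∈ T, k r + 1, Or.inl ?_⟩
    simp only [correctZeta, baseZeta, origin, swapHalf_of_isIntVec ht.1, offset, localize_apply,
      sign, hk, ← Finset.mul_sum, Finset.sum_sub_distrib]
    push_cast
    ring
  | threeHat γ T =>
    obtain ⟨k, hk⟩ := ht.1
    refine ⟨∑ r ∈ T, k r - 1, Or.inr ?_⟩
    simp only [correctZeta, baseZeta, origin, swapHalf_of_isIntVec ht.1, offset, localize_apply,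
      sign, hk, ← Finset.mul_sum, Finset.sum_sub_distrib]
    push_cast
    ring

lemma equivalent_correctZeta_iff {t : Tile} (ht : t.Admissible) (α : Fin 6 → ℝ) (ζ : ℝ) :
    Equivalent ζ (t.correctZeta α) ↔
      Equivalent (swapHalf t.origin ζ) (t.baseZeta (t.localize α)) := by
  rw [← equivalent_swapHalf_iff t.origin]
  exact ⟨fun h => h.trans (equivalent_correctZeta ht α),
    fun h => h.trans (equivalent_correctZeta ht α).symm⟩

lemma firstOrder_baseZeta {t : Tile} (ht : t.Admissible) {b : Fin 6 → ℝ} (hb : t.Shape b) :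
    firstOrder b (t.baseZeta b) = 0 := by
  cases t with
  | one β => exact ShapeOne.firstOrder_zero hb
  | oneHat γ => exact ShapeOne.firstOrder_zero hb
  | two β a => exact ShapeTwo.firstOrder_eq_zero hb
  | three β T => exact ShapeThree.firstOrder_eq_zero hb ht.2.2
  | threeHat γ T => exact ShapeThree.firstOrder_eq_zero hb ht.2.2

lemma baseZeta_mem {t : Tile} (ht : t.Admissible) {b : Fin 6 → ℝ} (hb : t.Shape b) :
    t.baseZeta b ∈ Icc (0 : ℝ) (1 / 2) := by
  cases t with
  | one β => exact left_mem
  | oneHat γ => exact left_mem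
  | two β a => exact ShapeTwo.mem hb
  | three β T => exact ShapeThree.mem hb ht.2.2
  | threeHat γ T => exact ShapeThree.mem hb ht.2.2

lemma eq_baseZeta {t : Tile} (ht : t.Admissible) {b : Fin 6 → ℝ} (hb : t.Shape b) {ℓ ζ : ℝ}
    (hℓ : ℓ ≠ 0) (hζ : ζ ∈ Icc (0 : ℝ) (1 / 2)) (hv : SecondOrderVanishes ℓ b ζ) :
    ζ = t.baseZeta b := by
  cases t with
  | one β => exact ShapeOne.eq_zero_of_secondOrderVanishes hb hℓ hζ hv
  | oneHat γ => exact ShapeOne.eq_zero_of_secondOrderVanishes hb hℓ hζ hv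
  | two β a => exact ShapeTwo.eq_of_secondOrderVanishes hb hℓ hζ hv
  | three β T => exact ShapeThree.eq_of_secondOrderVanishes hb ht.2.2 hℓ hζ hv
  | threeHat γ T => exact ShapeThree.eq_of_secondOrderVanishes hb ht.2.2 hℓ hζ hv

lemma secondOrderVanishes_baseZeta {t : Tile} (ht : t.Admissible) {α : Fin 6 → ℝ}
    (hb : t.Shape (t.localize α)) (ℓ : ℝ) :
    SecondOrderVanishes ℓ (t.localize α) (t.baseZeta (t.localize α)) ↔
      t.SecondOrderCondition α := by
  cases t with
  | one β => exact iff_of_true (ShapeOne.secondOrderVanishes hb ℓ) trivial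
  | oneHat γ => exact iff_of_true (ShapeOne.secondOrderVanishes hb ℓ) trivial
  | two β a =>
    refine (ShapeTwo.secondOrderVanishes_iff hb ℓ).trans ?_
    simp only [SecondOrderCondition, excess_eq, localize, sign, origin, one_smul]
  | three β T => exact iff_of_true (ShapeThree.secondOrderVanishes hb ht.2.2 ℓ) trivial
  | threeHat γ T => exact iff_of_true (ShapeThree.secondOrderVanishes hb ht.2.2 ℓ) trivial

lemma sum_eq_one {t : Tile} (ht : t.Admissible) {α : Fin 6 → ℝ} (hα : α ∈ t.body) :
    ∑ r, α r = 1 := by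
  have : α ∈ ⋃ t ∈ {t : Tile | t.Admissible}, t.body := mem_biUnion (x := t) ht hα
  rwa [iUnion_body] at this

theorem firstOrder_correctZeta {t : Tile} (ht : t.Admissible) {α : Fin 6 → ℝ} (hα : α ∈ t.body) :
    firstOrder α (t.correctZeta α) = 0 := by
  rw [firstOrder_localize ht, (equivalent_correctZeta ht α).firstOrder_eq,
    firstOrder_baseZeta ht ((mem_body_iff ht α).1 hα), mul_zero]

/-- Vanishing of Q alone confines ζ to the tabulated class, and F vanishes there automatically. -/
theorem isCorrect_iff {t : Tile} (ht : t.Admissible) {α : Fin 6 → ℝ} (hα : α ∈ t.body)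
    {lq lx : ℂ} (hlq : lq.re < 0) (ζ : ℝ) : IsCorrect lq lx α ζ ↔
      Equivalent ζ (t.correctZeta α) ∧ t.SecondOrderCondition α := by
  have hb := (mem_body_iff ht α).1 hα
  rw [BetaTiling.isCorrect_iff hlq (sum_eq_one ht hα), equivalent_correctZeta_iff ht,
    ← secondOrderVanishes_baseZeta ht hb lq.re, secondOrderVanishes_localize ht,
    firstOrder_localize ht]
  constructor
  -- The condition F = 0 is discarded: on the boundary it may hold at further ζ, while Q still
  -- singles out one class.
  · rintro ⟨-, hv⟩
    obtain ⟨y, hy, he⟩ := exists_equivalent (swapHalf t.origin ζ)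
    rw [he.secondOrderVanishes] at hv
    have := eq_baseZeta ht hb hlq.ne hy hv
    rw [this] at he hv
    exact ⟨he, hv⟩
  · rintro ⟨he, hv⟩
    rw [he.firstOrder_eq, he.secondOrderVanishes, firstOrder_baseZeta ht hb]
    exact ⟨mul_zero _, hv⟩

lemma firstOrder_eq_zero_iff_of_mem_inner {t : Tile} (ht : t.Admissible) {α : Fin 6 → ℝ}
    (hα : α ∈ t.inner) (hb : t.Shape (t.localize α)) {y : ℝ} (hy : y ∈ Icc (0 : ℝ) (1 / 2)) :
    firstOrder (t.localize α) y = 0 ↔ y = t.baseZeta (t.localize α) := by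
  cases t with
  | one β => exact (ShapeOne.levels hb (pos_of_mem_inner ht hα rfl) hy).1
  | oneHat γ => exact (ShapeOne.levels hb (pos_of_mem_inner ht hα rfl) hy).1
  | two β a => exact (ShapeTwo.levels hb (negMass_lt_of_mem_inner ht hα rfl hb) hy).1
  | three β T =>
    obtain ⟨h1, h2⟩ := lt_of_mem_inner ht hα ht.2.2 rfl
    exact (ShapeThree.levels hb ht.2.2 h1 h2 hy).1
  | threeHat γ T =>
    obtain ⟨h1, h2⟩ := lt_of_mem_inner ht hα ht.2.2 rfl
    exact (ShapeThree.levels hb ht.2.2 h1 h2 hy).1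

theorem firstOrder_eq_zero_iff {t : Tile} (ht : t.Admissible) {α : Fin 6 → ℝ}
    (hα : α ∈ t.inner) (hb : t.Shape (t.localize α)) (ζ : ℝ) :
    firstOrder α ζ = 0 ↔ Equivalent ζ (t.correctZeta α) := by
  have hs : t.sign ≠ 0 := by rcases t.sign_eq with h | h <;> rw [h] <;> norm_num
  obtain ⟨y, hy, he⟩ := exists_equivalent (swapHalf t.origin ζ)
  rw [equivalent_correctZeta_iff ht, firstOrder_localize ht, mul_eq_zero, or_iff_right hs,
    he.firstOrder_eq, firstOrder_eq_zero_iff_of_mem_inner ht hα hb hy]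
  exact ⟨fun h => h ▸ he, fun h => (he.symm.trans h).eq_of_mem hy (baseZeta_mem ht hb)⟩

/-! ### The table of extrema -/

theorem exists_isMaxOn {t : Tile} (ht : t.Admissible) {α : Fin 6 → ℝ} (hα : α ∈ t.body) :
    (∃ ζ ∈ t.maxTable α, IsMaxOn (firstOrder α) univ ζ) ∧
      ∃ ζ ∈ t.minTable α, IsMinOn (firstOrder α) univ ζ := by
  have hb := (mem_body_iff ht α).1 hα
  have h0 := firstOrder_correctZeta ht hα
  cases t with
  | one β =>
    have h1 := isMaxOn_of_sign_eq_one ht rfl α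
    exact ⟨⟨_, rfl, (h1 _).1.2 (by
        simp only [origin, swapHalf_swapHalf]; exact halfMax_of_monotoneOn (ShapeOne.monotoneOn hb))⟩,
      ⟨_, rfl, (h1 _).2.2 (by
        simp only [origin, swapHalf_swapHalf]; exact halfMin_of_monotoneOn (ShapeOne.monotoneOn hb))⟩⟩
  | oneHat γ =>
    have h1 := isMaxOn_of_sign_eq_neg_one ht rfl α
    exact ⟨⟨_, rfl, (h1 _).1.2 (by
        simp only [origin, swapHalf_swapHalf]; exact halfMin_of_monotoneOn (ShapeOne.monotoneOn hb))⟩,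
      ⟨_, rfl, (h1 _).2.2 (by
        simp only [origin, swapHalf_swapHalf]; exact halfMax_of_monotoneOn (ShapeOne.monotoneOn hb))⟩⟩
  | two β a =>
    have h1 := isMaxOn_of_sign_eq_one ht rfl α
    exact ⟨⟨_, rfl, (h1 _).1.2 (by
        simp only [origin, swapHalf_swapHalf]; exact halfMax_of_monotoneOn (ShapeTwo.monotoneOn hb))⟩,
      ⟨_, rfl, (h1 _).2.2 (by
        simp only [origin, swapHalf_swapHalf]; exact halfMin_of_monotoneOn (ShapeTwo.monotoneOn hb))⟩⟩
  | three β T =>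
    have h1 := isMaxOn_of_sign_eq_one ht rfl α
    simp only [origin, swapHalf_of_isIntVec ht.1] at h1
    refine ⟨?_, _, rfl, (isMinOn_firstOrder _ _).2 fun x hx => ?_⟩
    · rcases ShapeThree.exists_halfMax hb ht.2.2 with h | h
      · exact ⟨0, Or.inl rfl, (h1 _).1.2 h⟩
      · exact ⟨1 / 2, Or.inr rfl, (h1 _).1.2 h⟩
    · refine h0.le.trans ?_
      rw [firstOrder_localize ht]
      simpa only [sign, one_mul, origin, swapHalf_of_isIntVec ht.1] using
        ShapeThree.firstOrder_nonneg hb ht.2.2 hx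
  | threeHat γ T =>
    have h1 := isMaxOn_of_sign_eq_neg_one ht rfl α
    simp only [origin, swapHalf_of_isIntVec ht.1] at h1
    refine ⟨⟨_, rfl, (isMaxOn_firstOrder _ _).2 fun x hx => ?_⟩, ?_⟩
    · refine le_trans ?_ h0.ge
      rw [firstOrder_localize ht]
      simpa only [sign, neg_one_mul, origin, swapHalf_of_isIntVec ht.1, neg_nonpos] using
        ShapeThree.firstOrder_nonneg hb ht.2.2 hx
    · rcases ShapeThree.exists_halfMax hb ht.2.2 with h | h
      · exact ⟨0, Or.inl rfl, (h1 _).2.2 h⟩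
      · exact ⟨1 / 2, Or.inr rfl, (h1 _).2.2 h⟩

theorem isMaxOn_iff {t : Tile} (ht : t.Admissible) {α : Fin 6 → ℝ} (hα : α ∈ t.inner)
    (hb : t.Shape (t.localize α)) {ζ : ℝ} (hζ : ζ ∈ Icc (0 : ℝ) (1 / 2)) :
    (IsMaxOn (firstOrder α) univ ζ ↔ t.MaxAt α (firstOrder α) ζ) ∧
      (IsMinOn (firstOrder α) univ ζ ↔ t.MinAt α (firstOrder α) ζ) := by
  have hy := swapHalf_mem (β := t.origin) hζ
  have hz := firstOrder_eq_zero_iff ht hα hb ζ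
  have eq_iff : ∀ γ : Fin 6 → ℝ, swapHalf γ ζ = 0 ↔ ζ = swapHalf γ 0 := fun γ =>
    ⟨fun h => by rw [← h, swapHalf_swapHalf], fun h => by rw [h, swapHalf_swapHalf]⟩
  cases t with
  | one β =>
    have hpos := pos_of_mem_inner ht hα rfl
    have h1 := isMaxOn_of_sign_eq_one ht rfl α ζ
    have e : (one β).localize α = α - β := one_smul _ _
    rw [h1.1, h1.2, ShapeOne.halfMax_iff hb hpos hy, ShapeOne.halfMin_iff hb hpos hy, e]
    exact ⟨Iff.rfl, eq_iff β⟩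
  | oneHat γ =>
    have hpos := pos_of_mem_inner ht hα rfl
    have h1 := isMaxOn_of_sign_eq_neg_one ht rfl α ζ
    have e : (oneHat γ).localize α = γ - α := by simp [localize, sign, origin]
    rw [h1.1, h1.2, ShapeOne.halfMax_iff hb hpos hy, ShapeOne.halfMin_iff hb hpos hy, e]
    exact ⟨eq_iff γ, Iff.rfl⟩
  | two β a =>
    have hs := negMass_lt_of_mem_inner ht hα rfl hb
    have h1 := isMaxOn_of_sign_eq_one ht rfl α ζ
    have e : (two β a).localize α = α - β := one_smul _ _
    rw [h1.1, h1.2, ShapeTwo.halfMax_iff hb hs hy, ShapeTwo.halfMin_iff hb hs hy, e, neg_sub]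
    exact ⟨Iff.rfl, Iff.rfl⟩
  | three β T =>
    obtain ⟨hs, hs'⟩ := lt_of_mem_inner ht hα ht.2.2 rfl
    have h1 := isMaxOn_of_sign_eq_one ht rfl α ζ
    have hF := firstOrder_localize ht α
    have e : (three β T).localize α = α - β := one_smul _ _
    simp only [origin, swapHalf_of_isIntVec ht.1, sign, one_mul] at h1 hF
    rw [h1.1, h1.2, ShapeThree.halfMax_iff hb ht.2.2 hs hs' hζ, ShapeThree.halfMin_iff hb ht.2.2 hζ,
      ← hF, ← hF, ← hF, hz, e]
    exact ⟨Iff.rfl, Iff.rfl⟩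
  | threeHat γ T =>
    obtain ⟨hs, hs'⟩ := lt_of_mem_inner ht hα ht.2.2 rfl
    have h1 := isMaxOn_of_sign_eq_neg_one ht rfl α ζ
    have hF := firstOrder_localize ht α
    have e : (threeHat γ T).localize α = γ - α := by simp [localize, sign, origin]
    simp only [origin, swapHalf_of_isIntVec ht.1, sign, neg_one_mul] at h1 hF
    have hF' : ∀ x, firstOrder ((threeHat γ T).localize α) x = -firstOrder α x := fun x => by
      rw [hF, neg_neg]
    rw [h1.1, h1.2, ShapeThree.halfMax_iff hb ht.2.2 hs hs' hζ, ShapeThree.halfMin_iff hb ht.2.2 hζ,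
      hF', hF', hF', neg_eq_zero, neg_le_neg_iff, neg_le_neg_iff, hz, e]
    exact ⟨Iff.rfl, Iff.rfl⟩

end Tile

end BetaTiling

theorem mainTheorem3 :
    -- the tiling of the balancing hyperplane
    ((∀ t : BetaTiling.Tile, t.Admissible → t.HasShape) ∧
      (⋃ t ∈ {t : BetaTiling.Tile | t.Admissible}, t.body) = {α : Fin 6 → ℝ | ∑ r, α r = 1} ∧
      (∀ s t : BetaTiling.Tile, s.Admissible → t.Admissible → s ≠ t →
        Disjoint s.inner t.inner)) ∧
    ∀ lq lx : ℂ, lq.re < 0 →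
      -- the integrand has a first and a second order behavior
      (∃ fob sob, BetaTiling.IsOrderBehavior lq lx fob sob) ∧
      -- the correct value of `ζ`
      (∀ t : BetaTiling.Tile, t.Admissible → ∀ α ∈ t.body, ∀ ζ : ℝ,
        BetaTiling.IsCorrect lq lx α ζ ↔
          BetaTiling.Equivalent ζ (t.correctZeta α) ∧ t.SecondOrderCondition α) ∧
      -- the behavior at the tabulated value on the cross polytopes
      (∀ (β : Fin 6 → ℝ) (a : Fin 6), (BetaTiling.Tile.two β a).Admissible →
        ∀ α ∈ (BetaTiling.Tile.two β a).body,
          ∃ fob sob, BetaTiling.IsOrderBehavior lq lx fob sob ∧ fob α (α a) = 0 ∧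
            ∀ (u : Fin 6 → ℂ) (z : ℂ), (∀ r, u r ≠ 0) → z ≠ 0 →
              sob α (α a) u z = ((‖u a * z‖ ^ BetaTiling.excess β a α : ℝ) : ℂ)) ∧
      -- the first order behavior
      (∀ fob sob, BetaTiling.IsOrderBehavior lq lx fob sob →
        (∀ (α : Fin 6 → ℝ) (ζ : ℝ), ∑ r, α r = 1 →
          fob α (ζ + 1) = fob α ζ ∧ fob α (-ζ) = fob α ζ) ∧
        ∀ t : BetaTiling.Tile, t.Admissible →
          (∀ α ∈ t.body,
            fob α (t.correctZeta α) = 0 ∧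
            (∃ ζ ∈ t.maxTable α, IsMaxOn (fob α) Set.univ ζ) ∧
            (∃ ζ ∈ t.minTable α, IsMinOn (fob α) Set.univ ζ)) ∧
          (∀ α ∈ t.inner,
            (∀ ζ : ℝ, fob α ζ = 0 ↔ BetaTiling.Equivalent ζ (t.correctZeta α)) ∧
            ∀ ζ ∈ Set.Icc (0 : ℝ) (1 / 2),
              (IsMaxOn (fob α) Set.univ ζ ↔ t.MaxAt α (fob α) ζ) ∧
              (IsMinOn (fob α) Set.univ ζ ↔ t.MinAt α (fob α) ζ))) := by
  refine ⟨⟨fun t ht => BetaTiling.Tile.hasShape ht, BetaTiling.iUnion_body,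
    fun s t hs ht hst => BetaTiling.Tile.disjoint_inner hs ht hst⟩, fun lq lx hlq => ?_⟩
  refine ⟨?_, fun t ht α hα ζ => BetaTiling.Tile.isCorrect_iff ht hα hlq ζ, ?_, ?_⟩
  -- The point (0, 0) is arbitrary; the value prescribed there is the one that the general formula
  -- would give.
  · obtain ⟨sob, h, -⟩ := BetaTiling.exists_isOrderBehavior (lx := lx) hlq 0 0
      (fun u z => Complex.exp ((lx.re * BetaTiling.firstOrder 0 0 + BetaTiling.secondOrder lq.re 0 0
        (fun r => Real.log ‖u r‖) (Real.log ‖z‖) : ℝ))) (fun _ _ _ _ => Complex.exp_ne_zero _)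
      fun u z _ _ _ => by rw [Complex.norm_exp, Complex.ofReal_re, Real.log_exp]
    exact ⟨_, sob, h⟩
  · intro β a ht α hα
    have hb := (BetaTiling.Tile.mem_body_iff ht α).1 hα
    have e : (BetaTiling.Tile.two β a).localize α = α - β := one_smul _ _
    rw [e] at hb
    exact BetaTiling.exists_isOrderBehavior_two hlq ht.1 hb
      (BetaTiling.Tile.firstOrder_correctZeta ht hα)
  · intro fob sob h
    -- Off the hyperplane `fob` is unconstrained, so the identification holds only where the
    -- exponents sum to 1.
    have hfob : ∀ α : Fin 6 → ℝ, ∑ r, α r = 1 → fob α = BetaTiling.firstOrder α :=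
      fun α hα => funext fun ζ => h.eq_firstOrder hlq hα ζ
    refine ⟨fun α ζ hα => ?_, fun t ht => ⟨fun α hα => ?_, fun α hα => ?_⟩⟩
    · rw [hfob α hα, BetaTiling.firstOrder_neg_right]
      exact ⟨by simpa using BetaTiling.firstOrder_add_intCast α ζ 1, rfl⟩
    · rw [hfob α (BetaTiling.Tile.sum_eq_one ht hα)]
      exact ⟨BetaTiling.Tile.firstOrder_correctZeta ht hα, BetaTiling.Tile.exists_isMaxOn ht hα⟩
    · have hα' : α ∈ t.body := intrinsicInterior_subset hα
      have hb := (BetaTiling.Tile.mem_body_iff ht α).1 hα'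
      rw [hfob α (BetaTiling.Tile.sum_eq_one ht hα')]
      exact ⟨BetaTiling.Tile.firstOrder_eq_zero_iff ht hα hb,
        fun ζ hζ => BetaTiling.Tile.isMaxOn_iff ht hα hb hζ⟩
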